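/- Let $K$ be a field and let $f\colon X\to Y$ be a finite surjective separable morphism of smooth $K$-varieties (integral separated $K$-schemes of finite type, smooth over $K$; separable means that the extension of function fields $K(X)/K(Y)$ is separable), both of dimension $n$. Let $L$ be a line bundle on $X$ and $\psi\colon L\otimes L\xrightarrow{\ \sim\ }\mathcal{H}om(\det\mathcal T_X,f^*\det\mathcal T_Y)$ an isomorphism (a relative orientation of $f$). Assume that $L$ is $f$-Ulrich, i.e. $f_*L\cong\mathcal O_Y^{\oplus t}$ for some $t>0$, and that $H^0(Y,\mathcal O_Y)=K$. For $s,t\in H^0(Y,f_*L)=H^0(X,L)$ write $\psi(s\otimes t)=b\cdot\det(\mathrm Tf)$ with a rational function $b\in K(X)$, where $\mathrm Tf\colon\mathcal T_X\to f^*\mathcal T_Y$ is the differential of $f$, and put $\bar\psi(s,t)=\operatorname{Tr}_{K(X)/K(Y)}(b)$. Then $H^0(Y,f_*L)$ is a finite-dimensional $K$-vector space, $\bar\psi$ takes values in $K=H^0(Y,\mathcal O_Y)$, and $$\bar\psi\colon H^0(Y,f_*L)\times H^0(Y,f_*L)\to K$$ is a non-degenerate symmetric $K$-bilinear form. Moreover,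 the $\mathbb A^1$-degree of $f$ is well-defined and equals the class of $\bar\psi$ in the Grothendieck--Witt group $\operatorname{GW}(K)$. That is, for every closed point $y\in Y$ outside the branch locus of $f$ one has $$\deg^{\mathbb A^1}_y(f):=\sum_{x\in f^{-1}(y)}\Big[(a,a')\mapsto\operatorname{Tr}_{\kappa(x)/\kappa(y)}(g_x\,a\,a')\Big]=[\bar\psi]\otimes_K\kappa(y)\quad\text{in }\operatorname{GW}(\kappa(y)),$$ where $g_x\in\kappa(x)$ is any element such that, in the fibre at $x$, $\det(\mathrm T_xf)=g_x\cdot\psi(t_x\otimes t_x)$ for some $t_x$ in the fibre of $L$ at $x$. -/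

import Mathlib

open CategoryTheory AlgebraicGeometry TensorProduct

universe u

/-! ### The Grothendieck-Witt group -/

/-- A non-degenerate symmetric bilinear form on a finite dimensional `k`-vector space. -/
structure SymmBilinSpace (k : Type u) [Field k] where
  carrier : Type u
  [addCommGroup : AddCommGroup carrier]
  [module : Module k carrier]
  [finite : Module.Finite k carrier]
  form : LinearMap.BilinForm k carrier
  symm : form.IsSymm
  nondegenerate : form.Nondegenerate

namespace SymmBilinSpace

attribute [instance] addCommGroup module finite

section

variable {k : Type u} [Field k]

/-- Isometry of bilinear spaces. -/
def Isometric (M N : SymmBilinSpace k) : Prop :=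
  ∃ e : M.carrier ≃ₗ[k] N.carrier, ∀ x y, N.form (e x) (e y) = M.form x y

instance setoid (k : Type u) [Field k] : Setoid (SymmBilinSpace k) where
  r := Isometric
  iseqv :=
    { refl := fun _ => ⟨LinearEquiv.refl _ _, fun _ _ => rfl⟩
      symm := fun ⟨e, he⟩ => ⟨e.symm, fun x y => by simp [← he]⟩
      trans := fun ⟨e, he⟩ ⟨e', he'⟩ => ⟨e.trans e', fun x y => by simp [he, he']⟩ }

/-- The orthogonal sum. -/
noncomputable def sum (M N : SymmBilinSpace k) : SymmBilinSpace k where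
  carrier := M.carrier × N.carrier
  form := M.form.comp (LinearMap.fst k _ _) (LinearMap.fst k _ _) +
    N.form.comp (LinearMap.snd k _ _) (LinearMap.snd k _ _)
  symm := ⟨fun x y => by simp [M.symm.eq, N.symm.eq]⟩
  nondegenerate := by
    constructor
    · rintro ⟨x, y⟩ h
      refine Prod.ext (M.nondegenerate.1 x fun z => ?_) (N.nondegenerate.1 y fun z => ?_)
      · simpa using h (z, 0)
      · simpa using h (0, z)
    · rintro ⟨x, y⟩ h
      refine Prod.ext (M.nondegenerate.2 x fun z => ?_) (N.nondegenerate.2 y fun z => ?_)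
      · simpa using h (z, 0)
      · simpa using h (0, z)

@[simp] lemma sum_form (M N : SymmBilinSpace k) (x y : M.carrier × N.carrier) :
    (M.sum N).form x y = M.form x.1 y.1 + N.form x.2 y.2 := rfl

/-- The zero form. -/
def zero (k : Type u) [Field k] : SymmBilinSpace k where
  carrier := PUnit
  form := 0
  symm := ⟨fun _ _ => rfl⟩
  nondegenerate := ⟨fun _ _ => rfl, fun _ _ => rfl⟩

/-- The set of isometry classes of non-degenerate symmetric bilinear forms over `k`. -/
def IsometryClass (k : Type u) [Field k] : Type (u + 1) := Quotient (setoid k)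

lemma sum_congr {M M' N N' : SymmBilinSpace k} (h : Isometric M M') (h' : Isometric N N') :
    Isometric (M.sum N) (M'.sum N') := by
  obtain ⟨e, he⟩ := h
  obtain ⟨e', he'⟩ := h'
  refine ⟨e.prodCongr e', fun x y => ?_⟩
  have h₁ := he x.1 y.1
  have h₂ := he' x.2 y.2
  exact congrArg₂ (· + ·) h₁ h₂

noncomputable instance : Add (IsometryClass k) :=
  ⟨Quotient.map₂ sum fun _ _ h _ _ h' => sum_congr h h'⟩

instance : Zero (IsometryClass k) := ⟨Quotient.mk _ (zero k)⟩

noncomputable instance : AddCommMonoid (IsometryClass k) where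
  add_assoc := by
    rintro ⟨M⟩ ⟨N⟩ ⟨P⟩
    exact Quotient.sound ⟨LinearEquiv.prodAssoc k _ _ _, fun x y => (add_assoc _ _ _).symm⟩
  zero_add := by
    rintro ⟨M⟩
    exact Quotient.sound ⟨LinearEquiv.uniqueProd (R := k) (M := M.carrier) (M₂ := PUnit.{u + 1}),
      fun x y => (zero_add _).symm⟩
  add_zero := by
    rintro ⟨M⟩
    exact Quotient.sound ⟨LinearEquiv.prodUnique (R := k) (M := M.carrier) (M₂ := PUnit.{u + 1}),
      fun x y => (add_zero _).symm⟩
  add_comm := by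
    rintro ⟨M⟩ ⟨N⟩
    exact Quotient.sound ⟨LinearEquiv.prodComm k _ _, fun x y => add_comm _ _⟩
  nsmul := nsmulRec

end

/-- Extension of scalars `M ↦ M ⊗ₖ l`. -/
noncomputable def baseChange {k : Type u} [Field k] (l : Type u) [Field l] [Algebra k l]
    (M : SymmBilinSpace k) : SymmBilinSpace l where
  carrier := l ⊗[k] M.carrier
  form := M.form.baseChange l
  symm := ⟨fun x y => (LinearMap.BilinForm.IsSymm.baseChange l (B₂ := M.form) ⟨M.symm.eq⟩).eq x y⟩
  nondegenerate := by
    classical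
    let b := Module.finBasis k M.carrier
    have h := (LinearMap.BilinForm.nondegenerate_toMatrix_iff b).2 M.nondegenerate
    rw [Matrix.nondegenerate_iff_det_ne_zero] at h
    rw [← LinearMap.BilinForm.nondegenerate_toMatrix_iff (b.baseChange l),
      Matrix.nondegenerate_iff_det_ne_zero]
    have e : LinearMap.BilinForm.toMatrix (b.baseChange l) (M.form.baseChange l) =
        (algebraMap k l).mapMatrix (LinearMap.BilinForm.toMatrix b M.form) := by
      ext i j
      simp [LinearMap.BilinForm.toMatrix_apply, Algebra.algebraMap_eq_smul_one]
    rw [e, ← RingHom.map_det]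
    simpa using h

section

variable {k l : Type u} [Field k] [Field l] [Algebra k l]

lemma baseChange_congr {M N : SymmBilinSpace k} (h : Isometric M N) :
    Isometric (M.baseChange l) (N.baseChange l) := by
  obtain ⟨e, he⟩ := h
  refine ⟨e.baseChange k l _ _, fun x y => ?_⟩
  have : (N.form.baseChange l).comp (e.baseChange k l _ _).toLinearMap
      (e.baseChange k l _ _).toLinearMap = M.form.baseChange l := by
    ext x y
    simp [he]
  exact congr($this x y)

lemma baseChange_zero : Isometric ((zero k).baseChange l) (zero l) := by
  have : Subsingleton (l ⊗[k] PUnit.{u + 1}) := inferInstance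
  refine ⟨{ (0 : l ⊗[k] PUnit.{u + 1} →ₗ[l] PUnit.{u + 1}) with
    invFun := fun _ => 0
    left_inv := fun _ => this.elim _ _
    right_inv := fun _ => rfl }, fun x y => ?_⟩
  have h : x = 0 := this.elim _ _
  exact (LinearMap.congr_fun ((congrArg ((zero k).baseChange l).form h).trans (map_zero _)) y).symm

lemma baseChange_sum_form {V W : Type u} [AddCommGroup V] [Module k V] [AddCommGroup W]
    [Module k W] (B : LinearMap.BilinForm k V) (C : LinearMap.BilinForm k W)
    (x y : l ⊗[k] (V × W)) :
    B.baseChange l (TensorProduct.prodRight k l l V W x).1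
        (TensorProduct.prodRight k l l V W y).1 +
      C.baseChange l (TensorProduct.prodRight k l l V W x).2
        (TensorProduct.prodRight k l l V W y).2 =
    LinearMap.BilinForm.baseChange l (B.comp (LinearMap.fst k V W) (LinearMap.fst k V W) +
      C.comp (LinearMap.snd k V W) (LinearMap.snd k V W)) x y := by
  induction x with
  | zero => simp
  | add x x' h h' =>
    simp only [map_add, Prod.fst_add, Prod.snd_add, LinearMap.add_apply, ← h, ← h']
    abel
  | tmul a x =>
    induction y with
    | zero => simp
    | add y y' h h' =>
      simp only [map_add, Prod.fst_add, Prod.snd_add, ← h, ← h']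
      abel
    | tmul b y => simp [add_smul]

lemma baseChange_sum (M N : SymmBilinSpace k) :
    Isometric ((M.sum N).baseChange l) ((M.baseChange l).sum (N.baseChange l)) :=
  ⟨TensorProduct.prodRight k l l _ _, baseChange_sum_form M.form N.form⟩

end

/-- Extension of scalars along `φ` on isometry classes, as a monoid homomorphism. -/
noncomputable def IsometryClass.map {k l : Type u} [Field k] [Field l] (φ : k →+* l) :
    IsometryClass k →+ IsometryClass l :=
  letI := φ.toAlgebra
  { toFun := Quotient.map (baseChange l) fun _ _ h => baseChange_congr h
    map_zero' := Quotient.sound baseChange_zero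
    map_add' := by
      rintro ⟨M⟩ ⟨N⟩
      exact Quotient.sound (baseChange_sum M N) }

end SymmBilinSpace

/-- The Grothendieck-Witt group. -/
abbrev GW (k : Type u) [Field k] : Type (u + 1) :=
  Algebra.GrothendieckAddGroup (SymmBilinSpace.IsometryClass k)

namespace GW

/-- The extension of scalars `d ↦ d ⊗ₖ l` from `GW(k)` to `GW(l)` along `φ : k → l`. -/
noncomputable def map {k l : Type u} [Field k] [Field l] (φ : k →+* l) : GW k →+ GW l :=
  Algebra.GrothendieckAddGroup.lift
    (Algebra.GrothendieckAddGroup.of.comp (SymmBilinSpace.IsometryClass.map φ))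

open Classical in
/-- The class in `GW(k)` of a bilinear form on a `k`-vector space; this is `0` by
convention unless the form is symmetric, non-degenerate and finite dimensional. -/
noncomputable def ofForm {k V : Type u} [Field k] [AddCommGroup V] [Module k V]
    (β : LinearMap.BilinForm k V) : GW k :=
  if h : Module.Finite k V ∧ β.IsSymm ∧ β.Nondegenerate then
    letI := h.1
    Algebra.GrothendieckAddGroup.of
      (Quotient.mk (SymmBilinSpace.setoid k) ⟨V, β, h.2.1, h.2.2⟩)
  else 0

end GW

/-! ### Determinants of modules of derivations -/

namespace DetHom

/-- For a `B`-linear map `φ` from a `B`-module `M` to a `C`-module `N`, where `C` is a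
`B`-algebra, this is the `B`-linear map `m₁ ∧ ⋯ ∧ mₙ ↦ φ m₁ ∧ ⋯ ∧ φ mₙ` from the exterior power
of `M` over `B` to the exterior power of `N` over `C`. -/
noncomputable def extMap {B M N : Type u} (C : Type u) [CommRing B] [CommRing C] [Algebra B C]
    [AddCommGroup M] [Module B M] [AddCommGroup N] [Module B N] [Module C N] [IsScalarTower B C N]
    (n : ℕ) (φ : M →ₗ[B] N) : ⋀[B]^n M →ₗ[B] ⋀[C]^n N :=
  exteriorPower.alternatingMapLinearEquiv
    { ((exteriorPower.ιMulti C n (M := N)).toMultilinearMap.restrictScalars B).compLinearMap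
        (fun _ => φ) with
      map_eq_zero_of_eq' := fun v _ _ h hij =>
        (exteriorPower.ιMulti C n (M := N)).map_eq_zero_of_eq (fun i => φ (v i))
          (congrArg φ h) hij }

lemma extMap_ιMulti {B M N : Type u} (C : Type u) [CommRing B] [CommRing C] [Algebra B C]
    [AddCommGroup M] [Module B M] [AddCommGroup N] [Module B N] [Module C N] [IsScalarTower B C N]
    (n : ℕ) (φ : M →ₗ[B] N) (v : Fin n → M) :
    extMap C n φ (exteriorPower.ιMulti B n v) = exteriorPower.ιMulti C n (fun i => φ (v i)) := by
  rw [extMap, exteriorPower.alternatingMapLinearEquiv_apply_ιMulti]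
  rfl

section

variable (K A B : Type u) [CommRing K] [CommRing A] [CommRing B] [Algebra K A] [Algebra K B]

/-- Post-composition of `K`-derivations `A → B` with the structure map `B → C`. -/
def push [Algebra A B] (C : Type u) [CommRing C] [Algebra K C] [Algebra A C]
    [Algebra B C] [IsScalarTower K B C] [IsScalarTower A B C] :
    Derivation K A B →ₗ[B] Derivation K A C where
  toFun D :=
    { toLinearMap := (IsScalarTower.toAlgHom K B C).toLinearMap.comp D.toLinearMap
      map_one_eq_zero' := by simp
      leibniz' := fun a b => by simp [Algebra.smul_def, IsScalarTower.algebraMap_apply A B C] }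
  map_add' D D' := by ext; simp
  map_smul' b D := by ext; simp [Algebra.smul_def]

/-- Pre-composition of `K`-derivations `B → C` with the structure map `A → B`. -/
def pull [Algebra A B] [IsScalarTower K A B] (C : Type u) [CommRing C] [Algebra K C] [Algebra A C]
    [Algebra B C] [IsScalarTower A B C] :
    Derivation K B C →ₗ[C] Derivation K A C where
  toFun D := D.compAlgebraMap A
  map_add' _ _ := rfl
  map_smul' _ _ := rfl

end

end DetHom

section

variable (n : ℕ) (K A B : Type u) [CommRing K] [CommRing A] [CommRing B] [Algebra K A]
  [Algebra K B] [Algebra A B] [IsScalarTower K A B]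

/-- For a morphism `Spec B → Spec A` of smooth affine `K`-schemes of dimension `n`, the module of
sections of `ℋom(det T_{Spec B}, f^* det T_{Spec A})`: the sections of `T_{Spec B}` are the
`K`-derivations `B → B`, and those of `f^* T_{Spec A}` are the `K`-derivations `A → B`
(as `Ω_{A/K}` is finite projective). -/
abbrev DetHom : Type u :=
  ⋀[B]^n (Derivation K B B) →ₗ[B] ⋀[B]^n (Derivation K A B)

namespace DetHom

/-- The Jacobian `det (Tf) : det T_{Spec B} → f^* det T_{Spec A}`, the determinant of the
differential `Tf : T_{Spec B} → f^* T_{Spec A}`, which sends a derivation of `B` to its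
restriction to `A`. -/
noncomputable def jacobian : DetHom n K A B := exteriorPower.map n (pull K A B B)

variable {n K A B}

/-- The image of a section of `ℋom(det T_{Spec B}, f^* det T_{Spec A})` under `- ⊗_B C`, regarded
as a homomorphism from `det T_{Spec B}` to `(f^* det T_{Spec A}) ⊗_B C`; here the sections of
`f^* T_{Spec A} ⊗_B C` are the `K`-derivations `A → C`. -/
noncomputable def baseChange (C : Type u) [CommRing C] [Algebra K C] [Algebra A C]
    [Algebra B C] [IsScalarTower K B C] [IsScalarTower A B C] (φ : DetHom n K A B) :
    ⋀[B]^n (Derivation K B B) →ₗ[B] ⋀[C]^n (Derivation K A C) :=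
  extMap C n (push K A B C) ∘ₗ φ

/-- `φ₁ = c · φ₂` after extension of scalars along `e : B → C`. -/
def EqSMulAlong {C : Type u} [CommRing C] (e : B →+* C) (c : C) (φ₁ φ₂ : DetHom n K A B) : Prop :=
  letI : Algebra B C := e.toAlgebra
  letI : Algebra A C := (e.comp (algebraMap A B)).toAlgebra
  letI : Algebra K C := (e.comp (algebraMap K B)).toAlgebra
  haveI : IsScalarTower A B C := .of_algebraMap_eq' rfl
  haveI : IsScalarTower K B C := .of_algebraMap_eq' rfl
  φ₁.baseChange C = c • φ₂.baseChange C

/-- Given a commutative square of `K`-algebras with sides `A → A'` and `B → B'` inducing open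
immersions of spectra, `φ'` is the restriction of `φ` to `Spec B' ⊆ Spec B`: whenever
`d ∈ det T_{Spec B}` restricts to `d' ∈ det T_{Spec B'}`, `φ d` restricts to `φ' d'`. (Elements
are compared after identifying `T_{Spec B'}` with the `K`-derivations `B → B'`, and the restriction
of `f^* T_{Spec A}` to `Spec B'` with the `K`-derivations `A → B'`.) -/
def IsRestriction {A' B' : Type u} [CommRing A'] [CommRing B'] [Algebra K A'] [Algebra K B']
    [Algebra A' B'] [IsScalarTower K A' B'] (eA : A →ₐ[K] A') (eB : B →ₐ[K] B')
    (h : ∀ a, eB (algebraMap A B a) = algebraMap A' B' (eA a))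
    (φ : DetHom n K A B) (φ' : DetHom n K A' B') : Prop :=
  letI : Algebra A A' := eA.toRingHom.toAlgebra
  letI : Algebra B B' := eB.toRingHom.toAlgebra
  letI : Algebra A B' := (eB.toRingHom.comp (algebraMap A B)).toAlgebra
  haveI : IsScalarTower A B B' := .of_algebraMap_eq' rfl
  haveI : IsScalarTower A A' B' := .of_algebraMap_eq h
  haveI : IsScalarTower K A A' := .of_algebraMap_eq fun x => (eA.commutes x).symm
  haveI : IsScalarTower K B B' := .of_algebraMap_eq fun x => (eB.commutes x).symm
  ∀ (d : ⋀[B]^n (Derivation K B B)) (d' : ⋀[B']^n (Derivation K B' B')),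
    extMap B' n (push K B B B') d = exteriorPower.map n (pull K B B' B') d' →
      φ.baseChange B' d = exteriorPower.map n (pull K A A' B') (φ' d')

end DetHom

end

/-! ### Finite morphisms of varieties and relative orientations -/

namespace RelOrient

variable {K : Type u} [Field K] {X Y : Scheme.{u}}

/-- For a `K`-scheme `q : Y ⟶ Spec K`, the structure map from `K` to the sections over `V`. -/
noncomputable def scalars (q : Y ⟶ Spec (.of K)) (V : Y.Opens) : K →+* Γ(Y, V) :=
  ((Scheme.ΓSpecIso (.of K)).inv ≫ q.appTop ≫ Y.presheaf.map (homOfLE le_top).op).hom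

/-- The structure map from `K` to the residue field at a point. -/
noncomputable def scalarsResidue (q : Y ⟶ Spec (.of K)) (y : Y) : K →+* Y.residueField y :=
  (Y.evaluation ⊤ y trivial).hom.comp (scalars q ⊤)

/-! A `K`-scheme `q : Y ⟶ Spec K` and a `Y`-scheme `f : X ⟶ Y` are fixed; `X` is a `K`-scheme
through `f ≫ q`. -/

/-- The ring `Γ(Y, V)`, as a `K`-algebra. -/
def SecY (_q : Y ⟶ Spec (.of K)) (V : Y.Opens) : Type u := Γ(Y, V)

/-- The ring `Γ(X, f⁻¹ V)`, as an algebra over `K` and over `Γ(Y, V)`. -/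
def SecX (f : X ⟶ Y) (_q : Y ⟶ Spec (.of K)) (V : Y.Opens) : Type u := Γ(X, f ⁻¹ᵁ V)

/-- For a sheaf of modules `L` on `X`, the module `Γ(X, f⁻¹ V; L)` of sections of `f_* L` over `V`,
as a module over `Γ(X, f⁻¹ V)` and over `K`. -/
def SecL (f : X ⟶ Y) (_q : Y ⟶ Spec (.of K)) (L : X.Modules) (V : Y.Opens) : Type u :=
  Γ(L, f ⁻¹ᵁ V)

section

variable (f : X ⟶ Y) (q : Y ⟶ Spec (.of K)) (L : X.Modules) (V : Y.Opens)

instance : CommRing (SecY q V) := inferInstanceAs (CommRing Γ(Y, V))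
instance : CommRing (SecX f q V) := inferInstanceAs (CommRing Γ(X, f ⁻¹ᵁ V))
noncomputable instance : AddCommGroup (SecL f q L V) := inferInstanceAs (AddCommGroup Γ(L, f ⁻¹ᵁ V))
noncomputable instance : Algebra K (SecY q V) := (scalars q V).toAlgebra
noncomputable instance : Algebra (SecY q V) (SecX f q V) := (f.app V).hom.toAlgebra
noncomputable instance : Algebra K (SecX f q V) :=
  ((algebraMap (SecY q V) (SecX f q V)).comp (algebraMap K (SecY q V))).toAlgebra
instance : IsScalarTower K (SecY q V) (SecX f q V) := .of_algebraMap_eq' rfl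
noncomputable instance : Module (SecX f q V) (SecL f q L V) :=
  inferInstanceAs (Module Γ(X, f ⁻¹ᵁ V) Γ(L, f ⁻¹ᵁ V))
noncomputable instance : Module K (SecL f q L V) :=
  Module.compHom _ (algebraMap K (SecX f q V))

end

section

variable (f : X ⟶ Y) (q : Y ⟶ Spec (.of K)) (L : X.Modules) {V W : Y.Opens} (h : W ≤ V)

/-- Restriction of functions on `Y`. -/
noncomputable def resY : SecY q V →ₐ[K] SecY q W :=
  { (Y.presheaf.map (homOfLE h).op).hom with
    commutes' := fun r => by
      change (Y.presheaf.map (homOfLE h).op).hom (scalars q V r) = scalars q W r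
      simp only [scalars, CommRingCat.hom_comp, RingHom.comp_apply]
      rw [← RingHom.comp_apply, ← CommRingCat.hom_comp, ← Y.presheaf.map_comp]
      rfl }

lemma res_comm (a : SecY q V) :
    (X.presheaf.map (homOfLE (f.preimage_mono h)).op).hom (algebraMap (SecY q V) (SecX f q V) a) =
      algebraMap (SecY q W) (SecX f q W) (resY q h a) := by
  exact congr($(f.naturality (homOfLE h).op).hom a).symm

/-- Restriction of functions on `X`. -/
noncomputable def resX : SecX f q V →ₐ[K] SecX f q W :=
  { (X.presheaf.map (homOfLE (f.preimage_mono h)).op).hom with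
    commutes' := fun r => (res_comm f q h (algebraMap K (SecY q V) r)).trans
      (congrArg _ ((resY q h).commutes r)) }

/-- Restriction of sections of `L`. -/
noncomputable def resL : SecL f q L V →+ SecL f q L W :=
  (L.presheaf.map (homOfLE (f.preimage_mono h)).op).hom

end

/-- A sheaf of modules is a line bundle if it is locally isomorphic to the structure sheaf. -/
def IsLineBundle (L : X.Modules) : Prop :=
  ∀ x : X, ∃ U : X.Opens, x ∈ U ∧
    Nonempty (L.restrict U.ι ≅ SheafOfModules.unit U.toScheme.ringCatSheaf)

/-- A sheaf of modules `L` on `X` is `f`-Ulrich if `f_* L ≅ 𝒪_Y ^ t` for some `t > 0`. -/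
def IsUlrich (f : X ⟶ Y) (L : X.Modules) : Prop :=
  ∃ t : ℕ, 0 < t ∧ Nonempty ((Scheme.Modules.pushforward f).obj L ≅
    SheafOfModules.free (R := Y.ringCatSheaf) (ULift.{u} (Fin t)))

/-- A relative orientation `ψ : L ⊗ L ≅ ℋom(det T_X, f^* det T_Y)` of a finite morphism `f : X ⟶ Y`
of smooth `K`-varieties of dimension `n`, where `L` is a line bundle on `X`. An isomorphism of
these quasi-coherent sheaves is the same as a family of isomorphisms on sections over the
affine opens `f⁻¹ V ⊆ X`, where `V` ranges over the affine opens of `Y`, which is compatible with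
restriction. -/
structure RelativeOrientation (f : X ⟶ Y) (q : Y ⟶ Spec (.of K)) (n : ℕ) (L : X.Modules) where
  iso (V : Y.affineOpens) :
    SecL f q L V ⊗[SecX f q V] SecL f q L V ≃ₗ[SecX f q V] DetHom n K (SecY q V) (SecX f q V)
  compatible (V W : Y.affineOpens) (h : W.1 ≤ V.1) (s t : SecL f q L V) :
    DetHom.IsRestriction (resY q h) (resX f q h) (res_comm f q h) (iso V (s ⊗ₜ t))
      (iso W (resL f q L h s ⊗ₜ resL f q L h t))

/-! ### Function fields and residue fields -/

/-- A surjective morphism maps the generic point to the generic point. -/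
lemma genericPoint_specializes_of_surjective (f : X ⟶ Y) [IsIntegral X] [IsIntegral Y]
    [Surjective f] : f (genericPoint X) ⤳ genericPoint Y := by
  refine ((genericPoint_spec X).image f.continuous).specializes ?_
  rw [Set.image_univ, f.surjective.range_eq, closure_univ]
  trivial

/-- The extension `K(Y) → K(X)` of function fields induced by a surjective `f : X ⟶ Y`. -/
noncomputable def functionFieldMap (f : X ⟶ Y) [IsIntegral X] [IsIntegral Y] [Surjective f] :
    Y.functionField →+* X.functionField :=
  (Y.presheaf.stalkSpecializes (genericPoint_specializes_of_surjective f) ≫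
    f.stalkMap (genericPoint X)).hom

/-- A surjective morphism `f : X ⟶ Y` of integral schemes is separable if the extension
`K(X) / K(Y)` is separable. -/
def IsSeparableMorphism (f : X ⟶ Y) [IsIntegral X] [IsIntegral Y] [Surjective f] : Prop :=
  letI := (functionFieldMap f).toAlgebra
  Algebra.IsSeparable Y.functionField X.functionField

/-- The extension `κ(y) → κ(x)` of residue fields for `f x = y`. -/
noncomputable def residueMap (f : X ⟶ Y) {x : X} {y : Y} (h : f x = y) :
    Y.residueField y →+* X.residueField x :=
  ((Y.residueFieldCongr h.symm).hom ≫ f.residueFieldMap x).hom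

/-- Evaluation of functions at a point `x`. -/
noncomputable def evalX (f : X ⟶ Y) (q : Y ⟶ Spec (.of K)) (V : Y.Opens) (x : X)
    (hx : x ∈ f ⁻¹ᵁ V) : SecX f q V →+* X.residueField x :=
  (X.evaluation (f ⁻¹ᵁ V) x hx).hom

/-- The map from functions to rational functions. -/
noncomputable def germX (f : X ⟶ Y) (q : Y ⟶ Spec (.of K)) (V : Y.Opens) [IsIntegral X]
    (hV : genericPoint X ∈ f ⁻¹ᵁ V) : SecX f q V →+* X.functionField :=
  (X.presheaf.germ (f ⁻¹ᵁ V) (genericPoint X) hV).hom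

/-! ### The `𝔸¹`-degree -/

section Degree

variable {f : X ⟶ Y} {q : Y ⟶ Spec (.of K)} {n : ℕ} {L : X.Modules}

/-- `J_x f = g · ψ(t ⊗ t)` in the fibre of `ℋom(det T_X, f^* det T_Y)` at `x`, for some element
`t` of the fibre of `L` at `x` (each such `t` is the value at `x` of a section of `L`
over some `f⁻¹ V`). -/
def IsJacobianCoeff (ψ : RelativeOrientation f q n L) (x : X) (g : X.residueField x) : Prop :=
  ∃ (V : Y.affineOpens) (hx : x ∈ f ⁻¹ᵁ V.1) (t : SecL f q L V),
    DetHom.EqSMulAlong (evalX f q V x hx) g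
      (DetHom.jacobian n K (SecY q V) (SecX f q V)) (ψ.iso V (t ⊗ₜ t))

open Classical in
/-- The element `g` of `κ(x)` representing `J_x f`; it is determined
up to squares if `f` is unramified at `x`. -/
noncomputable def jacobianCoeff (ψ : RelativeOrientation f q n L) (x : X) : X.residueField x :=
  if h : ∃ g, IsJacobianCoeff ψ x g then h.choose else 0

/-- The scaled trace form `(a, b) ↦ Tr (g a b)` of an extension `E / k`. -/
noncomputable def scaledTraceForm (k E : Type u) [Field k] [Field E] [Algebra k E] (g : E) :
    LinearMap.BilinForm k E :=
  (Algebra.traceForm k E).comp (LinearMap.mulLeft k g) LinearMap.id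

/-- The local `𝔸¹`-degree of `f` at `x`, in `GW(κ(y))`, where `y = f x`: the class
of the form `(a, b) ↦ Tr_{κ(x)/κ(y)} (J_x f · a b)`. -/
noncomputable def localDegree (ψ : RelativeOrientation f q n L) {x : X} {y : Y} (h : f x = y) :
    GW (Y.residueField y) :=
  letI := (residueMap f h).toAlgebra
  GW.ofForm (scaledTraceForm (Y.residueField y) (X.residueField x) (jacobianCoeff ψ x))

/-- The `𝔸¹`-degree of `f` at `y`: the sum of the local `𝔸¹`-degrees at the points of the fibre. -/
noncomputable def degreeAt (ψ : RelativeOrientation f q n L) (y : Y) : GW (Y.residueField y) :=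
  ∑ᶠ x : {x : X // f x = y}, localDegree ψ x.2

/-- The point `y` lies outside the branch locus of `f`: `f` is unramified at every point over `y`. -/
def NotBranch (f : X ⟶ Y) (y : Y) : Prop :=
  ∀ x : X, f x = y → (f.stalkMap x).hom.FormallyUnramified

/-- The `𝔸¹`-degree of `f` is well-defined and equal to `d`. -/
def HasDegree (ψ : RelativeOrientation f q n L) (d : GW K) : Prop :=
  ∀ y : Y, IsClosed {y} → NotBranch f y → degreeAt ψ y = GW.map (scalarsResidue q y) d

/-! ### The trace form -/

/-- A `K`-bilinear form `β` on `H⁰(Y, f_* L)` is the form `ψ̄` induced by `ψ` and the trace: the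
section `ψ(s ⊗ t)` of `ℋom(det T_X, f^* det T_Y) = ω_X ⊗ f^* ω_Y⁻¹` can be written as `b • det (Tf)`
for a rational function `b` on `X`, where `det (Tf)` corresponds to the pull-back
`f^* ω_Y → ω_X` of forms; the trace sends it to `Tr_{K(X)/K(Y)} b`, and this
equals `β s t`. -/
def IsTraceForm [IsIntegral X] [IsIntegral Y] [Surjective f] (ψ : RelativeOrientation f q n L)
    (β : LinearMap.BilinForm K (SecL f q L ⊤)) : Prop :=
  letI := (functionFieldMap f).toAlgebra
  ∀ s t : SecL f q L ⊤, ∃ b : X.functionField,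
    (∀ (V : Y.affineOpens) (hV : genericPoint X ∈ f ⁻¹ᵁ V.1),
      DetHom.EqSMulAlong (germX f q V hV) b
        (ψ.iso V (resL f q L le_top s ⊗ₜ resL f q L le_top t))
        (DetHom.jacobian n K (SecY q V) (SecX f q V))) ∧
    (Y.presheaf.germ ⊤ (genericPoint Y) trivial).hom (scalars q ⊤ (β s t)) =
      Algebra.trace Y.functionField X.functionField b

end Degree

end RelOrient

/-!
The form `ψ̄` is controlled by duality for the finite extension `A → B` of smooth `K`-algebras that
`f` is over a small affine open of `Y`, made explicit enough that no duality theory is needed.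

*Coordinates.* Near each point a smooth domain has a *frame* (`IsFrame`): functions `u₁, …, uₙ`
whose differentials generate `Ω` up to a denominator `h`, with dual derivations. On frames of `A`
and `B`, a section of `ℋom(det T_X, f^* det T_Y)` becomes one function (`DetHom.coord`), and
`φ₁ = c · φ₂` at a point becomes an equation between functions there (`DetHom.eqSMulAlong_iff`). In
these coordinates `ψ` is a `B`-bilinear pairing on `M = Γ(f⁻¹ V, L)` without zero divisors, and
such a pairing is symmetric because `M` has rank one (`pairing_comm`). It generates `B` locally,
so `B` is projective over `A` as `M` is (`projective_of_relativeOrientation`). Frames extend along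
étale maps, so all relations may be checked after shrinking `V`
(`DetHom.eqSMulAlong_restriction_iff`).

*The trace is regular.* Let `b` be a rational function with `φ = b · det (Tf)`. As `B ⊗_K B` is
smooth over `K`, the kernel of multiplication is cut out locally by `n` elements `1 ⊗ wⱼ - wⱼ ⊗ 1`,
and the equations `1 ⊗ aᵢ - aᵢ ⊗ 1` of `B ⊗_A B` are combinations of these. Let `Δ ∈ B ⊗_A B` be the
image of the determinant of the coefficients: it is killed by the kernel of multiplication and is
the Jacobian on the diagonal, up to a unit. By Wiebe's theorem, in the explicit form
`det_notMem_span_mulVec`, it does not vanish on a given fibre `k ⊗_A B`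
(`exists_annihilator_diagonal`). As `B` is projective over `A`, this is detected by a functional `g
: B → A`. Now `g` has the form `Tr (y · )`, and contracting `Δ` with it gives `y` times the Jacobian
(`mul'_map_trace_eq`), so that `b` times the contraction has trace in `A`, as has each of its
multiples. The contractions generate the unit ideal, and hence `Tr (b)` lies in `A`
(`trace_mem_range_of_annihilator_diagonal`, `trace_mem_range_of_eqSMulAlong`). The values on the
members of an affine cover glue to a global function, which is a constant. Non-degeneracy is that of
the trace form of the separable extension `K(X) / K(Y)`, for which the sections `b(s, e i)` form a
basis (`exists_trace_ne_zero`).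

*The degree.* An isomorphism `f_* L ≅ 𝒪 ^ t` gives global sections that form a basis of `M` over `A`
for every `V` at once. At a closed point `y` outside the branch locus, with maximal ideal `p`, the
fibre `B / p B` is the product of the residue fields `κ(x)`. Choose `t_x` with
`det (Tf) = g_x ψ(t_x ⊗ t_x)` at `x`; dividing `ψ(s ⊗ t_x)` by `det (Tf)` identifies `M / p M` with
`∏ κ(x)`. As the pairing has rank one, `b(s, s')` becomes `g_x` times the product of the values of
`s` and `s'`, and the trace of `K(X) / K(Y)` reduces to the sum of the traces of `κ(x) / κ(y)`.
So the Gram matrix of the trace form reduces modulo `p` to the Gram matrix of the sum of the scaled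
trace forms (`exists_basis_fibre`), which is the claimed identity of classes
(`GW.sum_scaledTraceForm_eq_map`).
-/

/-! ### Determinants of relations between regular sequences -/

section Wiebe

variable {O : Type*} [CommRing O] {n : ℕ}

/-- If a square matrix `S` sends `x` to a vector whose `i`-th entry vanishes and whose other entries
are the powers `x j ^ N`, then `det S` lies in the ideal of these powers, as soon as `x i` is a
non-zero-divisor modulo them. -/
lemma det_mem_span_pow_of_mulVec (x : Fin n → O) (N : ℕ) (i : Fin n)
    (hreg : ∀ z, z * x i ∈ Ideal.span ((fun j => x j ^ N) '' {j | j ≠ i}) →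
      z ∈ Ideal.span ((fun j => x j ^ N) '' {j | j ≠ i}))
    (S : Matrix (Fin n) (Fin n) O) (hi : S.mulVec x i = 0)
    (hj : ∀ j, j ≠ i → S.mulVec x j = x j ^ N) :
    S.det ∈ Ideal.span ((fun j => x j ^ N) '' {j | j ≠ i}) := by
  apply hreg
  have h : S.det • x = S.adjugate.mulVec (S.mulVec x) := by
    rw [Matrix.mulVec_mulVec, Matrix.adjugate_mul, Matrix.smul_mulVec, Matrix.one_mulVec]
  have h' := congrFun h i
  simp only [Pi.smul_apply, smul_eq_mul] at h'
  rw [h', Matrix.mulVec, dotProduct]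
  refine Ideal.sum_mem _ fun j _ => Ideal.mul_mem_left _ _ ?_
  by_cases hji : j = i
  · subst hji
    rw [hi]
    exact zero_mem _
  · rw [hj j hji]
    exact Ideal.subset_span ⟨j, hji, rfl⟩

/-- Two matrices sending `x` to the vector of powers `x i ^ N` have the same determinant modulo
these powers. The rows of one are replaced by those of the other one at a time. -/
lemma det_sub_det_mem_span_pow (x : Fin n → O) (N : ℕ)
    (hreg : ∀ i z, z * x i ∈ Ideal.span ((fun j => x j ^ N) '' {j | j ≠ i}) →
      z ∈ Ideal.span ((fun j => x j ^ N) '' {j | j ≠ i}))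
    (P Q : Matrix (Fin n) (Fin n) O) (hP : P.mulVec x = fun i => x i ^ N)
    (hQ : Q.mulVec x = fun i => x i ^ N) :
    P.det - Q.det ∈ Ideal.span (Set.range fun j => x j ^ N) := by
  classical
  let R (s : Finset (Fin n)) : Matrix (Fin n) (Fin n) O :=
    Matrix.of fun i => if i ∈ s then P i else Q i
  have hR (s) (i) : (R s).mulVec x i = x i ^ N := by
    have hP' := congrFun hP i
    have hQ' := congrFun hQ i
    simp only [Matrix.mulVec, R, Matrix.of_apply] at hP' hQ' ⊢
    split_ifs
    · exact hP'
    · exact hQ'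
  have key (s : Finset (Fin n)) : (R s).det - Q.det ∈ Ideal.span (Set.range fun j => x j ^ N) := by
    induction s using Finset.induction_on with
    | empty =>
      have : R ∅ = Q := by ext i j; simp [R]
      simp [this]
    | insert i s hi ih =>
      have e₁ : R (insert i s) = (R s).updateRow i (P i) := by
        ext j k
        by_cases hj : j = i
        · rw [hj, Matrix.updateRow_self]
          simp [R]
        · rw [Matrix.updateRow_ne hj]
          simp [R, hj]
      have e₂ : R s = (R s).updateRow i (Q i) := by
        ext j k
        by_cases hj : j = i
        · rw [hj, Matrix.updateRow_self]
          simp [R, hi]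
        · rw [Matrix.updateRow_ne hj]
      have e₃ : (R (insert i s)).det - (R s).det = ((R s).updateRow i (P i - Q i)).det := by
        conv_lhs => rw [e₁, e₂]
        rw [Matrix.updateRow_idem, sub_eq_iff_eq_add, ← Matrix.det_updateRow_add, sub_add_cancel]
      have h₁ : (R (insert i s)).det - (R s).det ∈
          Ideal.span (Set.range fun j => x j ^ N) := by
        rw [e₃]
        refine Ideal.span_mono (Set.image_subset_range _ _)
          (det_mem_span_pow_of_mulVec x N i (hreg i) _ ?_ ?_)
        · have hP' := congrFun hP i
          have hQ' := congrFun hQ i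
          simp only [Matrix.mulVec] at hP' hQ'
          simp only [Matrix.mulVec, Matrix.updateRow_self, sub_dotProduct]
          rw [hP', hQ', sub_self]
        · intro j hj
          have := hR s j
          simp only [Matrix.mulVec] at this ⊢
          rw [Matrix.updateRow_ne hj, this]
      have := Ideal.add_mem _ h₁ ih
      rwa [sub_add_sub_cancel] at this
  have : R Finset.univ = P := by ext i j; simp [R]
  simpa [this] using key Finset.univ

/-- A form of Wiebe's theorem: if the ideal of the entries of `M x` contains powers of all the
`x i`, where the `x i` behave like the variables of a polynomial ring, then `det M` does not lie in
that ideal. Indeed, if `C M x` is the vector of powers `x i ^ N`, then `det C * det M` is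
congruent to the product of the `x i ^ (N - 1)`, which would lie in the ideal of
the powers `x i ^ N`. -/
lemma det_notMem_span_mulVec (x : Fin n → O) (N : ℕ)
    (hreg : ∀ i z, z * x i ∈ Ideal.span ((fun j => x j ^ (N + 1)) '' {j | j ≠ i}) →
      z ∈ Ideal.span ((fun j => x j ^ (N + 1)) '' {j | j ≠ i}))
    (hsoc : ∏ i, x i ^ N ∉ Ideal.span (Set.range fun j => x j ^ (N + 1)))
    (M : Matrix (Fin n) (Fin n) O)
    (hM : ∀ i, x i ^ (N + 1) ∈ Ideal.span (Set.range (M.mulVec x))) :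
    M.det ∉ Ideal.span (Set.range (M.mulVec x)) := by
  intro hdet
  have hC (i) : ∃ c : Fin n → O, ∑ j, c j * M.mulVec x j = x i ^ (N + 1) := by
    simpa [Ideal.mem_span_range_iff_exists_fun] using hM i
  choose C hC using hC
  have hCF : (Matrix.of C).mulVec (M.mulVec x) = fun i => x i ^ (N + 1) := by
    ext i
    exact hC i
  have hdiag : (Matrix.diagonal fun i => x i ^ N).mulVec x = fun i => x i ^ (N + 1) := by
    ext i
    rw [Matrix.mulVec_diagonal, pow_succ]
  have h₁ := det_sub_det_mem_span_pow x (N + 1) hreg (Matrix.of C * M) _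
    (by rw [← Matrix.mulVec_mulVec, hCF]) hdiag
  have h₂ : (Matrix.of C * M).det ∈ Ideal.span (Set.range fun j => x j ^ (N + 1)) := by
    rw [Matrix.det_mul]
    obtain ⟨d, hd⟩ := (Ideal.mem_span_range_iff_exists_fun).1 hdet
    rw [← hd, Finset.mul_sum]
    refine Ideal.sum_mem _ fun i _ => ?_
    rw [mul_left_comm]
    refine Ideal.mul_mem_left _ _ ?_
    have h : (Matrix.of C).det • M.mulVec x =
        (Matrix.of C).adjugate.mulVec fun i => x i ^ (N + 1) := by
      rw [← hCF, Matrix.mulVec_mulVec, Matrix.adjugate_mul, Matrix.smul_mulVec, Matrix.one_mulVec]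
    have h' := congrFun h i
    simp only [Pi.smul_apply, smul_eq_mul] at h'
    rw [h', Matrix.mulVec, dotProduct]
    exact Ideal.sum_mem _ fun j _ => Ideal.mul_mem_left _ _ (Ideal.subset_span ⟨j, rfl⟩)
  rw [Matrix.det_diagonal] at h₁
  apply hsoc
  have := Ideal.sub_mem _ h₂ h₁
  rwa [sub_sub_cancel] at this

end Wiebe

section Variables

open MvPolynomial

variable {k : Type*} [Field k] {n : ℕ}

lemma MvPolynomial.mem_span_X_pow_iff {s : Set (Fin n)} {N : ℕ} {p : MvPolynomial (Fin n) k} :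
    p ∈ Ideal.span ((fun j => (X j : MvPolynomial (Fin n) k) ^ N) '' s) ↔
      ∀ m ∈ p.support, ∃ j ∈ s, N ≤ m j := by
  have : (fun j => (X j : MvPolynomial (Fin n) k) ^ N) '' s =
      (fun m => monomial m (1 : k)) '' ((fun j => Finsupp.single j N) '' s) := by
    rw [Set.image_image]
    exact Set.image_congr fun j _ => by rw [X_pow_eq_monomial]
  rw [this, mem_ideal_span_monomial_image]
  simp [Finsupp.single_le_iff]

lemma MvPolynomial.mem_span_X_pow_of_mul_X {N : ℕ} {i : Fin n} {p : MvPolynomial (Fin n) k}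
    (h : p * X i ∈ Ideal.span ((fun j => (X j : MvPolynomial (Fin n) k) ^ N) '' {j | j ≠ i})) :
    p ∈ Ideal.span ((fun j => (X j : MvPolynomial (Fin n) k) ^ N) '' {j | j ≠ i}) := by
  rw [mem_span_X_pow_iff] at h ⊢
  intro m hm
  obtain ⟨j, hj, hN⟩ := h (m + Finsupp.single i 1) (by
    rw [mem_support_iff, coeff_mul_X]
    exact mem_support_iff.1 hm)
  refine ⟨j, hj, ?_⟩
  rwa [Finsupp.add_apply, Finsupp.single_eq_of_ne (by exact hj), add_zero] at hN

lemma MvPolynomial.mem_span_X_of_mul_prod {N : ℕ} {p : MvPolynomial (Fin n) k}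
    (h : p * ∏ i, (X i : MvPolynomial (Fin n) k) ^ N ∈
      Ideal.span (Set.range fun j => (X j : MvPolynomial (Fin n) k) ^ (N + 1))) :
    p ∈ Ideal.span (Set.range fun j => (X j : MvPolynomial (Fin n) k)) := by
  have h₁ : Set.range (fun j => (X j : MvPolynomial (Fin n) k)) =
      (fun j => (X j : MvPolynomial (Fin n) k) ^ 1) '' Set.univ := by simp
  have h₂ : ∏ i, (X i : MvPolynomial (Fin n) k) ^ N =
      monomial (∑ i, Finsupp.single i N) 1 := by
    simp [X_pow_eq_monomial, monomial_sum_one]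
  rw [← Set.image_univ, mem_span_X_pow_iff, h₂] at h
  rw [h₁, mem_span_X_pow_iff]
  intro m hm
  obtain ⟨j, -, hN⟩ := h (m + ∑ i, Finsupp.single i N) (by
    rw [mem_support_iff, coeff_mul_monomial, mul_one]
    exact mem_support_iff.1 hm)
  refine ⟨j, trivial, ?_⟩
  rw [Finsupp.add_apply, Finsupp.finsetSum_apply, Finset.sum_eq_single j] at hN
  · simp at hN; omega
  · intro i _ hi
    exact Finsupp.single_eq_of_ne (by exact hi.symm)
  · simp

/-- By flatness, a colon ideal of a finitely generated ideal is preserved by a flat extension. -/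
lemma mul_mem_span_of_flat {R O ι : Type*} [CommRing R] [CommRing O] [Algebra R O]
    [Module.Flat R O] [Fintype ι] (f : R) (g : ι → R) (I : Ideal R)
    (hI : ∀ p, p * f ∈ Ideal.span (Set.range g) → p ∈ I) (z : O)
    (hz : z * algebraMap R O f ∈ Ideal.span (Set.range fun i => algebraMap R O (g i))) :
    z ∈ I.map (algebraMap R O) := by
  obtain ⟨w, hw⟩ := Ideal.mem_span_range_iff_exists_fun.1 hz
  let F : Option ι → R := fun o => o.elim f g
  let Z : Option ι → O := fun o => o.elim z fun i => - w i
  have hrel : ∑ o, F o • Z o = 0 := by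
    rw [Fintype.sum_option]
    change f • z + ∑ i, g i • (- w i) = 0
    simp only [Algebra.smul_def, mul_neg, Finset.sum_neg_distrib]
    rw [mul_comm, ← hw, add_neg_eq_zero]
    exact Finset.sum_congr rfl fun i _ => mul_comm _ _
  obtain ⟨l, a, y, hy, ha⟩ := Module.Flat.isTrivialRelation_of_sum_smul_eq_zero
    (R := R) (M := O) (f := F) (x := Z) hrel
  have hz' : z = ∑ j, a none j • y j := hy none
  rw [hz']
  refine Ideal.sum_mem _ fun j _ => ?_
  rw [Algebra.smul_def]
  refine Ideal.mul_mem_right _ _ (Ideal.mem_map_of_mem _ (hI _ ?_))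
  have h := ha j
  rw [Fintype.sum_option] at h
  change f * a none j + ∑ i, g i * a (some i) j = 0 at h
  rw [mul_comm, eq_neg_of_add_eq_zero_left h]
  exact neg_mem (Ideal.sum_mem _ fun i _ =>
    Ideal.mul_mem_right _ _ (Ideal.subset_span ⟨i, rfl⟩))

variable {O : Type*} [CommRing O] [Algebra (MvPolynomial (Fin n) k) O]
  [Module.Flat (MvPolynomial (Fin n) k) O]

/-- The determinant criterion for a proper flat extension of a polynomial ring. -/
lemma det_notMem_span_mulVec_of_flat
    (x : Fin n → O) (hx : ∀ i, algebraMap (MvPolynomial (Fin n) k) O (X i) = x i)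
    (h1 : Ideal.span (Set.range x) ≠ ⊤) (N : ℕ) (M : Matrix (Fin n) (Fin n) O)
    (hM : ∀ i, x i ^ (N + 1) ∈ Ideal.span (Set.range (M.mulVec x))) :
    M.det ∉ Ideal.span (Set.range (M.mulVec x)) := by
  classical
  refine det_notMem_span_mulVec x N (fun i z hz => ?_) (fun h => h1 ?_) M hM
  · have e (s : Set (Fin n)) : Ideal.map (algebraMap _ O)
        (Ideal.span ((fun j => (X j : MvPolynomial (Fin n) k) ^ (N + 1)) '' s)) =
        Ideal.span ((fun j => x j ^ (N + 1)) '' s) := by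
      rw [Ideal.map_span, Set.image_image]
      simp [hx]
    rw [← e]
    refine mul_mem_span_of_flat (X i)
      (fun j : {j // j ≠ i} => (X j.1 : MvPolynomial (Fin n) k) ^ (N + 1)) _ (fun p hp => ?_) z ?_
    · apply mem_span_X_pow_of_mul_X
      rw [Set.image_eq_range]
      exact hp
    · rw [hx]
      rw [Set.image_eq_range] at hz
      simp only [map_pow, hx]
      exact hz
  · rw [Ideal.eq_top_iff_one]
    have e : Ideal.map (algebraMap _ O)
        (Ideal.span (Set.range fun j => (X j : MvPolynomial (Fin n) k))) =
        Ideal.span (Set.range x) := by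
      rw [Ideal.map_span, ← Set.range_comp]
      congr 2
      ext i; simp [hx]
    rw [← e]
    refine mul_mem_span_of_flat (∏ i, (X i : MvPolynomial (Fin n) k) ^ N)
      (fun j => (X j : MvPolynomial (Fin n) k) ^ (N + 1)) _
      (fun p hp => mem_span_X_of_mul_prod hp) 1 ?_
    simpa [hx] using h

end Variables

/-! ### Frames: local coordinates together with a dual family of derivations -/

/-- Functions `u i` on a `K`-algebra `B` and `K`-derivations `D j` of `B` form a frame with
denominator `h` if, after inverting `h`, the differentials `d (u i)` generate the module of
differentials and the `h⁻¹ D j` are the partial derivatives with respect to the `u i`. Keeping the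
denominator avoids passing to a localization. -/
structure IsFrame (K : Type*) {B : Type*} [CommRing K] [CommRing B] [Algebra K B] {n : ℕ}
    (u : Fin n → B) (D : Fin n → Derivation K B B) (h : B) : Prop where
  apply_eq (i j : Fin n) : D j (u i) = if i = j then h else 0
  smul_mem (ω : Ω[B⁄K]) :
    h • ω ∈ Submodule.span B (Set.range fun i => KaehlerDifferential.D K B (u i))

namespace IsFrame

section

variable {K B : Type*} [CommRing K] [CommRing B] [Algebra K B] {n : ℕ}
  {u : Fin n → B} {D : Fin n → Derivation K B B} {h : B}

lemma smul_derivation_eq_zero (H : IsFrame K u D h) {N : Type*} [AddCommGroup N] [Module B N]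
    [Module K N] [IsScalarTower K B N] (d : Derivation K B N) (hd : ∀ i, d (u i) = 0) (b : B) :
    h • d b = 0 := by
  have h₁ : Submodule.span B (Set.range fun i => KaehlerDifferential.D K B (u i)) ≤
      LinearMap.ker d.liftKaehlerDifferential := by
    rw [Submodule.span_le]
    rintro _ ⟨i, rfl⟩
    simp [hd]
  have h₂ := h₁ (H.smul_mem (KaehlerDifferential.D K B b))
  rwa [LinearMap.mem_ker, map_smul, Derivation.liftKaehlerDifferential_comp_D] at h₂

/-- Frames are carried along an extension whose differentials come from below. -/
lemma map (H : IsFrame K u D h) {K' B' : Type*} [CommRing K'] [CommRing B'] [Algebra K' B']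
    [Algebra K K'] [Algebra K B'] [IsScalarTower K K' B'] [Algebra B B'] [IsScalarTower K B B']
    (hspan : Submodule.span B' (Set.range (KaehlerDifferential.map K K' B B')) = ⊤)
    (v : Fin n → B') (E : Fin n → Derivation K' B' B')
    (hv : ∀ i, KaehlerDifferential.D K' B' (v i) =
      KaehlerDifferential.D K' B' (algebraMap B B' (u i)))
    (hE : ∀ i j, E j (v i) = if i = j then algebraMap B B' h else 0) :
    IsFrame K' v E (algebraMap B B' h) where
  apply_eq := hE
  smul_mem ω := by
    have hω : ω ∈ Submodule.span B' (Set.range (KaehlerDifferential.map K K' B B')) :=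
      hspan ▸ Submodule.mem_top
    induction hω using Submodule.span_induction with
    | mem ω hω =>
      obtain ⟨ω, rfl⟩ := hω
      rw [algebraMap_smul, ← map_smul]
      obtain ⟨c, hc⟩ := (Submodule.mem_span_range_iff_exists_fun B).1 (H.smul_mem ω)
      rw [← hc, map_sum]
      refine Submodule.sum_mem _ fun i _ => ?_
      rw [map_smul, KaehlerDifferential.map_D, ← hv, ← algebraMap_smul B' (c i)]
      exact Submodule.smul_mem _ _ (Submodule.subset_span ⟨i, rfl⟩)
    | zero => simp
    | add ω ω' _ _ h₁ h₂ => rw [smul_add]; exact add_mem h₁ h₂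
    | smul b ω _ h₁ => rw [smul_comm]; exact Submodule.smul_mem _ _ h₁

/-- If the denominator is a unit, then the differentials `d (u i)` are linearly independent. -/
lemma linearIndependent (H : IsFrame K u D h) (hu : IsUnit h) :
    LinearIndependent B fun i => KaehlerDifferential.D K B (u i) := by
  rw [Fintype.linearIndependent_iff]
  intro c hc j
  have := congrArg (D j).liftKaehlerDifferential hc
  simp only [map_sum, map_smul, Derivation.liftKaehlerDifferential_comp_D, map_zero,
    H.apply_eq] at this
  simpa [hu.mul_left_eq_zero] using this

lemma span_eq_top (H : IsFrame K u D h) (hu : IsUnit h) :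
    Submodule.span B (Set.range fun i => KaehlerDifferential.D K B (u i)) = ⊤ := by
  rw [eq_top_iff]
  intro ω _
  obtain ⟨v, rfl⟩ := hu
  have := Submodule.smul_mem _ (↑v⁻¹ : B) (H.smul_mem ω)
  rwa [smul_smul, Units.inv_mul, one_smul] at this

end

section

variable {K B : Type u} [CommRing K] [CommRing B] [Algebra K B] {n : ℕ}
  {u : Fin n → B} {D : Fin n → Derivation K B B} {h : B}

/-- The coordinates of a frame with invertible denominator on a smooth algebra define an étale
map to affine space. -/
lemma etale (H : IsFrame K u D h) (hu : IsUnit h) [Algebra.Smooth K B]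
    [Algebra (MvPolynomial (Fin n) K) B] [IsScalarTower K (MvPolynomial (Fin n) K) B]
    (hX : ∀ i, algebraMap (MvPolynomial (Fin n) K) B (MvPolynomial.X i) = u i) :
    Algebra.Etale (MvPolynomial (Fin n) K) B := by
  let P := MvPolynomial (Fin n) K
  have hsurj : Function.Surjective (KaehlerDifferential.mapBaseChange K P B) := by
    rw [← LinearMap.range_eq_top, eq_top_iff, ← H.span_eq_top hu, Submodule.span_le]
    rintro _ ⟨i, rfl⟩
    refine ⟨1 ⊗ₜ KaehlerDifferential.D K P (MvPolynomial.X i), ?_⟩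
    rw [KaehlerDifferential.mapBaseChange_tmul, one_smul, KaehlerDifferential.map_D, hX]
  have hinj : Function.Injective (KaehlerDifferential.mapBaseChange K P B) := by
    let b := (KaehlerDifferential.mvPolynomialBasis K (Fin n)).baseChange B
    have hb (i) : KaehlerDifferential.mapBaseChange K P B (b i) =
        KaehlerDifferential.D K B (u i) := by
      simp [b, KaehlerDifferential.mvPolynomialBasis_apply, P, hX]
    rw [← LinearMap.ker_eq_bot, LinearMap.ker_eq_bot']
    intro m hm
    rw [← b.sum_repr m] at hm ⊢
    simp only [map_sum, map_smul, hb] at hm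
    have := Fintype.linearIndependent_iff.1 (H.linearIndependent hu) _ hm
    simp [this]
  have hΩ : Subsingleton Ω[B⁄P] := by
    refine subsingleton_of_forall_eq 0 fun x => ?_
    obtain ⟨x, rfl⟩ := KaehlerDifferential.map_surjective K P B x
    exact (KaehlerDifferential.exact_mapBaseChange_map K P B x).2 (hsurj x)
  have hH : Subsingleton (Algebra.H1Cotangent P B) := by
    refine subsingleton_of_forall_eq 0 fun x => ?_
    have h₁ : Algebra.H1Cotangent.δ K P B x = 0 := by
      apply hinj
      rw [map_zero]
      exact (Algebra.H1Cotangent.exact_δ_mapBaseChange K P B _).2 ⟨x, rfl⟩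
    obtain ⟨y, rfl⟩ := (Algebra.H1Cotangent.exact_map_δ K P B x).1 h₁
    rw [Subsingleton.elim y 0, map_zero]
  have h₁ : Algebra.FormallyUnramified P B := ⟨hΩ⟩
  have h₂ : Algebra.FormallySmooth P B := ⟨inferInstance, hH⟩
  have h₃ : Algebra.FinitePresentation P B :=
    Algebra.FinitePresentation.of_restrict_scalars_finitePresentation K P B
  exact { formallyEtale := .of_formallyUnramified_and_formallySmooth }

end

end IsFrame

section Exists

variable {K B : Type u} [CommRing K] [CommRing B] [IsDomain B] [Algebra K B]

/-- A smooth domain has a frame whose denominator does not lie in a given prime ideal. -/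
lemma exists_isFrame [Algebra.Smooth K B] {n : ℕ} (hn : Module.finrank B Ω[B⁄K] = n)
    (p : Ideal B) [p.IsPrime] :
    ∃ (u : Fin n → B) (D : Fin n → Derivation K B B) (h : B), h ∉ p ∧ IsFrame K u D h := by
  classical
  let Bp := Localization.AtPrime p
  have hle : p.primeCompl ≤ nonZeroDivisors B := p.primeCompl_le_nonZeroDivisors
  have hinjB : Function.Injective (algebraMap B Bp) := IsLocalization.injective _ hle
  let ℓ : Ω[B⁄K] →ₗ[B] Ω[Bp⁄K] := KaehlerDifferential.map K K B Bp
  have : IsLocalizedModule p.primeCompl ℓ := KaehlerDifferential.isLocalizedModule_map _ _ _ _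
  have : Algebra.FormallySmooth K Bp :=
    have : Algebra.FormallySmooth B Bp := .of_isLocalization p.primeCompl
    .comp K B Bp
  obtain ⟨κ, a, b, hb⟩ := Module.exists_basis_of_span_of_flat _
    (KaehlerDifferential.span_range_map_derivation_of_isLocalization K _ Bp p.primeCompl)
  have : Finite κ := Module.Finite.finite_basis b
  have : Fintype κ := Fintype.ofFinite κ
  have hcard : Fintype.card κ = n := by
    rw [← hn, ← Module.finrank_eq_card_basis b, IsLocalization.finrank_eq Bp p.primeCompl hle,
      IsLocalizedModule.finrank_eq p.primeCompl ℓ hle]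
  let e : Fin n ≃ κ := (Fintype.equivFinOfCardEq hcard).symm
  let u : Fin n → B := a ∘ e
  let b' := b.reindex e.symm
  have hb' (i) : b' i = ℓ (KaehlerDifferential.D K B (u i)) := by
    simp [b', hb, u, ℓ]
  -- The partial derivatives, with their denominators.
  have hD (j : Fin n) : ∃ (D : Derivation K B B) (s : p.primeCompl),
      ∀ i, D (u i) = if i = j then (s : B) else 0 := by
    obtain ⟨g, s, hg⟩ := Module.FinitePresentation.exists_lift_of_isLocalizedModule p.primeCompl
      (Algebra.linearMap B Bp) (((b'.coord j).restrictScalars B) ∘ₗ ℓ)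
    refine ⟨g.compDer (KaehlerDifferential.D K B), s, fun i => hinjB ?_⟩
    have := LinearMap.congr_fun hg (KaehlerDifferential.D K B (u i))
    simp only [LinearMap.comp_apply, Algebra.linearMap_apply, LinearMap.smul_apply,
      LinearMap.restrictScalars_apply, ← hb', Module.Basis.coord_apply,
        Module.Basis.repr_self] at this
    change algebraMap B Bp (g (KaehlerDifferential.D K B (u i))) = _
    rw [this, Finsupp.single_apply]
    split_ifs
    · rw [Submonoid.smul_def, Algebra.smul_def, mul_one]
    · simp
  choose D s hs using hD
  have hgen : ∃ t : p.primeCompl, ∀ ω : Ω[B⁄K],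
      (t : B) • ω ∈ Submodule.span B (Set.range fun i => KaehlerDifferential.D K B (u i)) := by
    let N := Submodule.span B (Set.range fun i => KaehlerDifferential.D K B (u i))
    have h₁ (ω : Ω[B⁄K]) : ∃ t : p.primeCompl, (t : B) • ω ∈ N := by
      have h₂ : ∃ t : p.primeCompl, ∃ c : Fin n → B, ∀ i,
          algebraMap B Bp (c i) = (t : B) • b'.repr (ℓ ω) i := by
        obtain ⟨t, ht⟩ := IsLocalization.exist_integer_multiples_of_finset p.primeCompl
          (Finset.univ.image (b'.repr (ℓ ω)))
        have ht' (i) : ∃ c, algebraMap B Bp c = (t : B) • b'.repr (ℓ ω) i :=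
          ht _ (Finset.mem_image_of_mem _ (Finset.mem_univ i))
        choose c hc using ht'
        exact ⟨t, c, hc⟩
      obtain ⟨t, c, hc⟩ := h₂
      have h₃ : ℓ ((t : B) • ω) = ℓ (∑ i, c i • KaehlerDifferential.D K B (u i)) := by
        rw [map_smul, ← b'.sum_repr (ℓ ω), map_sum, Finset.smul_sum]
        refine Finset.sum_congr rfl fun i _ => ?_
        rw [map_smul, ← hb', ← algebraMap_smul Bp (c i), hc, smul_assoc]
      obtain ⟨r, hr⟩ := (IsLocalizedModule.eq_iff_exists p.primeCompl ℓ).1 h₃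
      refine ⟨r * t, ?_⟩
      rw [Submonoid.coe_mul, mul_smul]
      have : (r : B) • (t : B) • ω = (r : B) • ∑ i, c i • KaehlerDifferential.D K B (u i) := hr
      rw [this]
      exact N.smul_mem _ (N.sum_mem fun i _ => N.smul_mem _ (Submodule.subset_span ⟨i, rfl⟩))
    obtain ⟨S, hS⟩ := Module.Finite.fg_top (R := B) (M := Ω[B⁄K])
    choose t ht using h₁
    refine ⟨∏ ω ∈ S, t ω, fun ω => ?_⟩
    have hω : ω ∈ Submodule.span B (S : Set Ω[B⁄K]) := hS ▸ Submodule.mem_top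
    induction hω using Submodule.span_induction with
    | mem ω hω =>
      rw [← Finset.mul_prod_erase S t hω, mul_comm, Submonoid.coe_mul, mul_smul]
      exact N.smul_mem _ (ht ω)
    | zero => simp
    | add ω ω' _ _ h₁ h₂ => rw [smul_add]; exact add_mem h₁ h₂
    | smul b ω _ h₁ => rw [smul_comm]; exact N.smul_mem _ h₁
  obtain ⟨t, ht⟩ := hgen
  let h : B := (t : B) * ∏ j, (s j : B)
  refine ⟨u, fun j => ((t : B) * ∏ k ∈ Finset.univ.erase j, (s k : B)) • D j, h, ?_, ?_, ?_⟩
  · exact p.primeCompl.mul_mem t.2 (p.primeCompl.prod_mem fun j _ => (s j).2)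
  · intro i j
    rw [Derivation.smul_apply, hs, smul_eq_mul]
    split_ifs
    · rw [mul_assoc, Finset.prod_erase_mul _ _ (Finset.mem_univ j)]
    · rw [mul_zero]
  · intro ω
    change ((t : B) * ∏ j, (s j : B)) • ω ∈ _
    rw [mul_comm, mul_smul]
    exact Submodule.smul_mem _ _ (ht ω)

end Exists

/-! ### Generators of the ideal of the diagonal -/

section Diagonal

variable {K S : Type*} [CommRing K] [CommRing S] [Algebra K S]

/-- If, up to the denominator `h`, the differentials of the `u i` generate the module of
differentials, then the functions `1 ⊗ u i - u i ⊗ 1` generate the ideal of the diagonal up to a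
denominator which restricts to a power of `h` on the diagonal. -/
lemma exists_mul_mem_span_of_smul_mem_span [Algebra.EssFiniteType K S] {n : ℕ}
    (u : Fin n → S) (h : S)
    (hu : ∀ ω : Ω[S⁄K],
      h • ω ∈ Submodule.span S (Set.range fun i => KaehlerDifferential.D K S (u i))) :
    ∃ (E : S ⊗[K] S) (r : ℕ), Algebra.TensorProduct.lmul' (S := S) K E = h ^ r ∧
      ∀ z ∈ KaehlerDifferential.ideal K S,
        E * z ∈ Ideal.span (Set.range fun i => 1 ⊗ₜ[K] u i - u i ⊗ₜ[K] (1 : S)) := by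
  let R := S ⊗[K] S
  let I : Ideal R := KaehlerDifferential.ideal K S
  let J : Ideal R := Ideal.span (Set.range fun i => 1 ⊗ₜ[K] u i - u i ⊗ₜ[K] (1 : S))
  have hI : I.FG := KaehlerDifferential.ideal_fg K S
  have hδ (s : S) : 1 ⊗ₜ[K] s - s ⊗ₜ[K] (1 : S) ∈ I :=
    KaehlerDifferential.one_smul_sub_smul_one_mem_ideal K s
  let q : I →ₗ[R] Ω[S⁄K] := KaehlerDifferential.fromIdeal K S
  have hq (s : S) (z : I) : s • q z = q ((s ⊗ₜ[K] (1 : S)) • z) := by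
    rw [map_smul, ← algebraMap_smul R s (q z)]
    rfl
  have h₁ (z : I) : (((h ⊗ₜ[K] (1 : S)) • z : I) : R) ∈ J ⊔ I ^ 2 := by
    obtain ⟨c, hc⟩ := (Submodule.mem_span_range_iff_exists_fun S).1 (hu (q z))
    have h₂ : q ((h ⊗ₜ[K] (1 : S)) • z) =
        q (∑ i, (c i ⊗ₜ[K] (1 : S)) • (⟨1 ⊗ₜ[K] u i - u i ⊗ₜ[K] (1 : S), hδ _⟩ : I)) := by
      rw [← hq, ← hc, map_sum]
      refine Finset.sum_congr rfl fun i _ => ?_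
      rw [← hq]
      rfl
    have h₃ := (Ideal.toCotangent_eq I).1 h₂
    refine Submodule.mem_sup.2 ⟨_, ?_, _, h₃, add_sub_cancel _ _⟩
    rw [AddSubmonoidClass.coe_finsetSum]
    exact J.sum_mem fun i _ => J.mul_mem_left _ (Ideal.subset_span ⟨i, rfl⟩)
  -- Apply the Cayley-Hamilton theorem to multiplication by `h ⊗ 1` on `I / J`.
  let J' : Submodule R I := Submodule.comap (Submodule.subtype I) J
  have : Module.Finite R I := Module.Finite.iff_fg.2 hI
  let f : Module.End R (I ⧸ J') := LinearMap.lsmul R (I ⧸ J') (h ⊗ₜ[K] (1 : S))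
  have hf : LinearMap.range f ≤ I • ⊤ := by
    rintro _ ⟨x, rfl⟩
    obtain ⟨z, rfl⟩ := Submodule.mkQ_surjective J' x
    change (h ⊗ₜ[K] (1 : S)) • J'.mkQ z ∈ _
    rw [← map_smul]
    obtain ⟨y, hy, w, hw, hyw⟩ := Submodule.mem_sup.1 (h₁ z)
    have hyI : y ∈ I := by
      rw [eq_sub_of_add_eq hyw]
      exact sub_mem (Subtype.mem _) (Ideal.pow_le_self two_ne_zero hw)
    have hwI : w ∈ I := Ideal.pow_le_self two_ne_zero hw
    have e : (h ⊗ₜ[K] (1 : S)) • z = (⟨y, hyI⟩ : I) + ⟨w, hwI⟩ := Subtype.ext hyw.symm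
    have hy' : J'.mkQ ⟨y, hyI⟩ = 0 := (Submodule.Quotient.mk_eq_zero J').2 hy
    rw [e, map_add, hy', zero_add]
    have hw' : (⟨w, hwI⟩ : I) ∈ I • (⊤ : Submodule R I) := by
      have h₂ : (I • (⊤ : Submodule R I)).map (Submodule.subtype I) = I ^ 2 := by
        rw [Submodule.map_smul'', Submodule.map_top, Submodule.range_subtype, pow_two,
          smul_eq_mul]
      rw [← h₂] at hw
      obtain ⟨w', hw', rfl⟩ := hw
      exact hw'
    have h₃ := Submodule.mem_map_of_mem (f := J'.mkQ) hw'
    rw [Submodule.map_smul''] at h₃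
    exact Submodule.smul_mono le_rfl le_top h₃
  obtain ⟨p, hp, -, hcoeff, hpf⟩ :=
    LinearMap.exists_monic_and_natDegree_eq_and_coeff_mem_pow_and_aeval_eq_zero R f I hf
  refine ⟨p.eval (h ⊗ₜ[K] (1 : S)), p.natDegree, ?_, fun z hz => ?_⟩
  · have hI' (w : R) (hw : w ∈ I) : Algebra.TensorProduct.lmul' (S := S) K w = 0 := hw
    rw [Polynomial.eval_eq_sum_range, Finset.sum_range_succ, map_add, map_sum,
      Finset.sum_eq_zero, zero_add, hp.coeff_natDegree, one_mul, map_pow]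
    · simp
    · intro i hi
      rw [map_mul, hI' _ (Ideal.pow_le_self ?_ (hcoeff i)), zero_mul]
      have := Finset.mem_range.1 hi
      omega
  · have h₂ := LinearMap.congr_fun hpf (J'.mkQ ⟨z, hz⟩)
    have h₃ (p : Polynomial R) (x : I ⧸ J') :
        Polynomial.aeval f p x = p.eval (h ⊗ₜ[K] (1 : S)) • x := by
      have : f = algebraMap R (Module.End R (I ⧸ J')) (h ⊗ₜ[K] (1 : S)) := rfl
      rw [this, Polynomial.aeval_algebraMap_apply]
      rfl
    rw [h₃, LinearMap.zero_apply, ← map_smul] at h₂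
    exact (Submodule.Quotient.mk_eq_zero J').1 h₂

end Diagonal

/-! ### Extension of derivations and frames -/

section Extension

variable {K B B' N : Type u} [CommRing K] [CommRing B] [Algebra K B] [CommRing B'] [Algebra K B']
  [Algebra B B'] [IsScalarTower K B B'] [AddCommGroup N] [Module B' N] [Module K N]
  [IsScalarTower K B' N]

/-- Derivations extend along formally étale algebras. -/
lemma Derivation.exists_extension_of_formallyEtale [Module B N] [IsScalarTower K B N]
    [IsScalarTower B B' N] [Algebra.FormallyEtale B B']
    (D : Derivation K B N) : ∃ D' : Derivation K B' N, ∀ b, D' (algebraMap B B' b) = D b := by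
  let L : Ω[B'⁄K] →ₗ[B'] N :=
    (KaehlerDifferential.isBaseChange_of_formallyEtale K B B').lift D.liftKaehlerDifferential
  refine ⟨L.compDer (KaehlerDifferential.D K B'), fun b => ?_⟩
  change L (KaehlerDifferential.D K B' (algebraMap B B' b)) = D b
  rw [← KaehlerDifferential.map_D K K B B']
  exact ((KaehlerDifferential.isBaseChange_of_formallyEtale K B B').lift_eq _ _).trans
    (D.liftKaehlerDifferential_comp_D b)

lemma KaehlerDifferential.span_range_map_of_formallyEtale [Algebra.FormallyEtale B B'] :
    Submodule.span B' (Set.range (KaehlerDifferential.map K K B B')) = ⊤ := by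
  rw [eq_top_iff]
  intro ω _
  refine (KaehlerDifferential.isBaseChange_of_formallyEtale K B B').inductionOn ω _
    (zero_mem _) (fun m => Submodule.subset_span ⟨m, rfl⟩)
    (fun s n hn => Submodule.smul_mem _ s hn) fun _ _ => add_mem

/-- Frames extend along formally étale algebras. -/
lemma IsFrame.exists_extension [Algebra.FormallyEtale B B'] {n : ℕ} {w : Fin n → B}
    {D : Fin n → Derivation K B B} {h : B} (H : IsFrame K w D h) :
    ∃ D' : Fin n → Derivation K B' B',
      (∀ j b, D' j (algebraMap B B' b) = algebraMap B B' (D j b)) ∧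
      IsFrame K (fun i => algebraMap B B' (w i)) D' (algebraMap B B' h) := by
  have h₁ (j) := Derivation.exists_extension_of_formallyEtale (B' := B')
    ((Algebra.linearMap B B').compDer (D j))
  choose D' hD' using h₁
  refine ⟨D', hD', H.map KaehlerDifferential.span_range_map_of_formallyEtale _ _
    (fun _ => rfl) fun i j => ?_⟩
  rw [hD']
  change algebraMap B B' (D j (w i)) = _
  rw [H.apply_eq]
  split_ifs <;> simp

end Extension

section BaseChange

variable {K B k : Type u} [CommRing K] [CommRing B] [Algebra K B] [CommRing k] [Algebra K k]

attribute [local instance] Algebra.TensorProduct.rightAlgebra in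
/-- Frames are preserved by base change; moreover the coordinates may be translated by scalars. -/
lemma IsFrame.exists_baseChange {n : ℕ} {w : Fin n → B}
    {D : Fin n → Derivation K B B} {h : B} (H : IsFrame K w D h) (c : Fin n → k) :
    ∃ D' : Fin n → Derivation k (k ⊗[K] B) (k ⊗[K] B),
      IsFrame k (fun i => 1 ⊗ₜ w i - c i ⊗ₜ 1) D' (1 ⊗ₜ h) := by
  let T := k ⊗[K] B
  let e : T ⊗[B] Ω[B⁄K] ≃ₗ[T] Ω[T⁄k] := KaehlerDifferential.tensorKaehlerEquiv K k B T
  have he (t b) : e (t ⊗ₜ KaehlerDifferential.D K B b) =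
      t • KaehlerDifferential.D k T (1 ⊗ₜ b) :=
    KaehlerDifferential.tensorKaehlerEquiv_tmul_D K k B T t b
  let F (j : Fin n) : Ω[T⁄k] →ₗ[T] T :=
    LinearMap.liftBaseChange T
      ((Algebra.linearMap B T) ∘ₗ (D j).liftKaehlerDifferential) ∘ₗ e.symm.toLinearMap
  have hF (j b) : F j (KaehlerDifferential.D k T (1 ⊗ₜ b)) = 1 ⊗ₜ D j b := by
    have : KaehlerDifferential.D k T (1 ⊗ₜ b) = e (1 ⊗ₜ KaehlerDifferential.D K B b) := by
      rw [he, one_smul]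
    rw [this]
    simp only [F, LinearMap.comp_apply, LinearEquiv.coe_coe, LinearEquiv.symm_apply_apply,
      LinearMap.liftBaseChange_tmul, one_smul, Derivation.liftKaehlerDifferential_comp_D]
    rfl
  have hc (c : k) : KaehlerDifferential.D k T (c ⊗ₜ (1 : B)) = 0 :=
    (KaehlerDifferential.D k T).map_algebraMap c
  refine ⟨fun j => (F j).compDer (KaehlerDifferential.D k T), H.map (K' := k) (B' := T) ?_ _ _ ?_ ?_⟩
  · rw [eq_top_iff]
    rintro ω -
    obtain ⟨ω, rfl⟩ := e.surjective ω
    induction ω with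
    | zero => simp
    | add x y h₁ h₂ => rw [map_add]; exact add_mem h₁ h₂
    | tmul t ω =>
      have : e (t ⊗ₜ ω) = t • e (1 ⊗ₜ ω) := by
        rw [← map_smul, TensorProduct.smul_tmul', smul_eq_mul, mul_one]
      rw [this]
      refine Submodule.smul_mem _ _ (Submodule.subset_span ⟨ω, ?_⟩)
      have h₁ : KaehlerDifferential.map K k B T =
          (e.toLinearMap.restrictScalars B) ∘ₗ (TensorProduct.mk B T Ω[B⁄K] 1) := by
        ext b
        simp [he]
        rfl
      rw [h₁]
      rfl
  · intro i
    rw [map_sub, hc, sub_zero]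
    rfl
  · intro i j
    change F j (KaehlerDifferential.D k T (1 ⊗ₜ w i - c i ⊗ₜ 1)) = _
    rw [map_sub, hc, sub_zero, hF, H.apply_eq]
    split_ifs
    · rfl
    · simp

end BaseChange

/-! ### Determinants in smooth algebras -/

section Det

variable {k T : Type u} [Field k] [CommRing T] [Algebra k T] [Algebra.Smooth k T] {n : ℕ}
  {x : Fin n → T} {D : Fin n → Derivation k T T} {h : T}

/-- The determinant criterion at a point of a smooth algebra at which the coordinates of a frame
vanish. -/
lemma IsFrame.mul_det_notMem (H : IsFrame k x D h) (N : Ideal T) [N.IsPrime] (hN : h ∉ N)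
    (hx : ∀ i, x i ∈ N) (M : Matrix (Fin n) (Fin n) T) (m : ℕ)
    (hM : ∀ i, ∃ y, y ∉ N ∧ y * x i ^ (m + 1) ∈ Ideal.span (Set.range (M.mulVec x)))
    (s : T) (hs : s ∉ N) : s * M.det ∉ Ideal.span (Set.range (M.mulVec x)) := by
  intro hdet
  let P := MvPolynomial (Fin n) k
  let Th := Localization.Away h
  let O := Localization.AtPrime N
  have hle : Submonoid.powers h ≤ N.primeCompl := by
    rw [Submonoid.powers_le]
    exact hN
  have hunit (y : Submonoid.powers h) : IsUnit (algebraMap T O y) :=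
    IsLocalization.map_units O (⟨y, hle y.2⟩ : N.primeCompl)
  let : Algebra Th O := (IsLocalization.lift hunit : Th →+* O).toAlgebra
  have : IsScalarTower T Th O := .of_algebraMap_eq fun t =>
    (IsLocalization.lift_eq hunit t).symm
  have : IsLocalization (N.primeCompl.map (algebraMap T Th)) O :=
    IsLocalization.isLocalization_of_submonoid_le Th O _ _ hle
  have := Algebra.FormallyEtale.of_isLocalization (Rₘ := Th) (Submonoid.powers h)
  obtain ⟨D', -, H'⟩ := H.exists_extension (B' := Th)
  have hu : IsUnit (algebraMap T Th h) := IsLocalization.Away.algebraMap_isUnit h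
  let : Algebra P Th := (MvPolynomial.aeval fun i => algebraMap T Th (x i)).toAlgebra
  have hX (i) : algebraMap P Th (MvPolynomial.X i) = algebraMap T Th (x i) :=
    MvPolynomial.aeval_X _ i
  have : IsScalarTower k P Th := .of_algebraMap_eq fun c =>
    (MvPolynomial.aeval_C (fun i => algebraMap T Th (x i)) c).symm
  have : Algebra.Smooth k Th := .comp k T Th
  have := H'.etale hu hX
  let : Algebra P O := ((algebraMap Th O).comp (algebraMap P Th)).toAlgebra
  have : IsScalarTower P Th O := .of_algebraMap_eq' rfl
  have : Module.Flat Th O := IsLocalization.flat _ (N.primeCompl.map (algebraMap T Th))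
  have : Module.Flat P O := .trans P Th O
  have hX' (i) : algebraMap P O (MvPolynomial.X i) = algebraMap T O (x i) := by
    rw [IsScalarTower.algebraMap_apply P Th O, hX, ← IsScalarTower.algebraMap_apply]
  have hspan : (Ideal.span (Set.range (M.mulVec x))).map (algebraMap T O) =
      Ideal.span (Set.range ((M.map (algebraMap T O)).mulVec fun i => algebraMap T O (x i))) := by
    rw [Ideal.map_span, ← Set.range_comp]
    congr 2
    ext i
    simp [Matrix.mulVec, dotProduct]
  have hmem (y t : T) (hy : y ∉ N) (ht : y * t ∈ Ideal.span (Set.range (M.mulVec x))) :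
      algebraMap T O t ∈
        Ideal.span (Set.range ((M.map (algebraMap T O)).mulVec fun i => algebraMap T O (x i))) := by
    have h₁ := Ideal.mem_map_of_mem (algebraMap T O) ht
    rw [map_mul] at h₁
    rw [← hspan]
    exact (Ideal.unit_mul_mem_iff_mem _
      (IsLocalization.map_units O (⟨y, hy⟩ : N.primeCompl))).1 h₁
  refine det_notMem_span_mulVec_of_flat (fun i => algebraMap T O (x i)) hX' ?_ m
    (M.map (algebraMap T O)) (fun i => ?_) ?_
  · refine ne_top_of_le_ne_top (IsLocalRing.maximalIdeal.isMaximal O).ne_top ?_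
    rw [Ideal.span_le]
    rintro _ ⟨i, rfl⟩
    exact (IsLocalization.AtPrime.to_map_mem_maximal_iff O N _).2 (hx i)
  · obtain ⟨y, hy, hy'⟩ := hM i
    rw [← map_pow]
    exact hmem y _ hy hy'
  · have := hmem s _ hs hdet
    rwa [RingHom.map_det] at this

end Det

/-! ### An annihilator of the diagonal -/

/-- At a prime of an Artinian ring, the powers of the prime ideal vanish locally. -/
lemma exists_notMem_mul_pow_eq_zero {Q : Type*} [CommRing Q] [IsArtinianRing Q] (N : Ideal Q)
    [N.IsPrime] : ∃ (y : Q) (m : ℕ), y ∉ N ∧ ∀ z ∈ N, y * z ^ (m + 1) = 0 := by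
  obtain ⟨m, hm⟩ := IsArtinian.monotone_stabilizes (R := Q) (M := Q)
    ⟨fun k => OrderDual.toDual (N ^ k), fun a b hab => Ideal.pow_le_pow_right hab⟩
  have hm' : N ^ m = N ^ (m + 1) := hm (m + 1) (Nat.le_succ m)
  obtain ⟨r, hr, hr'⟩ := Submodule.exists_sub_one_mem_and_smul_eq_zero_of_fg_of_le_smul N (N ^ m)
    (IsNoetherian.noetherian _) (by rw [smul_eq_mul, ← pow_succ']; exact hm'.le)
  refine ⟨r, m, fun h => ?_, fun z hz => hr' _ (Ideal.pow_le_pow_right (Nat.le_succ m)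
    (Ideal.pow_mem_pow hz _))⟩
  apply (inferInstance : N.IsPrime).ne_top
  rw [Ideal.eq_top_iff_one]
  simpa using sub_mem h hr

section

variable {K A B k : Type u} [CommRing K] [CommRing A] [CommRing B] [Field k]
  [Algebra K A] [Algebra K B] [Algebra K k] [Algebra A B] [Algebra A k] [Algebra B k]
  [IsScalarTower K A B] [IsScalarTower K A k] [IsScalarTower K B k] [IsScalarTower A B k]

/-- If the differentials of the `a i` generate the module of differentials of `A`, then the
kernel of `k ⊗[K] B → k ⊗[A] B` is generated by the `1 ⊗ a i - a i ⊗ 1`, up to an element `ε` which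
becomes `1` under `k ⊗[K] B → k`. -/
lemma exists_mul_mem_span_of_mapOfCompatibleSMul_eq_zero [Algebra.EssFiniteType K A] {n : ℕ}
    (a : Fin n → A)
    (ha : ∀ ω : Ω[A⁄K], ω ∈ Submodule.span A (Set.range fun i => KaehlerDifferential.D K A (a i))) :
    ∃ ε : k ⊗[K] B, Algebra.TensorProduct.lift (Algebra.ofId k k) (IsScalarTower.toAlgHom K B k)
      (fun _ _ => Commute.all _ _) ε = 1 ∧
      ∀ z : k ⊗[K] B, Algebra.TensorProduct.mapOfCompatibleSMul A K A k B z = 0 →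
        ε * z ∈ Ideal.span (Set.range fun i =>
          1 ⊗ₜ[K] algebraMap A B (a i) - algebraMap A k (a i) ⊗ₜ[K] (1 : B)) := by
  obtain ⟨E, r, hE, hE'⟩ := exists_mul_mem_span_of_smul_mem_span (K := K) a 1 fun ω => by
    rw [one_smul]
    exact ha ω
  let χ : A ⊗[K] A →ₐ[K] k ⊗[K] B :=
    Algebra.TensorProduct.map (IsScalarTower.toAlgHom K A k) (IsScalarTower.toAlgHom K A B)
  let J : Ideal (k ⊗[K] B) := Ideal.span (Set.range fun i =>
          1 ⊗ₜ[K] algebraMap A B (a i) - algebraMap A k (a i) ⊗ₜ[K] (1 : B))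
  have hδ (b : A) : χ (1 ⊗ₜ b - b ⊗ₜ 1) = 1 ⊗ₜ algebraMap A B b - algebraMap A k b ⊗ₜ 1 := by
    simp [χ]
  have hJ (z) (hz : z ∈ KaehlerDifferential.ideal K A) : χ E * χ z ∈ J := by
    rw [← map_mul]
    have := Ideal.mem_map_of_mem χ (hE' z hz)
    rw [Ideal.map_span, ← Set.range_comp] at this
    convert this using 3
    ext i
    exact (hδ _).symm
  refine ⟨χ E, ?_, fun z hz => ?_⟩
  · have h₁ : ((Algebra.TensorProduct.lift (Algebra.ofId k k) (IsScalarTower.toAlgHom K B k)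
        (fun _ _ => Commute.all _ _)).restrictScalars K).comp χ =
        (IsScalarTower.toAlgHom K A k).comp (Algebra.TensorProduct.lmul' (S := A) K) := by
      ext b
      · simp [χ]
      · simp [χ, ← IsScalarTower.algebraMap_apply]
    have h₂ := DFunLike.congr_fun h₁ E
    rw [AlgHom.comp_apply, AlgHom.comp_apply, hE, one_pow, map_one] at h₂
    exact h₂
  · have h₁ : z ∈ LinearMap.ker (TensorProduct.mapOfCompatibleSMul A K A k B) := hz
    rw [TensorProduct.AlgebraTensorModule.ker_mapOfCompatibleSMul] at h₁
    change χ E * z ∈ J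
    clear hz
    induction h₁ using Submodule.span_induction with
    | mem z hz =>
      obtain ⟨b, c, d, rfl⟩ := hz
      have h₂ : (b • c) ⊗ₜ[K] d - c ⊗ₜ[K] (b • d) =
          - (c ⊗ₜ d) * χ (1 ⊗ₜ b - b ⊗ₜ 1) := by
        rw [hδ, mul_sub, neg_mul, neg_mul, Algebra.TensorProduct.tmul_mul_tmul,
          Algebra.TensorProduct.tmul_mul_tmul, mul_one, mul_one, sub_neg_eq_add,
          Algebra.smul_def, Algebra.smul_def, mul_comm c, mul_comm d]
        abel
      rw [h₂, mul_left_comm]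
      exact J.mul_mem_left _ (hJ _ (KaehlerDifferential.one_smul_sub_smul_one_mem_ideal K b))
    | zero => simp
    | add x y _ _ h₁ h₂ => rw [mul_add]; exact add_mem h₁ h₂
    | smul b z _ h₁ =>
      rw [Algebra.smul_def, mul_left_comm]
      exact J.mul_mem_left _ h₁

/-- The derivation identity `μ (m i j) * h = D j (f i)` for functions `f i` whose
differences `1 ⊗ f i - f i ⊗ 1` are expanded, up to the factor `E`, in terms of the coordinates. -/
lemma IsFrame.lmul'_mul_eq {n : ℕ} {w : Fin n → B} {D : Fin n → Derivation K B B} {h : B}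
    (H : IsFrame K w D h) (E : B ⊗[K] B) (f : B) (m : Fin n → B ⊗[K] B)
    (hm : ∑ j, m j * (1 ⊗ₜ w j - w j ⊗ₜ 1) = E * (1 ⊗ₜ f - f ⊗ₜ 1)) (j : Fin n) :
    Algebra.TensorProduct.lmul' (S := B) K (m j) * h =
      Algebra.TensorProduct.lmul' (S := B) K E * D j f := by
  let Φ : B ⊗[K] B →ₗ[K] B := LinearMap.mul' K B ∘ₗ TensorProduct.map .id (D j : B →ₗ[K] B)
  have hΦ (x y : B) : Φ (x ⊗ₜ y) = x * D j y := rfl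
  have h₁ (z : B ⊗[K] B) (b : B) : Φ (z * (1 ⊗ₜ b - b ⊗ₜ 1)) =
      Algebra.TensorProduct.lmul' (S := B) K z * D j b := by
    induction z with
    | zero => simp
    | add x y hx hy => rw [add_mul, map_add, hx, hy, map_add, add_mul]
    | tmul x y =>
      rw [mul_sub, Algebra.TensorProduct.tmul_mul_tmul, Algebra.TensorProduct.tmul_mul_tmul,
        map_sub, hΦ, hΦ, Algebra.TensorProduct.lmul'_apply_tmul, mul_one, mul_one,
        Derivation.leibniz, smul_eq_mul, smul_eq_mul]
      ring
  have h₂ := congrArg Φ hm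
  rw [map_sum, h₁] at h₂
  rw [← h₂]
  simp only [h₁, H.apply_eq]
  simp

/-- For a finite morphism of smooth schemes of the same dimension, locally at a point with residue
field `k`, there is an element `Δ` of `B ⊗[A] B` which annihilates the ideal of the diagonal,
whose restriction to the diagonal is the Jacobian determinant up to units at the point, and
which does not vanish on the fibre through the point.

It is the determinant of a matrix which expresses the equations `1 ⊗ a i - a i ⊗ 1` of
`B ⊗[A] B` in `B ⊗[K] B` in terms of local equations `1 ⊗ w j - w j ⊗ 1` of the diagonal; that it
does not vanish on the fibre is Wiebe's theorem. -/
lemma exists_annihilator_diagonal [Algebra.EssFiniteType K A] [Algebra.Smooth K B]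
    [Module.Finite A B] {n : ℕ} (a : Fin n → A)
    (ha : ∀ ω : Ω[A⁄K], ω ∈ Submodule.span A (Set.range fun i => KaehlerDifferential.D K A (a i)))
    {w : Fin n → B} {D : Fin n → Derivation K B B} {h : B} (H : IsFrame K w D h)
    (hk : algebraMap B k h ≠ 0) :
    ∃ (Δ : B ⊗[A] B) (r s : ℕ), (∀ b, Δ * (1 ⊗ₜ b - b ⊗ₜ 1) = 0) ∧
      h ^ r * Algebra.TensorProduct.lmul' (S := B) A Δ =
        h ^ s * (Matrix.of fun i j => D j (algebraMap A B (a i))).det ∧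
      Algebra.TensorProduct.map (IsScalarTower.toAlgHom A B k) (AlgHom.id A B) Δ ≠ 0 := by
  classical
  obtain ⟨E, r, hE, hE'⟩ := exists_mul_mem_span_of_smul_mem_span w h H.smul_mem
  let f (i : Fin n) : B := algebraMap A B (a i)
  have hm (i) : ∃ m : Fin n → B ⊗[K] B,
      ∑ j, m j * (1 ⊗ₜ w j - w j ⊗ₜ 1) = E * (1 ⊗ₜ f i - f i ⊗ₜ 1) :=
    Ideal.mem_span_range_iff_exists_fun.1
      (hE' _ (KaehlerDifferential.one_smul_sub_smul_one_mem_ideal K (f i)))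
  choose m hm using hm
  let m' : Matrix (Fin n) (Fin n) (B ⊗[K] B) := Matrix.of m
  let π : B ⊗[K] B →ₐ[A] B ⊗[A] B := Algebra.TensorProduct.mapOfCompatibleSMul A K A B B
  have hπf (i) : π (1 ⊗ₜ f i - f i ⊗ₜ 1) = 0 := by
    change (1 : B) ⊗ₜ[A] f i - f i ⊗ₜ[A] (1 : B) = 0
    simp only [f, Algebra.algebraMap_eq_smul_one, TensorProduct.tmul_smul, TensorProduct.smul_tmul',
      sub_self]
  have hdet (j) : π m'.det * π (1 ⊗ₜ w j - w j ⊗ₜ 1) = 0 := by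
    have h₁ : (m'.map π).mulVec (fun j => π (1 ⊗ₜ w j - w j ⊗ₜ 1)) = 0 := by
      ext i
      simp only [Matrix.mulVec, dotProduct, Matrix.map_apply, m', Matrix.of_apply, ← map_mul,
        ← map_sum, hm, Pi.zero_apply]
      rw [map_mul, hπf, mul_zero]
    have h₂ := congrArg (m'.map π).adjugate.mulVec h₁
    rw [Matrix.mulVec_mulVec, Matrix.adjugate_mul, Matrix.smul_mulVec, Matrix.one_mulVec,
      Matrix.mulVec_zero] at h₂
    have h₃ := congrFun h₂ j
    have h₄ : (m'.map π).det = π m'.det := (AlgHom.map_det π m').symm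
    rwa [h₄] at h₃
  refine ⟨π (E * m'.det), n, r * (n + 1), fun b => ?_, ?_, ?_⟩
  · obtain ⟨c, hc⟩ := Ideal.mem_span_range_iff_exists_fun.1
      (hE' _ (KaehlerDifferential.one_smul_sub_smul_one_mem_ideal K b))
    change π (E * m'.det) * π (1 ⊗ₜ b - b ⊗ₜ 1) = 0
    rw [← map_mul, mul_right_comm, ← hc, Finset.sum_mul, map_sum]
    refine Finset.sum_eq_zero fun j _ => ?_
    rw [mul_assoc, mul_comm (1 ⊗ₜ w j - w j ⊗ₜ 1), map_mul, map_mul, hdet, mul_zero]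
  · have h₁ (z : B ⊗[K] B) : Algebra.TensorProduct.lmul' (S := B) A (π z) =
        Algebra.TensorProduct.lmul' (S := B) K z := by
      induction z with
      | zero => simp
      | add x y hx hy => rw [map_add, map_add, hx, hy, map_add]
      | tmul x y => simp [π]
    rw [h₁, map_mul, hE, AlgHom.map_det]
    have h₂ : h • ((Algebra.TensorProduct.lmul' (S := B) K).mapMatrix m') =
        h ^ r • (Matrix.of fun i j => D j (algebraMap A B (a i))) := by
      ext i j
      have := H.lmul'_mul_eq E (f i) (m i) (hm i) j
      rw [hE] at this
      rw [Matrix.smul_apply, smul_eq_mul, mul_comm]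
      exact this
    have h₃ := congrArg Matrix.det h₂
    rw [Matrix.det_smul, Matrix.det_smul, Fintype.card_fin] at h₃
    rw [mul_left_comm, h₃]
    ring
  · intro h0
    let φ : B ⊗[K] B →ₐ[K] k ⊗[K] B :=
      Algebra.TensorProduct.map (IsScalarTower.toAlgHom K B k) (AlgHom.id K B)
    let ρ : k ⊗[K] B →ₐ[A] k ⊗[A] B := Algebra.TensorProduct.mapOfCompatibleSMul A K A k B
    have hρφ (z) : ρ (φ z) =
        Algebra.TensorProduct.map (IsScalarTower.toAlgHom A B k) (AlgHom.id A B) (π z) := by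
      induction z with
      | zero => simp
      | add x y hx hy => rw [map_add, map_add, hx, hy, map_add, map_add]
      | tmul x y => simp [π, ρ, φ]
    let ev : k ⊗[K] B →ₐ[k] k := Algebra.TensorProduct.lift (Algebra.ofId k k)
      (IsScalarTower.toAlgHom K B k) (fun _ _ => Commute.all _ _)
    let evA : k ⊗[A] B →ₐ[k] k := Algebra.TensorProduct.lift (Algebra.ofId k k)
      (IsScalarTower.toAlgHom A B k) (fun _ _ => Commute.all _ _)
    have hev (z) : evA (ρ z) = ev z := by
      induction z with
      | zero => simp
      | add x y hx hy => rw [map_add, map_add, hx, hy, map_add]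
      | tmul x y => simp [ρ, ev, evA]
    have hevφ (z) : ev (φ z) = algebraMap B k (Algebra.TensorProduct.lmul' (S := B) K z) := by
      induction z with
      | zero => simp
      | add x y hx hy => rw [map_add, map_add, hx, hy, map_add, map_add]
      | tmul x y => simp [ev, φ]
    let N : Ideal (k ⊗[K] B) := RingHom.ker ev
    have hNp : N.IsPrime := RingHom.ker_isPrime _
    let NQ : Ideal (k ⊗[A] B) := RingHom.ker evA
    have hNQ : NQ.IsPrime := RingHom.ker_isPrime _
    obtain ⟨ε, hε, hε'⟩ := exists_mul_mem_span_of_mapOfCompatibleSMul_eq_zero (B := B) (k := k) a ha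
    have hεN : ε ∉ N := by
      rw [RingHom.mem_ker]
      exact hε.trans_ne one_ne_zero
    obtain ⟨D', H'⟩ := H.exists_baseChange (fun i => algebraMap B k (w i))
    let x (i : Fin n) : k ⊗[K] B := 1 ⊗ₜ w i - algebraMap B k (w i) ⊗ₜ 1
    have hx (i) : φ (1 ⊗ₜ w i - w i ⊗ₜ 1) = x i := by simp [φ, x]
    have hxN (i) : x i ∈ N := by
      rw [RingHom.mem_ker, ← hx, hevφ]
      simp
    have hEN : φ E ∉ N := by
      rw [RingHom.mem_ker, hevφ, hE, map_pow]
      exact pow_ne_zero _ hk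
    let M := m'.map φ
    let J := Ideal.span (Set.range (M.mulVec x))
    have hMx (i) : M.mulVec x i = φ E * (1 ⊗ₜ f i - algebraMap A k (a i) ⊗ₜ 1) := by
      have h₁ := congrArg φ (hm i)
      rw [map_sum, map_mul] at h₁
      simp only [map_mul, hx] at h₁
      have h₂ : φ (1 ⊗ₜ f i - f i ⊗ₜ 1) = 1 ⊗ₜ f i - algebraMap A k (a i) ⊗ₜ 1 := by
        simp [φ, f, ← IsScalarTower.algebraMap_apply]
      rw [h₂] at h₁
      exact h₁
    -- `φ E * ε` multiplies the kernel of `ρ` into the ideal of the entries of `M x`.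
    have hker (z) (hz : ρ z = 0) : (φ E * ε) * z ∈ J := by
      have h₁ := hε' z hz
      rw [mul_assoc]
      obtain ⟨c, hc⟩ := Ideal.mem_span_range_iff_exists_fun.1 h₁
      rw [← hc, Finset.mul_sum]
      refine J.sum_mem fun i _ => ?_
      rw [mul_left_comm, ← hMx]
      exact J.mul_mem_left _ (Ideal.subset_span ⟨i, rfl⟩)
    have : IsArtinianRing (k ⊗[A] B) := IsArtinianRing.of_finite k _
    obtain ⟨y', M', hy', hyM⟩ := exists_notMem_mul_pow_eq_zero NQ
    obtain ⟨y, rfl⟩ := Algebra.TensorProduct.mapOfCompatibleSMul_surjective A K A k B y'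
    have hyN : y ∉ N := fun hy => hy' (by
      rw [RingHom.mem_ker] at hy ⊢
      exact (hev y).trans hy)
    refine H'.mul_det_notMem N ?_ hxN M M' (fun i => ⟨φ E * ε * y, ?_, ?_⟩) (φ E * ε * φ E) ?_ ?_
    · rw [RingHom.mem_ker]
      simpa [ev] using hk
    · exact N.primeCompl.mul_mem (N.primeCompl.mul_mem hEN hεN) hyN
    · rw [mul_assoc]
      refine hker _ ?_
      rw [map_mul, map_pow]
      exact hyM _ (by rw [RingHom.mem_ker, hev]; exact hxN i)
    · exact N.primeCompl.mul_mem (N.primeCompl.mul_mem hEN hεN) hEN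
    · rw [mul_assoc]
      refine hker _ ?_
      have h₁ : M.det = φ m'.det := (AlgHom.map_det φ m').symm
      rw [h₁, ← map_mul, hρφ]
      exact h0

end

/-! ### Integrality of traces -/

section

/-- If `Δ ∈ L ⊗ L` annihilates the ideal of the diagonal, then contracting its second factor with
the functional `Tr (y · )` gives `y` times the restriction of `Δ` to the diagonal: multiplication by
`Δ * (1 ⊗ y)` is an endomorphism of rank one, and both sides are its trace. -/
lemma mul'_map_trace_eq {k L : Type*} [Field k] [Field L] [Algebra k L] [FiniteDimensional k L]
    (Δ : L ⊗[k] L) (hΔ : ∀ x : L, Δ * (1 ⊗ₜ x - x ⊗ₜ 1) = 0) (y : L) :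
    LinearMap.mul' k L (TensorProduct.map .id
      (Algebra.linearMap k L ∘ₗ Algebra.trace k L ∘ₗ LinearMap.mulLeft k y) Δ) =
      y * Algebra.TensorProduct.lmul' (S := L) k Δ := by
  have h₁ (z : L ⊗[k] L) : Algebra.trace L (L ⊗[k] L) (z * 1 ⊗ₜ y) =
      LinearMap.mul' k L (TensorProduct.map .id
        (Algebra.linearMap k L ∘ₗ Algebra.trace k L ∘ₗ LinearMap.mulLeft k y) z) := by
    induction z with
    | zero => simp
    | add a b ha hb => rw [add_mul, map_add, ha, hb, map_add, map_add]
    | tmul a b =>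
      have h₂ : (a ⊗ₜ[k] b) * (1 ⊗ₜ y) = a • ((1 : L) ⊗ₜ[k] (y * b)) := by
        simp [TensorProduct.smul_tmul', mul_comm]
      have h₃ : Algebra.lmul L (L ⊗[k] L) (1 ⊗ₜ (y * b)) =
          (Algebra.lmul k L (y * b)).baseChange L := by
        ext x
        simp
      rw [h₂, map_smul, Algebra.trace_apply, h₃, LinearMap.trace_baseChange]
      simp [Algebra.trace_apply]
  rw [← h₁, Algebra.trace_apply]
  let F : L ⊗[k] L →ₗ[L] L :=
    y • (Algebra.TensorProduct.lift (Algebra.ofId L L) (AlgHom.id k L)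
      (fun _ _ => Commute.all _ _)).toLinearMap
  have h₂ : Algebra.lmul L (L ⊗[k] L) (Δ * 1 ⊗ₜ y) = F.smulRight Δ := by
    ext x
    have h₃ : Δ * 1 ⊗ₜ (y * x) = Δ * (y * x) ⊗ₜ 1 := by
      rw [← sub_eq_zero, ← mul_sub, hΔ]
    have h₄ : ((y * x) • Δ) = Δ * (y * x) ⊗ₜ 1 := by
      rw [Algebra.smul_def, mul_comm]
      rfl
    change Δ * 1 ⊗ₜ y * 1 ⊗ₜ x = F (1 ⊗ₜ x) • Δ
    rw [mul_assoc, Algebra.TensorProduct.tmul_mul_tmul, one_mul, h₃, ← h₄]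
    simp [F]
  rw [h₂, LinearMap.trace_smulRight]
  have h₅ : (Algebra.TensorProduct.lift (Algebra.ofId L L) (AlgHom.id k L)
      (fun _ _ => Commute.all _ _) : L ⊗[k] L →ₐ[L] L).restrictScalars k =
        Algebra.TensorProduct.lmul' (S := L) k := by
    ext <;> simp
  rw [← h₅]
  rfl

variable {A B κ LA LB : Type*} [CommRing A] [CommRing B] [Algebra A B]

/-- The elements of `P ⊗ B` are detected by functionals on the projective module `B`. -/
lemma exists_rid_map_ne_zero [Module.Finite A B] [Module.Projective A B] [CommRing κ] [Algebra A κ]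
    (z : κ ⊗[A] B) (hz : z ≠ 0) :
    ∃ g : B →ₗ[A] A, TensorProduct.rid A κ (TensorProduct.map .id g z) ≠ 0 := by
  obtain ⟨n, f, g, -, -, hfg⟩ := Module.Finite.exists_comp_eq_id_of_projective A B
  by_contra! hg
  apply hz
  have h₁ (z : κ ⊗[A] B) : z = ∑ i, (TensorProduct.rid A κ (TensorProduct.map .id
      (LinearMap.proj i ∘ₗ g) z)) ⊗ₜ[A] f (Pi.single i 1) := by
    induction z with
    | zero => simp
    | add x y hx hy =>
      simp only [map_add, TensorProduct.add_tmul, Finset.sum_add_distrib, ← hx, ← hy]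
    | tmul x y =>
      conv_lhs => rw [← LinearMap.id_apply (R := A) y, ← hfg, LinearMap.comp_apply,
        LinearMap.pi_apply_eq_sum_univ f, TensorProduct.tmul_sum]
      refine Finset.sum_congr rfl fun i _ => ?_
      have h₂ : (fun j => if i = j then (1 : A) else 0) = Pi.single i 1 := by
        ext j
        simp [Pi.single_apply, eq_comm]
      simp [h₂, TensorProduct.smul_tmul]
  rw [h₁ z]
  refine Finset.sum_eq_zero fun i _ => ?_
  rw [hg, TensorProduct.zero_tmul]

variable [IsDomain A] [IsDomain B] [FaithfulSMul A B] [Module.Finite A B]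
  [Field LA] [Field LB] [Algebra A LA] [IsFractionRing A LA] [Algebra B LB] [IsFractionRing B LB]
  [Algebra A LB] [IsScalarTower A B LB] [Algebra LA LB] [IsScalarTower A LA LB]
  [FiniteDimensional LA LB] [Algebra.IsSeparable LA LB]

/-- A functional on `B` is given by the trace form of the fraction fields. -/
lemma exists_trace_mul_eq (g : B →ₗ[A] A) : ∃ y : LB, ∀ b, algebraMap A LA (g b) =
    Algebra.trace LA LB (y * algebraMap B LB b) := by
  have hB : IsBaseChange LA (IsScalarTower.toAlgHom A B LB).toLinearMap :=
    Algebra.IsAlgebraic.isBaseChange_of_isFractionRing A B LA LB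
  let g' : LB →ₗ[LA] LA := hB.lift (Algebra.linearMap A LA ∘ₗ g)
  obtain ⟨y, hy⟩ := ((Algebra.traceForm LA LB).toDual (traceForm_nondegenerate LA LB)).surjective g'
  refine ⟨y, fun b => ?_⟩
  have h₁ := DFunLike.congr_fun hy (algebraMap B LB b)
  rw [LinearMap.BilinForm.toDual_def, Algebra.traceForm_apply] at h₁
  rw [h₁]
  exact (hB.lift_eq (Algebra.linearMap A LA ∘ₗ g) b).symm

/-- If `Δ` annihilates the ideal of the diagonal and `w` times its restriction to the diagonal is
integral, then `w` times a contraction of `Δ` with a functional of `B`, and every multiple of this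
by an element of `B`, has integral trace. -/
lemma trace_mul_contraction_mem (Δ : B ⊗[A] B) (hΔ : ∀ b : B, Δ * (1 ⊗ₜ b - b ⊗ₜ 1) = 0)
    (g : B →ₗ[A] A) (w : LB)
    (hw : w * algebraMap B LB (Algebra.TensorProduct.lmul' (S := B) A Δ) ∈ (algebraMap B LB).range)
    (z : B) : Algebra.trace LA LB (w * algebraMap B LB (TensorProduct.rid A B
      (TensorProduct.map .id g Δ) * z)) ∈ (algebraMap A LA).range := by
  obtain ⟨y, hy⟩ := exists_trace_mul_eq (LA := LA) (LB := LB) g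
  let P : B ⊗[A] B →ₐ[A] LB ⊗[LA] LB :=
    Algebra.TensorProduct.lift
      (((Algebra.TensorProduct.includeLeft : LB →ₐ[LA] LB ⊗[LA] LB).restrictScalars A).comp
        (IsScalarTower.toAlgHom A B LB))
      (((Algebra.TensorProduct.includeRight : LB →ₐ[LA] LB ⊗[LA] LB).restrictScalars A).comp
        (IsScalarTower.toAlgHom A B LB)) (fun _ _ => Commute.all _ _)
  have hP (a b : B) : P (a ⊗ₜ b) = algebraMap B LB a ⊗ₜ algebraMap B LB b := by simp [P]
  have hPΔ (x : LB) : P Δ * (1 ⊗ₜ x - x ⊗ₜ 1) = 0 := by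
    have hB : IsBaseChange LA (IsScalarTower.toAlgHom A B LB).toLinearMap :=
      Algebra.IsAlgebraic.isBaseChange_of_isFractionRing A B LA LB
    induction x using hB.inductionOn with
    | zero => simp
    | tmul b =>
      have := congrArg P (hΔ b)
      rw [map_mul, map_sub, hP, hP, map_zero, map_one] at this
      exact this
    | smul c x hx =>
      rw [TensorProduct.tmul_smul, ← TensorProduct.smul_tmul', ← smul_sub, mul_smul_comm, hx,
        smul_zero]
    | add x y hx hy =>
      rw [TensorProduct.tmul_add, TensorProduct.add_tmul, add_sub_add_comm, mul_add, hx, hy,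
        add_zero]
  have h₁ := mul'_map_trace_eq (P Δ) hPΔ y
  have h₂ (t : B ⊗[A] B) : LinearMap.mul' LA LB (TensorProduct.map .id
      (Algebra.linearMap LA LB ∘ₗ Algebra.trace LA LB ∘ₗ LinearMap.mulLeft LA y) (P t)) =
      algebraMap B LB (TensorProduct.rid A B (TensorProduct.map .id g t)) := by
    induction t with
    | zero => simp
    | add a b ha hb => simp only [map_add, ha, hb]
    | tmul a b =>
      rw [hP]
      simp [← hy, Algebra.smul_def, ← IsScalarTower.algebraMap_apply, mul_comm]
  have h₃ (t : B ⊗[A] B) : Algebra.TensorProduct.lmul' (S := LB) LA (P t) =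
      algebraMap B LB (Algebra.TensorProduct.lmul' (S := B) A t) := by
    induction t with
    | zero => simp
    | add a b ha hb => simp only [map_add, ha, hb]
    | tmul a b => simp [hP]
  rw [h₂, h₃] at h₁
  obtain ⟨c, hc⟩ := hw
  refine ⟨g (c * z), ?_⟩
  rw [hy]
  congr 1
  rw [map_mul, map_mul, hc, h₁]
  ring

/-- **Integrality of traces.** Let `w` be in the fraction field of `B`. Suppose that at every
maximal ideal of `B` there is an element `Δ` of `B ⊗[A] B` which annihilates the ideal of the
diagonal, does not vanish on the fibre, and whose restriction to the diagonal is, up to a unit, a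
denominator of `w`. Then the trace of `w` lies in `A`. -/
lemma trace_mem_range_of_annihilator_diagonal [Module.Projective A B] (w : LB)
    (H : ∀ n : Ideal B, ∀ _ : n.IsMaximal, ∃ (Δ : B ⊗[A] B) (u : B), u ∉ n ∧
      (∀ b, Δ * (1 ⊗ₜ b - b ⊗ₜ 1) = 0) ∧
      w * algebraMap B LB (u * Algebra.TensorProduct.lmul' (S := B) A Δ) ∈ (algebraMap B LB).range ∧
      Algebra.TensorProduct.map (Ideal.Quotient.mkₐ A n) (AlgHom.id A B) Δ ≠ 0) :
    Algebra.trace LA LB w ∈ (algebraMap A LA).range := by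
  let I : Ideal B :=
    { carrier := {e | ∀ z, Algebra.trace LA LB (w * algebraMap B LB (e * z)) ∈
        (algebraMap A LA).range}
      zero_mem' := fun z => by simp
      add_mem' := fun {a b} ha hb z => by
        rw [add_mul, map_add, mul_add, map_add]
        exact add_mem (ha z) (hb z)
      smul_mem' := fun c a ha z => by
        rw [smul_eq_mul, mul_comm c, mul_assoc]
        exact ha _ }
  have hI : I = ⊤ := by
    by_contra hI
    obtain ⟨n, hn, hIn⟩ := Ideal.exists_le_maximal I hI
    obtain ⟨Δ, u, hu, hΔ, huv, hΔn⟩ := H n hn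
    obtain ⟨g, hg⟩ := exists_rid_map_ne_zero _ hΔn
    have hg' (z : B ⊗[A] B) : TensorProduct.rid A (B ⧸ n) (TensorProduct.map .id g
        (Algebra.TensorProduct.map (Ideal.Quotient.mkₐ A n) (AlgHom.id A B) z)) =
        Ideal.Quotient.mk n (TensorProduct.rid A B (TensorProduct.map .id g z)) := by
      induction z with
      | zero => simp
      | add a b ha hb => simp only [map_add, ha, hb]
      | tmul a b => exact (map_smul (Ideal.Quotient.mkₐ A n) (g b) a).symm
    rw [hg', Ne, Ideal.Quotient.eq_zero_iff_mem] at hg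
    have h₁ : u * TensorProduct.rid A B (TensorProduct.map .id g Δ) ∈ I := fun z => by
      rw [mul_assoc, map_mul (algebraMap B LB), ← mul_assoc]
      refine trace_mul_contraction_mem Δ hΔ g _ ?_ z
      rwa [mul_assoc, ← map_mul]
    exact (hn.isPrime.mem_or_mem (hIn h₁)).elim hu hg
  have h₁ : (1 : B) ∈ I := hI ▸ Submodule.mem_top
  simpa using h₁ 1

end

/-! ### Coordinates on `ℋom(det T_X, f^* det T_Y)` -/

/-- An alternating map is determined by its value on a basis. -/
lemma AlternatingMap.eq_det_smul {R M N ι : Type*} [CommRing R] [AddCommGroup M] [Module R M]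
    [AddCommGroup N] [Module R N] [Fintype ι] [DecidableEq ι] (b : Module.Basis ι R M)
    (f : M [⋀^ι]→ₗ[R] N) (v : ι → M) : f v = b.det v • f b := by
  have : f = (LinearMap.toSpanSingleton R N (f b)).compAlternatingMap b.det := by
    refine b.ext_alternating fun v hv => ?_
    obtain ⟨σ, rfl⟩ : ∃ σ : Equiv.Perm ι, v = σ :=
      ⟨Equiv.ofBijective v (Finite.injective_iff_bijective.1 hv), rfl⟩
    have h₁ := f.map_perm b σ
    have h₂ := b.det.map_perm b σ
    rw [b.det_self] at h₂
    change f (b ∘ σ) = b.det (b ∘ σ) • f b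
    rw [h₁, h₂, smul_assoc, one_smul]
  conv_lhs => rw [this]
  rfl

/-- The exterior product of linear combinations. -/
lemma exteriorPower.ιMulti_sum_smul {R M : Type*} [CommRing R] [AddCommGroup M] [Module R M]
    {n : ℕ} (v : Fin n → M) (m : Matrix (Fin n) (Fin n) R) :
    exteriorPower.ιMulti R n (fun i => ∑ j, m i j • v j) = m.det • exteriorPower.ιMulti R n v := by
  have h₁ := AlternatingMap.eq_det_smul (Pi.basisFun R (Fin n))
    ((exteriorPower.ιMulti R n (M := M)).compLinearMap (Fintype.linearCombination R v)) m
  rw [Pi.basisFun_det] at h₁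
  have h₂ : ((exteriorPower.ιMulti R n (M := M)).compLinearMap (Fintype.linearCombination R v))
      (Pi.basisFun R (Fin n)) = exteriorPower.ιMulti R n v := by
    simp [Fintype.linearCombination_apply, Pi.single_apply, ite_smul]
  rw [h₂] at h₁
  exact h₁

namespace DetHom

section

variable {n : ℕ} {K A : Type u} [CommRing K] [CommRing A] [Algebra K A]
  (C : Type u) [CommRing C] [Algebra K C] [Algebra A C]

/-- The values of derivations at the functions `a i`. -/
def evalAt (a : Fin n → A) : Derivation K A C →ₗ[C] (Fin n → C) where
  toFun D i := D (a i)
  map_add' _ _ := rfl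
  map_smul' _ _ := rfl

@[simp] lemma evalAt_apply (a : Fin n → A) (D : Derivation K A C) (i : Fin n) :
    evalAt C a D i = D (a i) := rfl

/-- The linear map `D₁ ∧ ⋯ ∧ Dₙ ↦ det (Dᵢ aⱼ)`, which is the pairing with the
differential form `da₁ ∧ ⋯ ∧ daₙ`. -/
noncomputable def evDet (a : Fin n → A) : ⋀[C]^n (Derivation K A C) →ₗ[C] C :=
  exteriorPower.alternatingMapLinearEquiv (Matrix.detRowAlternating.compLinearMap (evalAt C a))

lemma evDet_ιMulti (a : Fin n → A) (D : Fin n → Derivation K A C) :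
    evDet C a (exteriorPower.ιMulti C n D) = (Matrix.of fun i j => D i (a j)).det := by
  rw [evDet, exteriorPower.alternatingMapLinearEquiv_apply_ιMulti]
  rfl

variable {C}

/-- Near a point, an element of `f^* det T_Y` is determined by its pairing with a local
generator of `ω_Y`. -/
lemma evDet_injective [IsScalarTower K A C] {a : Fin n → A} {D : Fin n → Derivation K A A} {h : A}
    (H : IsFrame K a D h) (hh : IsUnit (algebraMap A C h)) :
    Function.Injective (evDet (K := K) C a) := by
  have hinj : Function.Injective (evalAt (K := K) C a) := by
    rw [injective_iff_map_eq_zero]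
    intro d hd
    ext b
    have h₁ := H.smul_derivation_eq_zero d (fun i => congrFun hd i) b
    rw [Algebra.smul_def] at h₁
    exact (hh.mul_right_eq_zero).1 h₁
  obtain ⟨c, hc⟩ := hh.exists_right_inv
  let d (i : Fin n) : Derivation K A C := c • DetHom.push K A A C (D i)
  have hd (i j) : d i (a j) = if j = i then 1 else 0 := by
    change c * algebraMap A C (D i (a j)) = _
    rw [H.apply_eq, mul_comm]
    by_cases hij : i = j
    · simp [hij, hc]
    · simp [Ne.symm hij]
  let e : Derivation K A C ≃ₗ[C] (Fin n → C) := LinearEquiv.ofBijective (evalAt C a)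
    ⟨hinj, fun x => ⟨∑ i, x i • d i, by
      ext j
      have : evalAt C a (∑ i, x i • d i) j = ∑ i, x i * d i (a j) := by
        rw [map_sum, Finset.sum_apply]
        rfl
      simp [this, hd]⟩⟩
  let b := Module.Basis.ofEquivFun e
  have h₁ (x) : x = evDet C a x • exteriorPower.ιMulti C n b := by
    have : LinearMap.id = (LinearMap.toSpanSingleton C _ (exteriorPower.ιMulti C n b)) ∘ₗ
        evDet (K := K) C a := by
      ext v
      have h₂ := AlternatingMap.eq_det_smul b (exteriorPower.ιMulti C n) v
      have h₃ : b.det v = (Matrix.of fun i j => v i (a j)).det := by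
        rw [Module.Basis.det_apply, ← Matrix.det_transpose]
        congr 1
      rw [h₃, ← evDet_ιMulti] at h₂
      simpa using congrArg Subtype.val h₂
    exact congr($this x)
  intro x y hxy
  rw [h₁ x, h₁ y, hxy]

end

section

variable {n : ℕ} {K A B : Type u} [CommRing K] [CommRing A] [CommRing B] [Algebra K A]
  [Algebra K B] [Algebra A B]

/-- The coordinate of a section of `ℋom(det T_X, f^* det T_Y)` with respect to the fields `D i` and
the functions `a i`. -/
noncomputable def coord (a : Fin n → A) (D : Fin n → Derivation K B B) :
    DetHom n K A B →ₗ[B] B :=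
  evDet B a ∘ₗ LinearMap.applyₗ (exteriorPower.ιMulti B n D)

lemma coord_apply (a : Fin n → A) (D : Fin n → Derivation K B B) (φ : DetHom n K A B) :
    coord a D φ = evDet B a (φ (exteriorPower.ιMulti B n D)) := rfl

lemma coord_jacobian [IsScalarTower K A B] (a : Fin n → A) (D : Fin n → Derivation K B B) :
    coord a D (jacobian n K A B) = (Matrix.of fun i j => D i (algebraMap A B (a j))).det := by
  rw [coord_apply, jacobian, exteriorPower.map_apply_ιMulti, evDet_ιMulti]
  rfl

/-- Near a point, `det T_X` is generated by `D₁ ∧ ⋯ ∧ Dₙ`. -/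
lemma _root_.IsFrame.pow_smul_ιMulti [IsDomain B] {w : Fin n → B} {D : Fin n → Derivation K B B}
    {h : B} (HB : IsFrame K w D h) (hh : h ≠ 0) (D' : Fin n → Derivation K B B) :
    h ^ n • exteriorPower.ιMulti B n D' =
      (Matrix.of fun i j => D' i (w j)).det • exteriorPower.ιMulti B n D := by
  have h₁ (i) : h • D' i = ∑ j, D' i (w j) • D j := by
    rw [← sub_eq_zero]
    ext b
    have h₂ := HB.smul_derivation_eq_zero (h • D' i - ∑ j, D' i (w j) • D j) (fun k => ?_) b
    · exact (smul_eq_zero.1 h₂).resolve_left hh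
    · rw [← evalAt_apply, map_sub, map_sum]
      simp [HB.apply_eq, mul_comm]
  rw [← exteriorPower.ιMulti_sum_smul]
  have h₂ := (exteriorPower.ιMulti B n).map_smul_univ (fun _ => h) D'
  simp only [Finset.prod_const, Finset.card_univ, Fintype.card_fin] at h₂
  rw [← h₂]
  congr 1
  ext1 i
  exact h₁ i

lemma evDet_extMap {C : Type u} [CommRing C] [Algebra K C] [Algebra A C] [Algebra B C]
    [IsScalarTower A B C] [IsScalarTower K B C] (a : Fin n → A) (x : ⋀[B]^n (Derivation K A B)) :
    evDet C a (extMap C n (push K A B C) x) = algebraMap B C (evDet B a x) := by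
  have : ((evDet C a).restrictScalars B) ∘ₗ (extMap C n (push K A B C)) =
      Algebra.linearMap B C ∘ₗ evDet B a := by
    ext v
    have h₁ := evDet_ιMulti C a fun i => push K A B C (v i)
    rw [← extMap_ιMulti] at h₁
    have h₂ := congrArg (algebraMap B C) (evDet_ιMulti B a v)
    rw [RingHom.map_det] at h₂
    exact h₁.trans h₂.symm
  exact congr($this x)

lemma evDet_map_pull [IsScalarTower K A B] {C : Type u} [CommRing C] [Algebra K C] [Algebra A C]
    [Algebra B C] [IsScalarTower A B C] (a : Fin n → A) (x : ⋀[C]^n (Derivation K B C)) :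
    evDet C a (exteriorPower.map n (pull K A B C) x) =
      evDet C (fun i => algebraMap A B (a i)) x := by
  have : evDet C a ∘ₗ exteriorPower.map n (pull K A B C) =
      evDet C (fun i => algebraMap A B (a i)) := by
    ext v
    have h₁ := evDet_ιMulti C a fun i => pull K A B C (v i)
    refine Eq.trans ?_ (h₁.trans (evDet_ιMulti C _ v).symm)
    exact congrArg (evDet C a) (exteriorPower.map_apply_ιMulti _ _)
  exact congr($this x)

/-- The coordinates of the restriction of a section are the restrictions of its coordinates. -/
lemma IsRestriction.coord_eq [IsScalarTower K A B] {A' B' : Type u} [CommRing A'] [CommRing B']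
    [Algebra K A'] [Algebra K B'] [Algebra A' B'] [IsScalarTower K A' B'] {eA : A →ₐ[K] A'}
    {eB : B →ₐ[K] B'} {h : ∀ a, eB (algebraMap A B a) = algebraMap A' B' (eA a)}
    {φ : DetHom n K A B} {φ' : DetHom n K A' B'} (H : IsRestriction eA eB h φ φ')
    (a : Fin n → A) {D : Fin n → Derivation K B B} {D' : Fin n → Derivation K B' B'}
    (hD : ∀ i b, D' i (eB b) = eB (D i b)) :
    coord (fun i => eA (a i)) D' φ' = eB (coord a D φ) := by
  let : Algebra A A' := eA.toRingHom.toAlgebra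
  let : Algebra B B' := eB.toRingHom.toAlgebra
  let : Algebra A B' := (eB.toRingHom.comp (algebraMap A B)).toAlgebra
  have : IsScalarTower A B B' := .of_algebraMap_eq' rfl
  have : IsScalarTower A A' B' := .of_algebraMap_eq h
  have : IsScalarTower K A A' := .of_algebraMap_eq fun x => (eA.commutes x).symm
  have : IsScalarTower K B B' := .of_algebraMap_eq fun x => (eB.commutes x).symm
  have h₁ := H (exteriorPower.ιMulti B n D) (exteriorPower.ιMulti B' n D') (by
    rw [extMap_ιMulti, exteriorPower.map_apply_ιMulti]
    congr 1
    ext i b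
    exact (hD i b).symm)
  have h₂ := congrArg (evDet B' a) h₁
  rw [evDet_map_pull, baseChange, LinearMap.comp_apply, evDet_extMap] at h₂
  exact h₂.symm

section

variable [IsScalarTower K A B] {C : Type u} [Field C] {a : Fin n → A}
  {δ : Fin n → Derivation K A A} {hA : A} {w : Fin n → B} {D : Fin n → Derivation K B B} {h : B}

/-- Proportionality after extension of scalars to a field is a statement about coordinates. -/
lemma eqSMulAlong_iff [IsDomain B] (HA : IsFrame K a δ hA) (HB : IsFrame K w D h) (e : B →+* C)
    (heA : e (algebraMap A B hA) ≠ 0) (heB : e h ≠ 0) (c : C) (φ₁ φ₂ : DetHom n K A B) :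
    EqSMulAlong e c φ₁ φ₂ ↔ e (coord a D φ₁) = c * e (coord a D φ₂) := by
  let : Algebra B C := e.toAlgebra
  let : Algebra A C := (e.comp (algebraMap A B)).toAlgebra
  let : Algebra K C := (e.comp (algebraMap K B)).toAlgebra
  have : IsScalarTower A B C := .of_algebraMap_eq' rfl
  have : IsScalarTower K B C := .of_algebraMap_eq' rfl
  have : IsScalarTower K A C := .of_algebraMap_eq fun x => by
    rw [IsScalarTower.algebraMap_apply K B C, IsScalarTower.algebraMap_apply K A B,
      IsScalarTower.algebraMap_apply A B C]
  have h₁ (φ : DetHom n K A B) (x) : evDet C a (φ.baseChange C x) = e (evDet B a (φ x)) :=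
    evDet_extMap a (φ x)
  change φ₁.baseChange C = c • φ₂.baseChange C ↔ _
  refine ⟨fun H => ?_, fun H => ?_⟩
  · have h₂ := congrArg (evDet C a) (congr($H (exteriorPower.ιMulti B n D)))
    rwa [LinearMap.smul_apply, map_smul, h₁, h₁] at h₂
  · have hh : h ≠ 0 := fun h0 => heB (by rw [h0, map_zero])
    apply exteriorPower.linearMap_ext
    ext1 D'
    refine evDet_injective HA (heA.isUnit) ?_
    change evDet C a (φ₁.baseChange C (exteriorPower.ιMulti B n D')) =
      evDet C a (c • φ₂.baseChange C (exteriorPower.ιMulti B n D'))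
    rw [map_smul, h₁, h₁]
    have h₃ (φ : DetHom n K A B) : e h ^ n * e (evDet B a (φ (exteriorPower.ιMulti B n D'))) =
        e (Matrix.of fun i j => D' i (w j)).det * e (coord a D φ) := by
      have := congrArg (fun x => e (evDet B a (φ x))) (HB.pow_smul_ιMulti hh D')
      simpa [coord_apply] using this
    refine mul_left_cancel₀ (pow_ne_zero n heB) ?_
    rw [smul_eq_mul, mul_left_comm, h₃, h₃, H]
    ring

/-- A section whose coordinate vanishes is zero. -/
lemma eq_zero_of_coord_eq_zero [IsDomain B] (HA : IsFrame K a δ hA) (HB : IsFrame K w D h)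
    (hhA : IsUnit hA) (hh : h ≠ 0) {φ : DetHom n K A B} (hφ : coord a D φ = 0) : φ = 0 := by
  apply exteriorPower.linearMap_ext
  ext1 D'
  refine evDet_injective HA (hhA.map (algebraMap A B)) ?_
  change evDet B a (φ (exteriorPower.ιMulti B n D')) = evDet B a 0
  rw [map_zero]
  have := congrArg (fun x => evDet B a (φ x)) (HB.pow_smul_ιMulti hh D')
  simp only [map_smul, smul_eq_mul] at this
  rw [← coord_apply a D, hφ, mul_zero] at this
  exact (mul_eq_zero.1 this).resolve_left (pow_ne_zero n hh)

/-- Near a point, `ℋom(det T_X, f^* det T_Y)` has a section without zeros. -/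
lemma exists_coord_eq (HA : IsFrame K a δ hA) (HB : IsFrame K w D h) :
    ∃ φ : DetHom n K A B, coord a D φ = algebraMap A B hA ^ n * h ^ n := by
  refine ⟨(evDet B w).smulRight (exteriorPower.ιMulti B n fun i => push K A A B (δ i)), ?_⟩
  rw [coord_apply, LinearMap.smulRight_apply, map_smul, evDet_ιMulti, evDet_ιMulti, smul_eq_mul,
    mul_comm]
  congr 1
  · have : (Matrix.of fun i j => push K A A B (δ i) (a j)) =
        Matrix.diagonal fun _ : Fin n => algebraMap A B hA := by
      ext i j
      change algebraMap A B (δ i (a j)) = _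
      rw [HA.apply_eq, Matrix.diagonal_apply, apply_ite (algebraMap A B), map_zero]
      simp only [eq_comm]
    rw [this, Matrix.det_diagonal]
    simp
  · have : (Matrix.of fun i j => D i (w j)) = Matrix.diagonal fun _ : Fin n => h := by
      ext i j
      rw [Matrix.of_apply, HB.apply_eq, Matrix.diagonal_apply]
      simp only [eq_comm]
    rw [this, Matrix.det_diagonal]
    simp

end

end

/-- The Jacobian does not vanish at a point where `f` is unramified. -/
lemma coord_jacobian_ne_zero {n : ℕ} {K A B C : Type u} [CommRing K] [CommRing A] [CommRing B]
    [Field C] [Algebra K A] [Algebra K B] [Algebra A B] [IsScalarTower K A B] [Algebra A C]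
    [Algebra B C] [IsScalarTower A B C] {a : Fin n → A}
    {δ : Fin n → Derivation K A A} {hA : A} {w : Fin n → B} {D : Fin n → Derivation K B B} {h : B}
    (HA : IsFrame K a δ hA) (HB : IsFrame K w D h)
    (heA : algebraMap A C hA ≠ 0) (heB : algebraMap B C h ≠ 0)
    (hder : ∀ d : Derivation A B C, d = 0) :
    algebraMap B C (coord a D (jacobian n K A B)) ≠ 0 := by
  let : Algebra K C := ((algebraMap B C).comp (algebraMap K B)).toAlgebra
  have : IsScalarTower K B C := .of_algebraMap_eq' rfl
  have : IsScalarTower K A C := .of_algebraMap_eq fun x => by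
    rw [IsScalarTower.algebraMap_apply K B C, IsScalarTower.algebraMap_apply K A B,
      IsScalarTower.algebraMap_apply A B C]
  intro h0
  rw [coord_jacobian, RingHom.map_det] at h0
  obtain ⟨v, hv, hv0⟩ := Matrix.exists_vecMul_eq_zero_iff.2 h0
  apply hv
  let d : Derivation K B C := ∑ i, v i • push K B B C (D i)
  have hd {ι : Type} (u : ι → B) (k) : d (u k) = ∑ i, v i * algebraMap B C (D i (u k)) := by
    have := congrFun (map_sum (evalAt (n := 1) (K := K) C (fun _ => u k))
      (fun i => v i • push K B B C (D i)) Finset.univ) 0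
    rw [Finset.sum_apply] at this
    exact this
  have hda (b : A) : d (algebraMap A B b) = 0 := by
    have h₁ := HA.smul_derivation_eq_zero (d.compAlgebraMap A) (fun j => ?_) b
    · rw [Algebra.smul_def] at h₁
      exact (mul_eq_zero.1 h₁).resolve_left heA
    · change d (algebraMap A B (a j)) = 0
      rw [hd (fun j => algebraMap A B (a j))]
      exact congrFun hv0 j
  have hd0 : ∀ b, d b = 0 := by
    let d' : Derivation A B C :=
      { toFun := d
        map_add' := map_add d
        map_smul' := fun r b => by
          rw [Algebra.smul_def, Derivation.leibniz, hda, smul_zero, add_zero,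
            IsScalarTower.algebraMap_smul]
          rfl
        map_one_eq_zero' := d.map_one_eq_zero
        leibniz' := d.leibniz }
    exact fun b => congr($(hder d') b)
  ext k
  have h₁ := hd w k
  rw [hd0, Finset.sum_eq_single k] at h₁
  · rw [HB.apply_eq, if_pos rfl] at h₁
    exact (mul_eq_zero.1 h₁.symm).resolve_right heB
  · intro i _ hi
    rw [HB.apply_eq, if_neg hi.symm, map_zero, mul_zero]
  · simp

end DetHom

/-! ### Bilinear pairings on modules of rank one -/

section

variable {A B M : Type*} [CommRing A] [CommRing B] [Algebra A B] [AddCommGroup M] [Module A M]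
  [Module B M] [IsScalarTower A B M]

/-- A module over an integral extension `B` of `A` which is free over `A` is torsion free. -/
lemma isTorsionFree_of_basis [IsDomain A] [IsDomain B] [FaithfulSMul A B] [Algebra.IsIntegral A B]
    {ι : Type*} (e : Module.Basis ι A M) : Module.IsTorsionFree B M := by
  have : Module.Free A M := .of_basis e
  refine .of_smul_eq_zero fun b m hbm => ?_
  by_contra! h
  obtain ⟨a, ha, c, hc⟩ := (Algebra.IsAlgebraic.isAlgebraic (R := A) b).exists_nonzero_dvd
    (mem_nonZeroDivisors_of_ne_zero h.1)
  have h₁ : a • m = 0 := by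
    rw [← algebraMap_smul B a m, hc, mul_comm, mul_smul, hbm, smul_zero]
  exact (smul_eq_zero.1 h₁).elim ha h.2

/-- In a torsion free module, products of non-zero elements do not vanish. -/
lemma tmul_eq_zero_of_isTorsionFree [IsDomain B] [Module.IsTorsionFree B M] {w t : M}
    (h : w ⊗ₜ[B] t = 0) : w = 0 ∨ t = 0 := by
  by_contra! hwt
  let F := FractionRing B
  have h₁ (m : M) (hm : m ≠ 0) : (1 : F) ⊗ₜ[B] m ≠ 0 := by
    intro h0
    obtain ⟨c, hc⟩ := (IsLocalizedModule.eq_zero_iff (nonZeroDivisors B)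
      (TensorProduct.mk B F M 1)).1 h0
    exact (smul_eq_zero.1 hc).elim (nonZeroDivisors.ne_zero c.2) hm
  have h₂ (m : M) (hm : m ≠ 0) : ∃ f : M →ₗ[B] F, f m ≠ 0 := by
    by_contra! hf
    exact h₁ m hm ((Module.forall_dual_apply_eq_zero_iff F _).1 fun f =>
      hf (f.restrictScalars B ∘ₗ TensorProduct.mk B F M 1))
  obtain ⟨f, hf⟩ := h₂ w hwt.1
  obtain ⟨g, hg⟩ := h₂ t hwt.2
  have h₃ := congrArg (LinearMap.mul' B F ∘ₗ TensorProduct.map f g) h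
  have h₄ : f w * g t = 0 := by simpa using h₃
  exact (mul_eq_zero.1 h₄).elim hf hg

section

variable {c : M →ₗ[B] M →ₗ[B] B} (hc : ∀ s t, c s t = 0 → s = 0 ∨ t = 0)
include hc

lemma smul_eq_smul_left (s t m : M) : c s t • m = c m t • s := by
  rcases hc (c s t • m - c m t • s) t (by simp [mul_comm]) with h | rfl
  · exact sub_eq_zero.1 h
  · simp

lemma smul_eq_smul_right (s t m : M) : c t s • m = c t m • s := by
  rcases hc t (c t s • m - c t m • s) (by simp [mul_comm]) with rfl | h
  · simp
  · exact sub_eq_zero.1 h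

/-- A pairing without zero divisors is symmetric. -/
lemma pairing_comm [IsDomain B] [Module.IsTorsionFree B M] (s t : M) : c s t = c t s := by
  by_cases ht : t = 0
  · simp [ht]
  · refine sub_eq_zero.1 ((smul_eq_zero.1 ?_).resolve_right ht)
    rw [sub_smul, smul_eq_smul_left hc s t t, smul_eq_smul_right hc s t t, sub_self]

lemma pairing_mul_pairing (s s' t : M) : c t t * c s s' = c s t * c s' t := by
  have := congrArg (c s) (smul_eq_smul_left hc t t s')
  simpa [mul_comm] using this

end

/-- If `M` generates `B`, then `B` is a direct summand of a power of `M`. -/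
lemma projective_of_forall_maximal [Module.Projective A M]
    (H : ∀ n : Ideal B, n.IsMaximal → ∃ (f : M →ₗ[B] B) (m : M), f m ∉ n) :
    Module.Projective A B := by
  have h₁ : Ideal.span (Set.range fun x : (M →ₗ[B] B) × M => x.1 x.2) = ⊤ := by
    by_contra h
    obtain ⟨n, hn, hle⟩ := Ideal.exists_le_maximal _ h
    obtain ⟨f, m, hf⟩ := H n hn
    exact hf (hle (Ideal.subset_span ⟨(f, m), rfl⟩))
  obtain ⟨c, hc⟩ := (Finsupp.mem_ideal_span_range_iff_exists_finsupp).1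
    ((Ideal.eq_top_iff_one _).1 h₁)
  let i : B →ₗ[B] (c.support → M) := LinearMap.pi fun x => LinearMap.toSpanSingleton B M x.1.2
  let p : (c.support → M) →ₗ[B] B := ∑ x, c x.1 • x.1.1 ∘ₗ LinearMap.proj x
  have : Module.Projective A (c.support → M) :=
    .of_equiv (DFinsupp.linearEquivFunOnFintype (R := A) (M := fun _ : c.support => M))
  refine Module.Projective.of_split (i.restrictScalars A) (p.restrictScalars A) ?_
  ext b
  have h₂ : p (i 1) = 1 := by
    rw [Finsupp.sum, ← Finset.sum_coe_sort] at hc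
    simpa [p, i] using hc
  have h₃ : p (i b) = b • p (i 1) := by rw [← map_smul, ← map_smul, smul_eq_mul, mul_one]
  rw [h₂, smul_eq_mul, mul_one] at h₃
  exact h₃

end

/-! ### The trace of a section of the relative orientation -/

/-- There are no derivations from `B` to a `B'`-module if `B'` is a localization of `B` which is
formally unramified over `A`. -/
lemma Derivation.eq_zero_of_formallyUnramified {A B N : Type u} (B' : Type u) [CommRing A]
    [CommRing B] [CommRing B'] [Algebra A B] [Algebra A B'] [Algebra B B'] [IsScalarTower A B B']
    [AddCommGroup N] [Module A N] [Module B N] [Module B' N] [IsScalarTower A B' N]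
    [IsScalarTower B B' N] [IsScalarTower A B N]
    (S : Submonoid B) [IsLocalization S B'] [Algebra.FormallyUnramified A B']
    (d : Derivation A B N) : d = 0 := by
  have := Algebra.FormallyEtale.of_isLocalization (Rₘ := B') S
  obtain ⟨D, hD⟩ := Derivation.exists_extension_of_formallyEtale (B' := B') d
  ext b
  rw [← hD, ← D.liftKaehlerDifferential_comp_D, Subsingleton.elim (KaehlerDifferential.D A B' _) 0,
    map_zero]
  rfl

/-- A smooth algebra has frames near each of its primes. -/
lemma exists_isFrame_algebraMap_ne_zero {K B C : Type u} [Field K] [CommRing B] [IsDomain B]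
    [Algebra K B] [Algebra.Smooth K B] {n : ℕ} (hn : Module.finrank B Ω[B⁄K] = n) [Field C]
    (e : B →+* C) :
    ∃ (w : Fin n → B) (D : Fin n → Derivation K B B) (h : B), e h ≠ 0 ∧ IsFrame K w D h := by
  have := RingHom.ker_isPrime e
  obtain ⟨w, D, h, hh, H⟩ := exists_isFrame (K := K) hn (RingHom.ker e)
  exact ⟨w, D, h, hh, H⟩

/-- The relation `φ = w · det (Tf)` in coordinates. -/
lemma coord_eq_mul_coord_jacobian {n : ℕ} {K A B : Type u} [Field K] [CommRing A] [CommRing B]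
    [Algebra K A] [Algebra K B] [Algebra A B] [IsScalarTower K A B] [IsDomain B]
    {a : Fin n → A} {δ : Fin n → Derivation K A A} {hA : A} (HA : IsFrame K a δ hA)
    (hhA : IsUnit hA) {C : Type u} [Field C] (e : B →+* C) {φ : DetHom n K A B} {w : C}
    (hw : DetHom.EqSMulAlong e w φ (DetHom.jacobian n K A B)) {u : Fin n → B}
    {D : Fin n → Derivation K B B} {h : B} (HB : IsFrame K u D h) (hh : e h ≠ 0) :
    e (DetHom.coord a D φ) = w * e (DetHom.coord a D (DetHom.jacobian n K A B)) :=
  (DetHom.eqSMulAlong_iff HA HB e ((hhA.map (algebraMap A B)).map e).ne_zero hh w φ _).1 hw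

/-- The Jacobian of a separable morphism is not zero at the generic point. -/
lemma coord_jacobian_ne_zero_of_isSeparable {n : ℕ} {K A B LB : Type u} (LA : Type u) [Field K]
    [CommRing A] [CommRing B] [Algebra K A] [Algebra K B] [Algebra A B] [IsScalarTower K A B]
    [Field LA] [Field LB] [Algebra A LA] [IsFractionRing A LA] [Algebra B LB]
    [IsFractionRing B LB] [Algebra A LB] [IsScalarTower A B LB] [Algebra LA LB]
    [IsScalarTower A LA LB] [Algebra.IsSeparable LA LB]
    {a : Fin n → A} {δ : Fin n → Derivation K A A} {hA : A}
    (HA : IsFrame K a δ hA) (hhA : IsUnit hA) {u : Fin n → B} {D : Fin n → Derivation K B B}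
    {h : B} (HB : IsFrame K u D h) (hh : algebraMap B LB h ≠ 0) :
    algebraMap B LB (DetHom.coord a D (DetHom.jacobian n K A B)) ≠ 0 := by
  have : Algebra.FormallyUnramified LA LB := .of_isSeparable LA LB
  have : Algebra.FormallyUnramified A LA := .of_isLocalization (nonZeroDivisors A)
  have : Algebra.FormallyUnramified A LB := .comp A LA LB
  exact DetHom.coord_jacobian_ne_zero HA HB (hhA.map (algebraMap A LB)).ne_zero hh fun d =>
    d.eq_zero_of_formallyUnramified LB (nonZeroDivisors B)

section

variable {n : ℕ} {K A B LA LB : Type u} [Field K] [CommRing A] [CommRing B] [Algebra K A]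
  [Algebra K B] [Algebra A B] [IsScalarTower K A B] [IsDomain B] [Algebra.Smooth K B]
  [Field LA] [Field LB] [Algebra A LA] [IsFractionRing A LA] [Algebra B LB]
  [IsFractionRing B LB] [Algebra A LB] [IsScalarTower A B LB] [Algebra LA LB] [IsScalarTower A LA LB]
  [Algebra.IsSeparable LA LB]

/-- The rational functions `w` with `φ = w · det (Tf)` have integral traces. -/
lemma trace_mem_range_of_eqSMulAlong [IsDomain A] [FaithfulSMul A B] [Module.Finite A B]
    [FiniteDimensional LA LB] [Algebra.EssFiniteType K A] [Module.Projective A B]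
    (hn : Module.finrank B Ω[B⁄K] = n)
    {a : Fin n → A} {δ : Fin n → Derivation K A A} {hA : A} (HA : IsFrame K a δ hA)
    (hhA : IsUnit hA) (φ : DetHom n K A B) (w : LB)
    (hw : DetHom.EqSMulAlong (algebraMap B LB) w φ (DetHom.jacobian n K A B)) :
    Algebra.trace LA LB w ∈ (algebraMap A LA).range := by
  refine trace_mem_range_of_annihilator_diagonal (A := A) (B := B) w fun m hm => ?_
  let : Field (B ⧸ m) := Ideal.Quotient.field m
  obtain ⟨u, D, h, hh, HB⟩ := exists_isFrame_algebraMap_ne_zero (K := K) hn (algebraMap B (B ⧸ m))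
  have hh' : algebraMap B LB h ≠ 0 := by
    intro h0
    apply hh
    rw [(IsFractionRing.injective B LB) (h0.trans (map_zero _).symm), map_zero]
  have ha (ω : Ω[A⁄K]) :
      ω ∈ Submodule.span A (Set.range fun i => KaehlerDifferential.D K A (a i)) := by
    have h₁ := HA.smul_mem ω
    rwa [Submodule.smul_mem_iff_of_isUnit _ hhA] at h₁
  obtain ⟨Δ, r, s, hΔ, hdet, hΔ'⟩ := exists_annihilator_diagonal (k := B ⧸ m) a ha HB hh
  refine ⟨Δ, h ^ r, fun hmem => ?_, hΔ, ?_, hΔ'⟩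
  · exact hh (Ideal.Quotient.eq_zero_iff_mem.2 (hm.isPrime.mem_of_pow_mem _ hmem))
  · have h₁ := coord_eq_mul_coord_jacobian HA hhA (algebraMap B LB) hw HB hh'
    rw [DetHom.coord_jacobian, ← Matrix.det_transpose] at h₁
    refine ⟨h ^ s * DetHom.coord a D φ, ?_⟩
    rw [hdet, map_mul, h₁, map_mul, mul_left_comm]
    rfl

variable (LA)

include LA in
lemma exists_eqSMulAlong_jacobian (hn : Module.finrank B Ω[B⁄K] = n)
    {a : Fin n → A} {δ : Fin n → Derivation K A A} {hA : A} (HA : IsFrame K a δ hA)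
    (hhA : IsUnit hA) (φ : DetHom n K A B) :
    ∃ w : LB, DetHom.EqSMulAlong (algebraMap B LB) w φ (DetHom.jacobian n K A B) := by
  obtain ⟨u, D, h, hh, HB⟩ := exists_isFrame_algebraMap_ne_zero (K := K) hn (algebraMap B LB)
  refine ⟨algebraMap B LB (DetHom.coord a D φ) /
    algebraMap B LB (DetHom.coord a D (DetHom.jacobian n K A B)), ?_⟩
  rw [DetHom.eqSMulAlong_iff HA HB (algebraMap B LB)
    ((hhA.map (algebraMap A B)).map (algebraMap B LB)).ne_zero hh,
    div_mul_cancel₀ _ (coord_jacobian_ne_zero_of_isSeparable LA HA hhA HB hh)]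

include LA in
lemma eq_of_eqSMulAlong_jacobian (hn : Module.finrank B Ω[B⁄K] = n)
    {a : Fin n → A} {δ : Fin n → Derivation K A A} {hA : A} (HA : IsFrame K a δ hA)
    (hhA : IsUnit hA) (φ : DetHom n K A B) {w w' : LB}
    (hw : DetHom.EqSMulAlong (algebraMap B LB) w φ (DetHom.jacobian n K A B))
    (hw' : DetHom.EqSMulAlong (algebraMap B LB) w' φ (DetHom.jacobian n K A B)) : w = w' := by
  obtain ⟨u, D, h, hh, HB⟩ := exists_isFrame_algebraMap_ne_zero (K := K) hn (algebraMap B LB)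
  refine mul_right_cancel₀ (coord_jacobian_ne_zero_of_isSeparable LA HA hhA HB hh) ?_
  rw [← coord_eq_mul_coord_jacobian HA hhA _ hw HB hh,
    ← coord_eq_mul_coord_jacobian HA hhA _ hw' HB hh]

end

/-! ### The pairing defined by a relative orientation -/

section

variable {n : ℕ} {K A B M : Type u} [Field K] [CommRing A] [CommRing B] [Algebra K A]
  [Algebra K B] [Algebra A B] [AddCommGroup M] [Module B M]

/-- The pairing on `M` given by the coordinates of `ψ (s ⊗ t)`. -/
noncomputable def coordPairing (ψ : M ⊗[B] M ≃ₗ[B] DetHom n K A B) (a : Fin n → A)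
    (D : Fin n → Derivation K B B) : M →ₗ[B] M →ₗ[B] B :=
  (TensorProduct.mk B M M).compr₂ (DetHom.coord a D ∘ₗ ψ.toLinearMap)

lemma coordPairing_apply (ψ : M ⊗[B] M ≃ₗ[B] DetHom n K A B) (a : Fin n → A)
    (D : Fin n → Derivation K B B) (s t : M) :
    coordPairing ψ a D s t = DetHom.coord a D (ψ (s ⊗ₜ t)) := rfl

variable [IsScalarTower K A B] (ψ : M ⊗[B] M ≃ₗ[B] DetHom n K A B) {a : Fin n → A}
  {δ : Fin n → Derivation K A A} {hA : A} (HA : IsFrame K a δ hA) (hhA : IsUnit hA)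
  {u : Fin n → B} {D : Fin n → Derivation K B B} {h : B} (HB : IsFrame K u D h)

include HA hhA HB

lemma coordPairing_eq_zero [IsDomain B] [Module.IsTorsionFree B M] (hh : h ≠ 0) (s t : M)
    (hst : coordPairing ψ a D s t = 0) : s = 0 ∨ t = 0 := by
  refine tmul_eq_zero_of_isTorsionFree (B := B) (ψ.injective ?_)
  rw [map_zero]
  exact DetHom.eq_zero_of_coord_eq_zero HA HB hhA hh hst

lemma exists_coordPairing_notMem (m : Ideal B) [m.IsPrime] (hm : h ∉ m) :
    ∃ s t : M, coordPairing ψ a D s t ∉ m := by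
  by_contra! H
  obtain ⟨φ, hφ⟩ := DetHom.exists_coord_eq HA HB
  have h₁ (z : M ⊗[B] M) : DetHom.coord a D (ψ z) ∈ m := by
    induction z with
    | zero => simp
    | add x y hx hy => rw [map_add, map_add]; exact add_mem hx hy
    | tmul s t => exact H s t
  have h₂ := h₁ (ψ.symm φ)
  rw [ψ.apply_symm_apply, hφ] at h₂
  refine (m.primeCompl.mul_mem ?_ (m.primeCompl.pow_mem hm n)) h₂
  refine m.primeCompl.pow_mem (fun h0 => ?_) n
  exact (inferInstance : m.IsPrime).ne_top (m.eq_top_of_isUnit_mem h0 (hhA.map _))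

end

/-- If there is a relative orientation on a module which is projective over `A`, then `B` is
projective over `A`. -/
lemma projective_of_relativeOrientation {n : ℕ} {K A B M : Type u} [Field K] [CommRing A]
    [CommRing B] [Algebra K A] [Algebra K B] [Algebra A B] [IsScalarTower K A B] [IsDomain B]
    [Algebra.Smooth K B] (hn : Module.finrank B Ω[B⁄K] = n) {a : Fin n → A}
    {δ : Fin n → Derivation K A A} {hA : A} (HA : IsFrame K a δ hA) (hhA : IsUnit hA)
    [AddCommGroup M] [Module A M] [Module B M] [IsScalarTower A B M] [Module.Projective A M]
    (ψ : M ⊗[B] M ≃ₗ[B] DetHom n K A B) : Module.Projective A B := by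
  refine projective_of_forall_maximal (M := M) fun m hm => ?_
  obtain ⟨u, D, h, hh, HB⟩ := exists_isFrame (K := K) hn m
  obtain ⟨s, t, hst⟩ := exists_coordPairing_notMem ψ HA hhA HB m hh
  exact ⟨coordPairing ψ a D s, t, hst⟩

/-! ### Traces and bases -/

/-- The trace of multiplication by `s` can be computed on a lattice `M` with basis `e`. -/
lemma trace_eq_algebraMap_trace {A R S M ι : Type*} [CommRing A] [CommRing R] [CommRing S]
    [Algebra A R] [Algebra R S] [Module A S] [IsScalarTower A R S] [AddCommGroup M] [Module A M]
    [Finite ι] (e : Module.Basis ι A M) (f : Module.Basis ι R S) (θ : M →ₗ[A] S)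
    (hf : ∀ i, f i = θ (e i)) (T : M →ₗ[A] M) (s : S) (hT : ∀ m, θ (T m) = s * θ m) :
    Algebra.trace R S s = algebraMap A R (LinearMap.trace A M T) := by
  classical
  cases nonempty_fintype ι
  rw [Algebra.trace_eq_matrix_trace f, LinearMap.trace_eq_matrix_trace A e, Matrix.trace,
    Matrix.trace, map_sum]
  refine Finset.sum_congr rfl fun i _ => ?_
  have h₁ : s * f i = ∑ j, algebraMap A R (e.repr (T (e i)) j) • f j := by
    rw [hf, ← hT]
    conv_lhs => rw [← e.sum_repr (T (e i)), map_sum]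
    simp only [map_smul, hf, algebraMap_smul]
  rw [Matrix.diag_apply, Matrix.diag_apply, Algebra.leftMulMatrix_eq_repr_mul,
    LinearMap.toMatrix_apply, h₁, f.repr_sum_self]

/-- The trace of a finite product of algebras. -/
lemma trace_pi_apply {k X : Type*} {κ : X → Type*} [Field k] [Fintype X] [∀ x, CommRing (κ x)]
    [∀ x, Algebra k (κ x)] [∀ x, FiniteDimensional k (κ x)] (s : Π x, κ x) :
    Algebra.trace k (Π x, κ x) s = ∑ x, Algebra.trace k (κ x) (s x) := by
  classical
  let b (x : X) := Module.finBasis k (κ x)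
  rw [Algebra.trace_eq_matrix_trace (Pi.basis b), Matrix.trace, Fintype.sum_sigma]
  refine Finset.sum_congr rfl fun x _ => ?_
  rw [Algebra.trace_eq_matrix_trace (b x), Matrix.trace]
  refine Finset.sum_congr rfl fun i _ => ?_
  rw [Matrix.diag_apply, Matrix.diag_apply, Algebra.leftMulMatrix_eq_repr_mul,
    Algebra.leftMulMatrix_eq_repr_mul, Pi.basis_repr, Pi.basis_apply]
  simp

/-- A lattice of rank one over `B` spans the fraction field of `B`. -/
lemma exists_basis_fractionRing {A B LA LB M ι : Type*} [CommRing A] [CommRing B] [Algebra A B]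
    [IsDomain A] [IsDomain B] [FaithfulSMul A B] [Module.Finite A B] [Field LA] [Field LB]
    [Algebra A LA] [IsFractionRing A LA] [Algebra B LB] [IsFractionRing B LB] [Algebra A LB]
    [IsScalarTower A B LB] [Algebra LA LB] [IsScalarTower A LA LB] [AddCommGroup M] [Module A M]
    [Module B M] [IsScalarTower A B M] (e : Module.Basis ι A M) [Nontrivial M] (θ : M →ₗ[B] LB)
    (hθ : Function.Injective θ) : ∃ f : Module.Basis ι LA LB, ∀ i, f i = θ (e i) := by
  have hli : LinearIndependent LA fun i => θ (e i) := by
    rw [← LinearIndependent.iff_fractionRing (R := A)]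
    exact e.linearIndependent.map' (θ.restrictScalars A) (LinearMap.ker_eq_bot.2 hθ)
  let S := Submodule.span LA (Set.range fun i => θ (e i))
  have hM (m : M) : θ m ∈ S := by
    have h₁ := e.mem_span m
    have h₂ := Submodule.mem_map_of_mem (f := θ.restrictScalars A) h₁
    rw [Submodule.map_span, ← Set.range_comp] at h₂
    exact Submodule.span_le_restrictScalars A LA _ h₂
  obtain ⟨m₀, hm₀⟩ := exists_ne (0 : M)
  have hθ₀ : θ m₀ ≠ 0 := by rwa [Ne, map_eq_zero_iff θ hθ]
  have hB : IsBaseChange LA (IsScalarTower.toAlgHom A B LB).toLinearMap :=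
    Algebra.IsAlgebraic.isBaseChange_of_isFractionRing A B LA LB
  have hS (x : LB) : x * θ m₀ ∈ S := by
    induction x using hB.inductionOn with
    | zero => simp
    | tmul b =>
      have := hM (b • m₀)
      rwa [map_smul, Algebra.smul_def] at this
    | smul c x hx => rw [smul_mul_assoc]; exact S.smul_mem _ hx
    | add x y hx hy => rw [add_mul]; exact add_mem hx hy
  refine ⟨Module.Basis.mk hli fun x _ => ?_, fun i => by simp⟩
  have := hS (x * (θ m₀)⁻¹)
  rwa [inv_mul_cancel_right₀ hθ₀] at this

/-! ### The fibre of a finite morphism -/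

/-- An ideal of `B` which is contained in none of the prime ideals over `p` contains an element
of `A` outside `p`. -/
lemma exists_algebraMap_mem_of_forall_not_le {A B X : Type*} [CommRing A] [CommRing B] [Algebra A B]
    [Algebra.IsIntegral A B] (p : Ideal A) [p.IsPrime] (n : X → Ideal B)
    (hn : ∀ q : Ideal B, q.IsPrime → q.comap (algebraMap A B) = p → ∃ x, q = n x)
    (I : Ideal B) (hI : ∀ x, ¬ I ≤ n x) : ∃ α, α ∉ p ∧ algebraMap A B α ∈ I := by
  by_contra! h
  obtain ⟨q, hq, hq', hqp⟩ := Ideal.exists_ideal_over_prime_of_isIntegral p I fun α hα =>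
    by_contra fun hα' => h α hα' hα
  obtain ⟨x, rfl⟩ := hn q hq' hqp
  exact hI x hq

lemma repr_mem_of_mem_map_smul_top {A B M ι : Type*} [CommRing A] [CommRing B] [Algebra A B]
    [AddCommGroup M] [Module A M] [Module B M] [IsScalarTower A B M] (e : Module.Basis ι A M)
    (p : Ideal A) {m : M} (hm : m ∈ p.map (algebraMap A B) • (⊤ : Submodule B M)) (i : ι) :
    e.repr m i ∈ p := by
  induction hm using Submodule.smul_induction_on' with
  | smul r hr m _ =>
    rw [Ideal.map] at hr
    induction hr using Submodule.span_induction generalizing m with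
    | mem r hr =>
      obtain ⟨a, ha, rfl⟩ := hr
      rw [algebraMap_smul, map_smul, Finsupp.smul_apply, smul_eq_mul]
      exact p.mul_mem_right _ ha
    | zero => simp
    | add r s _ _ h₁ h₂ =>
      rw [add_smul, map_add, Finsupp.add_apply]
      exact add_mem (h₁ m trivial) (h₂ m trivial)
    | smul b r _ h₁ =>
      rw [smul_eq_mul, mul_comm, mul_smul]
      exact h₁ _ trivial
  | add x _ y _ h₁ h₂ =>
    rw [map_add, Finsupp.add_apply]
    exact add_mem h₁ h₂

/-- A `B`-linear map to a finite product of residue fields of `B`, no component of which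
vanishes, is surjective. -/
lemma surjective_of_forall_exists_ne_zero {B M X : Type*} {κ : X → Type*} [CommRing B]
    [AddCommGroup M] [Module B M] [Finite X] [∀ x, Field (κ x)] [∀ x, Algebra B (κ x)]
    (hsurj : ∀ x, Function.Surjective (algebraMap B (κ x)))
    (hinj : Function.Injective fun x => RingHom.ker (algebraMap B (κ x))) (ℓ : M →ₗ[B] Π x, κ x)
    (hℓ : ∀ x, ∃ m, ℓ m x ≠ 0) : Function.Surjective ℓ := by
  classical
  cases nonempty_fintype X
  have hmax (x) : (RingHom.ker (algebraMap B (κ x))).IsMaximal :=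
    RingHom.ker_isMaximal_of_surjective _ (hsurj x)
  have hcop : Pairwise (Function.onFun IsCoprime fun x => RingHom.ker (algebraMap B (κ x))) :=
    fun x y hxy => Ideal.isCoprime_of_isMaximal fun h => hxy (hinj h)
  have hcrt (v : Π x, κ x) : ∃ b : B, ∀ x, algebraMap B (κ x) b = v x := by
    choose c hc using fun x => hsurj x (v x)
    obtain ⟨b, hb⟩ := Ideal.exists_forall_sub_mem_ideal hcop c
    refine ⟨b, fun x => ?_⟩
    rw [← hc, ← sub_eq_zero, ← map_sub]
    exact hb x
  choose m hm using hℓ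
  intro v
  choose b hb using fun x : X => hcrt (Pi.single x ((ℓ (m x) x)⁻¹ * v x))
  refine ⟨∑ x, b x • m x, ?_⟩
  ext y
  rw [map_sum, Finset.sum_apply, Finset.sum_eq_single y]
  · rw [map_smul, Pi.smul_apply, Algebra.smul_def, hb, Pi.single_eq_same, mul_right_comm,
      inv_mul_cancel₀ (hm y), one_mul]
  · intro x _ hxy
    rw [map_smul, Pi.smul_apply, Algebra.smul_def, hb, Pi.single_eq_of_ne hxy.symm, zero_mul]
  · simp

/-! ### The trace form on an unramified fibre -/

section

variable {n : ℕ} {K A B M : Type u} [Field K] [CommRing A] [CommRing B] [Algebra K A]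
  [Algebra K B] [Algebra A B] [IsScalarTower K A B] [IsDomain B] [Algebra.Smooth K B]
  [AddCommGroup M] [Module B M] [Module.IsTorsionFree B M]

/-- At a point of `X` with residue field `C` where `f` is unramified, the form
`ψ(s ⊗ s') / det (Tf)` on the fibre of `L` is the form `g · ℓ(s) ℓ(s')` of rank one, where
`ℓ` is a coordinate on the fibre of `L`. -/
lemma exists_fibre_coordinate (hn : Module.finrank B Ω[B⁄K] = n) {a : Fin n → A}
    {δ : Fin n → Derivation K A A} {hA : A} (HA : IsFrame K a δ hA) (hhA : IsUnit hA)
    (ψ : M ⊗[B] M ≃ₗ[B] DetHom n K A B) {C : Type u} [Field C] [Algebra A C] [Algebra B C]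
    [IsScalarTower A B C] (hder : ∀ d : Derivation A B C, d = 0) (g : C) (t : M)
    (hg : DetHom.EqSMulAlong (algebraMap B C) g (DetHom.jacobian n K A B) (ψ (t ⊗ₜ t)))
    (I : Ideal B) (r : B) (hr : algebraMap B C r ≠ 0)
    (hrI : ∀ z, algebraMap B C z = 0 → r * z ∈ I) :
    g ≠ 0 ∧ ∃ ℓ : M →ₗ[B] C, ℓ t ≠ 0 ∧
      (∀ m, ℓ m = 0 → ∃ d, algebraMap B C d ≠ 0 ∧ d • m ∈ I • (⊤ : Submodule B M)) ∧
      ∀ {LB : Type u} [Field LB] [Algebra B LB] [IsFractionRing B LB] (s s' : M) (w : LB),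
        DetHom.EqSMulAlong (algebraMap B LB) w (ψ (s ⊗ₜ s')) (DetHom.jacobian n K A B) →
        ∃ d c, algebraMap B C d ≠ 0 ∧ w * algebraMap B LB d = algebraMap B LB c ∧
          algebraMap B C c = algebraMap B C d * (g * ℓ s * ℓ s') := by
  obtain ⟨u, D, h, hh, HB⟩ := exists_isFrame_algebraMap_ne_zero (K := K) hn (algebraMap B C)
  have hh0 : h ≠ 0 := fun h0 => hh (by rw [h0, map_zero])
  have hA' : algebraMap B C (algebraMap A B hA) ≠ 0 :=
    ((hhA.map (algebraMap A B)).map (algebraMap B C)).ne_zero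
  set j := DetHom.coord a D (DetHom.jacobian n K A B) with hj
  have hj0 : algebraMap B C j ≠ 0 := DetHom.coord_jacobian_ne_zero HA HB
    (hhA.map (algebraMap A C)).ne_zero hh hder
  set c := coordPairing ψ a D with hc
  have hc0 := coordPairing_eq_zero ψ HA hhA HB hh0
  have hgt : algebraMap B C j = g * algebraMap B C (c t t) :=
    (DetHom.eqSMulAlong_iff HA HB _ hA' hh g _ _).1 hg
  have hg0 : g ≠ 0 := fun h0 => hj0 (by rw [hgt, h0, zero_mul])
  have ht0 : algebraMap B C (c t t) ≠ 0 := fun h0 => hj0 (by rw [hgt, h0, mul_zero])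
  let ℓ : M →ₗ[B] C := LinearMap.mulRight B (algebraMap B C j)⁻¹ ∘ₗ Algebra.linearMap B C ∘ₗ c.flip t
  have hℓ (m) : ℓ m = algebraMap B C (c m t) * (algebraMap B C j)⁻¹ := rfl
  refine ⟨hg0, ℓ, ?_, fun m hm => ?_, fun {LB} _ _ _ s s' w hw => ?_⟩
  · rw [hℓ]
    exact mul_ne_zero ht0 (inv_ne_zero hj0)
  · rw [hℓ] at hm
    refine ⟨r * c t t, ?_, ?_⟩
    · rw [map_mul]
      exact mul_ne_zero hr ht0
    · rw [mul_smul, smul_eq_smul_left hc0 t t m, ← mul_smul]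
      exact Submodule.smul_mem_smul
        (hrI _ ((mul_eq_zero.1 hm).resolve_right (inv_ne_zero hj0))) trivial
  · have hh' : algebraMap B LB h ≠ 0 := by
      rwa [Ne, map_eq_zero_iff _ (IsFractionRing.injective B LB)]
    refine ⟨j, c s s', hj0, (coord_eq_mul_coord_jacobian HA hhA _ hw HB hh').symm, ?_⟩
    have h₁ := congrArg (algebraMap B C) (pairing_mul_pairing hc0 s s' t)
    rw [map_mul, map_mul] at h₁
    have h₂ : algebraMap B C j * (g * ℓ s * ℓ s') = g * (algebraMap B C (c s t) *
        algebraMap B C (c s' t)) * (algebraMap B C j)⁻¹ := by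
      rw [hℓ, hℓ]
      field_simp
    rw [h₂, ← h₁, ← mul_assoc, ← hgt, mul_right_comm, mul_inv_cancel₀ hj0, one_mul]

/-- **The trace form on a fibre.** Over a closed point with residue field `k` outside the branch
locus, the values of the global sections `e i` of `L` on the fibre form a basis of the product of
the residue fields, in which the Gram matrix of the sum of the scaled trace forms is the reduction
of the Gram matrix of the trace form. -/
lemma exists_basis_fibre {LA LB k X ι : Type u} {κ : X → Type u} [IsDomain A] [FaithfulSMul A B]
    [Module.Finite A B] [Field LA] [Field LB] [Algebra A LA] [IsFractionRing A LA] [Algebra B LB]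
    [IsFractionRing B LB] [Algebra A LB] [IsScalarTower A B LB] [Algebra LA LB]
    [IsScalarTower A LA LB] [FiniteDimensional LA LB] [Algebra.IsSeparable LA LB]
    [Module A M] [IsScalarTower A B M]
    (hn : Module.finrank B Ω[B⁄K] = n) {a : Fin n → A}
    {δ : Fin n → Derivation K A A} {hA : A} (HA : IsFrame K a δ hA) (hhA : IsUnit hA)
    (ψ : M ⊗[B] M ≃ₗ[B] DetHom n K A B) [Finite ι] [Nonempty ι] (e : Module.Basis ι A M)
    [Field k] [Algebra A k] (hk : Function.Surjective (algebraMap A k)) [Fintype X]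
    [∀ x, Field (κ x)] [∀ x, Algebra A (κ x)] [∀ x, Algebra B (κ x)] [∀ x, Algebra k (κ x)]
    [∀ x, IsScalarTower A B (κ x)] [∀ x, IsScalarTower A k (κ x)]
    [∀ x, FiniteDimensional k (κ x)]
    (hsurj : ∀ x, Function.Surjective (algebraMap B (κ x)))
    (hinj : Function.Injective fun x => RingHom.ker (algebraMap B (κ x)))
    (hfib : ∀ q : Ideal B, q.IsPrime → q.comap (algebraMap A B) = RingHom.ker (algebraMap A k) →
      ∃ x, q = RingHom.ker (algebraMap B (κ x)))
    (hder : ∀ x, ∀ d : Derivation A B (κ x), d = 0)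
    (hram : ∀ x, ∃ r : B, algebraMap B (κ x) r ≠ 0 ∧ ∀ z, algebraMap B (κ x) z = 0 →
      r * z ∈ (RingHom.ker (algebraMap A k)).map (algebraMap A B))
    (g : Π x, κ x) (hg : ∀ x, ∃ t : M, DetHom.EqSMulAlong (algebraMap B (κ x)) (g x)
      (DetHom.jacobian n K A B) (ψ (t ⊗ₜ t))) :
    (∀ x, g x ≠ 0) ∧ ∃ f : Module.Basis ι k (Π x, κ x), ∀ i j (w : LB) (α : A),
      DetHom.EqSMulAlong (algebraMap B LB) w (ψ (e i ⊗ₜ e j)) (DetHom.jacobian n K A B) →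
      Algebra.trace LA LB w = algebraMap A LA α →
      ∑ x, Algebra.trace k (κ x) (g x * f i x * f j x) = algebraMap A k α := by
  choose t ht using hg
  choose r hr hr' using hram
  have H x := exists_fibre_coordinate hn HA hhA ψ (hder x) (g x) (t x) (ht x) _ (r x) (hr x) (hr' x)
  choose hg0 ℓ' hℓt hℓ0 hℓb using H
  refine ⟨hg0, ?_⟩
  set p := RingHom.ker (algebraMap A k) with hp
  have hpp : p.IsPrime := RingHom.ker_isPrime _
  let ℓ : M →ₗ[B] Π x, κ x := LinearMap.pi ℓ'
  have hℓsurj : Function.Surjective ℓ :=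
    surjective_of_forall_exists_ne_zero hsurj hinj ℓ fun x => ⟨t x, hℓt x⟩
  have hover := exists_algebraMap_mem_of_forall_not_le (A := A) (B := B) p
    (fun x => RingHom.ker (algebraMap B (κ x))) hfib
  have hkκ (x) (α : A) : algebraMap B (κ x) (algebraMap A B α) =
      algebraMap k (κ x) (algebraMap A k α) := by
    rw [← IsScalarTower.algebraMap_apply, ← IsScalarTower.algebraMap_apply]
  -- The values of the basis on the fibre are linearly independent.
  have hker (m : M) (hm : ℓ m = 0) (i : ι) : e.repr m i ∈ p := by
    let I : Ideal B := (p.map (algebraMap A B) • (⊤ : Submodule B M)).comap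
      (LinearMap.toSpanSingleton B M m)
    obtain ⟨α, hα, hαI⟩ := hover I fun x hx => by
      obtain ⟨d, hd, hdm⟩ := hℓ0 x m (congrFun hm x)
      exact hd (hx hdm)
    have h₁ := repr_mem_of_mem_map_smul_top e p (m := algebraMap A B α • m) hαI i
    rw [algebraMap_smul, map_smul, Finsupp.smul_apply, smul_eq_mul] at h₁
    exact (hpp.mem_or_mem h₁).resolve_left hα
  cases nonempty_fintype ι
  have hℓs (α : A) (m : M) : ℓ (α • m) = algebraMap A k α • ℓ m := by
    ext x
    rw [← algebraMap_smul B α m, map_smul, Pi.smul_apply, Pi.smul_apply, Algebra.smul_def, hkκ,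
      Algebra.smul_def]
  have hli : LinearIndependent k fun i => ℓ (e i) := by
    rw [Fintype.linearIndependent_iff]
    intro v hv i
    choose α hα using fun i => hk (v i)
    have h₁ : ℓ (∑ i, α i • e i) = 0 := by
      rw [map_sum, ← hv]
      exact Finset.sum_congr rfl fun i _ => by rw [hℓs, hα]
    have h₂ := hker _ h₁ i
    rw [e.repr_sum_self] at h₂
    rw [← hα]
    exact h₂
  let f : Module.Basis ι k (Π x, κ x) := .mk hli fun v _ => by
    obtain ⟨m, rfl⟩ := hℓsurj v
    rw [← e.sum_repr m, map_sum]
    exact Submodule.sum_mem _ fun i _ => by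
      rw [hℓs]
      exact Submodule.smul_mem _ _ (Submodule.subset_span ⟨i, rfl⟩)
  have hf (i) : f i = ℓ (e i) := by simp [f]
  refine ⟨f, fun i j w α hw hα => ?_⟩
  -- A multiple `β` of `w` by an element `γ` of `A` outside `p` is integral.
  let I : Ideal B := (Submodule.comap (LinearMap.mulLeft B w ∘ₗ Algebra.linearMap B LB)
    (LinearMap.range (Algebra.linearMap B LB)))
  have hex : ∃ γ, γ ∉ p ∧ algebraMap A B γ ∈ I := hover I fun x hx => by
    obtain ⟨d, c, hd, hdc, -⟩ := hℓb x (e i) (e j) w hw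
    exact hd (hx (show d ∈ I from ⟨c, hdc.symm⟩))
  obtain ⟨γ, hγ, β, hβ⟩ := hex
  replace hβ : algebraMap B LB β = w * algebraMap B LB (algebraMap A B γ) := hβ
  have hβx (x) : algebraMap B (κ x) β =
      algebraMap k (κ x) (algebraMap A k γ) * (g x * f i x * f j x) := by
    obtain ⟨d, c, hd, hdc, hc⟩ := hℓb x (e i) (e j) w hw
    have h₁ : d * β = algebraMap A B γ * c := by
      apply IsFractionRing.injective B LB
      rw [map_mul, map_mul, hβ, ← hdc]
      ring
    have h₂ := congrArg (algebraMap B (κ x)) h₁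
    rw [map_mul, map_mul, hc, hkκ, mul_left_comm] at h₂
    rw [mul_left_cancel₀ hd h₂, hf, hf]
    rfl
  -- Compute the trace of `β` on `M` both generically and on the fibre.
  have hM : Nontrivial M := by
    obtain ⟨i⟩ : Nonempty ι := inferInstance
    exact ⟨e i, 0, e.ne_zero i⟩
  obtain ⟨m₀, hm₀⟩ := exists_ne (0 : M)
  obtain ⟨u, D, h, hh, HB⟩ := exists_isFrame_algebraMap_ne_zero (K := K) hn (algebraMap B LB)
  have hh0 : h ≠ 0 := fun h0 => hh (by rw [h0, map_zero])
  let θ : M →ₗ[B] LB := Algebra.linearMap B LB ∘ₗ (coordPairing ψ a D).flip m₀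
  have hθ : Function.Injective θ := by
    rw [injective_iff_map_eq_zero]
    intro m hm
    have h₁ : coordPairing ψ a D m m₀ = 0 :=
      IsFractionRing.injective B LB (hm.trans (map_zero _).symm)
    exact (coordPairing_eq_zero ψ HA hhA HB hh0 m m₀ h₁).resolve_right hm₀
  obtain ⟨fθ, hfθ⟩ := exists_basis_fractionRing (LA := LA) e θ hθ
  let T : M →ₗ[A] M := Algebra.lsmul A A M β
  have h₁ := trace_eq_algebraMap_trace e fθ (θ.restrictScalars A) hfθ T (algebraMap B LB β)
    fun m => by
      change θ (β • m) = _
      rw [map_smul, Algebra.smul_def]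
      rfl
  let : Module A (Π x, κ x) := Pi.module _ _ _
  have h₂ := trace_eq_algebraMap_trace e f (ℓ.restrictScalars A) hf T
    (fun x => algebraMap B (κ x) β) fun m => by
      change ℓ (β • m) = _
      rw [map_smul]
      ext x
      rw [Pi.smul_apply, Algebra.smul_def]
      rfl
  have h₃ : LinearMap.trace A M T = γ * α := by
    apply IsFractionRing.injective A LA
    rw [← h₁, hβ, mul_comm w, ← IsScalarTower.algebraMap_apply,
      IsScalarTower.algebraMap_apply A LA LB, ← Algebra.smul_def, map_smul, hα, map_mul,
      smul_eq_mul]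
  rw [trace_pi_apply, h₃, map_mul] at h₂
  refine mul_left_cancel₀ (fun h0 => hγ h0) (Eq.trans ?_ h₂)
  rw [Finset.mul_sum]
  refine Finset.sum_congr rfl fun x _ => ?_
  rw [hβx, ← smul_eq_mul, ← map_smul, Algebra.smul_def]

end

/-! ### Orthogonal sums in the Grothendieck-Witt group -/

namespace SymmBilinSpace

variable {k : Type u} [Field k]

/-- The orthogonal sum of a finite family. -/
noncomputable def pi {X : Type u} [Fintype X] (M : X → SymmBilinSpace k) : SymmBilinSpace k where
  carrier := Π x, (M x).carrier
  form := ∑ x, (M x).form.comp (LinearMap.proj x) (LinearMap.proj x)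
  symm := ⟨fun v w => by simp [(M _).symm.eq]⟩
  nondegenerate := by
    classical
    constructor
    · intro v h
      ext x
      refine (M x).nondegenerate.1 _ fun z => ?_
      have := h (Pi.single x z)
      simp only [LinearMap.coe_sum, Finset.sum_apply, LinearMap.BilinForm.comp_apply,
        LinearMap.proj_apply] at this
      rw [Finset.sum_eq_single x (fun y _ hy => by rw [Pi.single_eq_of_ne hy, map_zero])
        (by simp)] at this
      simpa using this
    · intro v h
      ext x
      refine (M x).nondegenerate.2 _ fun z => ?_
      have := h (Pi.single x z)
      simp only [LinearMap.coe_sum, Finset.sum_apply, LinearMap.BilinForm.comp_apply,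
        LinearMap.proj_apply] at this
      rw [Finset.sum_eq_single x (fun y _ hy => by rw [Pi.single_eq_of_ne hy, map_zero]; rfl)
        (by simp)] at this
      simpa using this

lemma pi_form {X : Type u} [Fintype X] (M : X → SymmBilinSpace k) (v w : Π x, (M x).carrier) :
    (pi M).form v w = ∑ x, (M x).form (v x) (w x) := by
  change (∑ x, (M x).form.comp (LinearMap.proj x) (LinearMap.proj x) :
    LinearMap.BilinForm k (Π x, (M x).carrier)) v w = _
  simp only [LinearMap.coe_sum, Finset.sum_apply, LinearMap.BilinForm.comp_apply,
    LinearMap.proj_apply]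

/-- The isometry class of a space. -/
def toClass (M : SymmBilinSpace k) : IsometryClass k := Quotient.mk (setoid k) M

lemma toClass_eq {M N : SymmBilinSpace k} (e : M.carrier ≃ₗ[k] N.carrier)
    (he : ∀ x y, N.form (e x) (e y) = M.form x y) : M.toClass = N.toClass :=
  Quotient.sound ⟨e, he⟩

lemma sum_toClass {X : Type u} [Fintype X] (M : X → SymmBilinSpace k) :
    ∑ x, (M x).toClass = (pi M).toClass := by
  refine Fintype.induction_empty_option (P := fun X _ => ∀ M : X → SymmBilinSpace k,
    ∑ x, (M x).toClass = (pi M).toClass) ?_ ?_ ?_ X M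
  · intro α β _ e h M
    let := Fintype.ofEquiv β e.symm
    have h₁ := h fun a => M (e a)
    rw [← e.sum_comp, h₁]
    refine toClass_eq (LinearEquiv.piCongrLeft k (fun b => (M b).carrier) e) fun v w => ?_
    refine (pi_form M _ _).trans (Eq.trans ?_ (pi_form (fun a => M (e a)) v w).symm)
    rw [← e.sum_comp]
    refine Finset.sum_congr rfl fun a _ => ?_
    have h₂ (v : Π a, (M (e a)).carrier) :
        LinearEquiv.piCongrLeft k (fun b => (M b).carrier) e v (e a) = v a :=
      Equiv.piCongrLeft_apply_apply (fun b => (M b).carrier) e v a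
    exact congrArg₂ (fun x y => (M (e a)).form x y) (h₂ v) (h₂ w)
  · intro M
    rw [Finset.univ_eq_empty, Finset.sum_empty]
    have : Subsingleton (pi M).carrier := inferInstanceAs (Subsingleton (Π x : PEmpty, _))
    refine toClass_eq (M := zero k)
      { (0 : (zero k).carrier →ₗ[k] (pi M).carrier) with
        invFun := fun _ => PUnit.unit
        left_inv := fun _ => rfl
        right_inv := fun _ => Subsingleton.elim _ _ } fun x y => ?_
    exact pi_form M _ _
  · intro α _ h M
    rw [Fintype.sum_option, h fun a => M (some a)]
    refine (toClass_eq (M := pi M) (N := (M none).sum (pi fun a => M (some a)))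
      (LinearEquiv.piOptionEquivProd k) fun v w => ?_).symm
    refine Eq.trans ?_ ((pi_form M v w).trans (Fintype.sum_option _)).symm
    exact congrArg _ (pi_form (fun a => M (some a)) _ _)

end SymmBilinSpace

namespace GW

variable {k : Type u} [Field k]

lemma ofForm_form (M : SymmBilinSpace k) :
    ofForm M.form = Algebra.GrothendieckAddGroup.of M.toClass := by
  rw [ofForm, dif_pos ⟨M.finite, M.symm, M.nondegenerate⟩]
  rfl

lemma map_of {l : Type u} [Field l] (φ : k →+* l) (x : SymmBilinSpace.IsometryClass k) :
    map φ (Algebra.GrothendieckAddGroup.of x) =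
      Algebra.GrothendieckAddGroup.of (SymmBilinSpace.IsometryClass.map φ x) := by
  exact congr($(Algebra.GrothendieckAddGroup.lift.symm_apply_apply
    (Algebra.GrothendieckAddGroup.of.comp (SymmBilinSpace.IsometryClass.map φ))) x)

end GW

open RelOrient in
/-- The scaled trace form of a separable extension, as a bilinear space. -/
noncomputable def SymmBilinSpace.scaledTrace (k E : Type u) [Field k] [Field E] [Algebra k E]
    [FiniteDimensional k E] [Algebra.IsSeparable k E] (g : E) (hg : g ≠ 0) :
    SymmBilinSpace k where
  carrier := E
  form := scaledTraceForm k E g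
  symm := ⟨fun x y => by simp [scaledTraceForm, Algebra.traceForm_apply, mul_right_comm]⟩
  nondegenerate := by
    have h := traceForm_nondegenerate k E
    constructor
    · intro x hx
      exact (mul_eq_zero.1 (h.1 (g * x) hx)).resolve_left hg
    · intro x hx
      refine h.2 x fun y => ?_
      have := hx (g⁻¹ * y)
      simp only [scaledTraceForm, LinearMap.BilinForm.comp_apply, LinearMap.mulLeft_apply,
        LinearMap.id_apply, mul_inv_cancel_left₀ hg] at this
      exact this

open RelOrient in
/-- A comparison of Gram matrices gives the decomposition of an extension of scalars into scaled
trace forms. -/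
lemma GW.sum_scaledTraceForm_eq_map {K k V ι X : Type u} [Field K] [Field k] (φ : K →+* k)
    [AddCommGroup V] [Module K V] [Finite ι] [Fintype X] {κ : X → Type u} [∀ x, Field (κ x)]
    [∀ x, Algebra k (κ x)] [∀ x, FiniteDimensional k (κ x)] [∀ x, Algebra.IsSeparable k (κ x)]
    (β : LinearMap.BilinForm K V) (hβ : β.IsSymm) (hβ' : β.Nondegenerate) (g : Π x, κ x)
    (hg : ∀ x, g x ≠ 0) (b : Module.Basis ι K V) (f : Module.Basis ι k (Π x, κ x))
    (h : ∀ i j, ∑ x, Algebra.trace k (κ x) (g x * f i x * f j x) = φ (β (b i) (b j))) :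
    ∑ x, GW.ofForm (scaledTraceForm k (κ x) (g x)) = GW.map φ (GW.ofForm β) := by
  have := Module.Finite.of_basis b
  let N : SymmBilinSpace K := ⟨V, β, hβ, hβ'⟩
  let M (x : X) := SymmBilinSpace.scaledTrace k (κ x) (g x) (hg x)
  have h₁ : GW.ofForm β = Algebra.GrothendieckAddGroup.of N.toClass := GW.ofForm_form N
  have h₂ (x) : GW.ofForm (scaledTraceForm k (κ x) (g x)) =
      Algebra.GrothendieckAddGroup.of (M x).toClass := GW.ofForm_form (M x)
  simp only [h₁, h₂, GW.map_of, ← map_sum, SymmBilinSpace.sum_toClass]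
  congr 1
  let : Algebra K k := φ.toAlgebra
  let b' : Module.Basis ι k (k ⊗[K] V) := b.baseChange k
  let E : (SymmBilinSpace.pi M).carrier ≃ₗ[k] (N.baseChange k).carrier := f.equiv b' (Equiv.refl ι)
  refine SymmBilinSpace.toClass_eq E fun v w => ?_
  have h₃ : (N.baseChange k).form.comp E.toLinearMap E.toLinearMap =
      (SymmBilinSpace.pi M).form := by
    refine LinearMap.BilinForm.ext_basis f fun i j => ?_
    have hE (i) : E (f i) = (1 : k) ⊗ₜ[K] b i := by
      change f.equiv b' (Equiv.refl ι) (f i) = _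
      simp [b']
    have h₄ : (N.baseChange k).form (E (f i)) (E (f j)) = φ (β (b i) (b j)) := by
      rw [hE, hE]
      refine (LinearMap.BilinForm.baseChange_tmul ..).trans ?_
      rw [one_mul, ← Algebra.algebraMap_eq_smul_one]
      rfl
    refine Eq.trans ?_ (((SymmBilinSpace.pi_form M (f i) (f j)).trans (h i j)).symm)
    exact h₄
  exact congr($h₃ v w)

/-! ### Sections of Ulrich bundles -/

/-- Finite copowers in a preadditive category are biproducts. -/
lemma CategoryTheory.Limits.IsColimit.exists_biproduct {C I : Type*} [Category* C] [Preadditive C]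
    [Fintype I] [DecidableEq I] {U F : C} (ι : I → (U ⟶ F))
    (hc : Limits.IsColimit (Limits.Cofan.mk F ι)) :
    ∃ π : I → (F ⟶ U), (∀ i j, ι i ≫ π j = if i = j then 𝟙 U else 0) ∧ ∑ i, π i ≫ ι i = 𝟙 F := by
  let π (j : I) : F ⟶ U := Limits.Cofan.IsColimit.desc hc fun i => if i = j then 𝟙 U else 0
  have h₁ (i j) : ι i ≫ π j = if i = j then 𝟙 U else 0 :=
    Limits.Cofan.IsColimit.fac hc (fun i => if i = j then 𝟙 U else 0) i
  refine ⟨π, h₁, Limits.Cofan.IsColimit.hom_ext hc _ _ fun i => ?_⟩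
  change ι i ≫ _ = ι i ≫ 𝟙 _
  rw [Preadditive.comp_sum, Finset.sum_eq_single i]
  · rw [← Category.assoc, h₁, if_pos rfl, Category.id_comp, Category.comp_id]
  · intro j _ hij
    rw [← Category.assoc, h₁, if_neg hij.symm, Limits.zero_comp]
  · simp

namespace RelOrient

variable {K : Type u} [Field K] {X Y : Scheme.{u}}

section

variable (f : X ⟶ Y) (q : Y ⟶ Spec (.of K)) (L : X.Modules) (V : Y.Opens)

noncomputable instance : Module (SecY q V) (SecL f q L V) :=
  Module.compHom _ (algebraMap (SecY q V) (SecX f q V))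

instance : IsScalarTower (SecY q V) (SecX f q V) (SecL f q L V) :=
  .of_algebraMap_smul fun _ _ => rfl

instance : IsScalarTower K (SecY q V) (SecL f q L V) :=
  .of_algebraMap_smul fun _ _ => rfl

end

lemma resL_smul (f : X ⟶ Y) (q : Y ⟶ Spec (.of K)) (L : X.Modules) {V W : Y.Opens} (h : W ≤ V)
    (b : SecX f q V) (m : SecL f q L V) : resL f q L h (b • m) = resX f q h b • resL f q L h m :=
  Scheme.Modules.map_smul L (homOfLE (f.preimage_mono h)) b m

lemma resL_smul' (f : X ⟶ Y) (q : Y ⟶ Spec (.of K)) (L : X.Modules) {V W : Y.Opens} (h : W ≤ V)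
    (a : SecY q V) (m : SecL f q L V) : resL f q L h (a • m) = resY q h a • resL f q L h m := by
  rw [← algebraMap_smul (SecX f q V) a m, resL_smul, ← algebraMap_smul (SecX f q W)]
  congr 1
  exact res_comm f q h a

lemma resL_resL (f : X ⟶ Y) (q : Y ⟶ Spec (.of K)) (L : X.Modules) {U V W : Y.Opens} (h : W ≤ V)
    (h' : V ≤ U) (m : SecL f q L U) :
    resL f q L h (resL f q L h' m) = resL f q L (h.trans h') m := by
  change (L.presheaf.map _ ≫ L.presheaf.map _) m = _
  rw [← L.presheaf.map_comp]
  rfl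

/-- If `L` is `f`-Ulrich, then there are global sections of `L` whose restrictions form a basis
of the sections of `f_* L` over each open subset. -/
lemma exists_basis_of_isUlrich {f : X ⟶ Y} (q : Y ⟶ Spec (.of K)) {L : X.Modules}
    (hU : IsUlrich f L) : ∃ (t : ℕ) (_ : 0 < t) (s : ULift.{u} (Fin t) → SecL f q L ⊤),
      ∀ V : Y.Opens, ∃ e : Module.Basis (ULift.{u} (Fin t)) (SecY q V) (SecL f q L V),
        ∀ i, e i = resL f q L le_top (s i) := by
  classical
  obtain ⟨t, ht, ⟨α⟩⟩ := hU
  let I := ULift.{u} (Fin t)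
  let N : Y.Modules := (Scheme.Modules.pushforward f).obj L
  let F : Y.Modules := SheafOfModules.free (R := Y.ringCatSheaf) I
  let U : Y.Modules := SheafOfModules.unit Y.ringCatSheaf
  let α : N ≅ F := α
  let ι (i : I) : U ⟶ F := SheafOfModules.ιFree (R := Y.ringCatSheaf) i
  obtain ⟨π, h₁, h₃⟩ := Limits.IsColimit.exists_biproduct ι
    (SheafOfModules.isColimitFreeCofan (R := Y.ringCatSheaf) I)
  let ι' (i : I) : U ⟶ N := ι i ≫ α.inv
  let π' (i : I) : N ⟶ U := α.hom ≫ π i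
  have h₁' (i j) : ι' i ≫ π' j = if i = j then 𝟙 U else 0 := by
    simp only [ι', π', Category.assoc, Iso.inv_hom_id_assoc]
    exact h₁ i j
  have h₃' : ∑ i, π' i ≫ ι' i = 𝟙 N := by
    have : ∑ i, π' i ≫ ι' i = α.hom ≫ (∑ i, π i ≫ ι i) ≫ α.inv := by
      simp only [ι', π', Category.assoc, Preadditive.comp_sum, Preadditive.sum_comp]
    rw [this, h₃]
    simp
  let one (V : Y.Opens) : Γ(U, V) := (1 : Γ(Y, V))
  let s (V : Y.Opens) (i : I) : SecL f q L V := (ι' i).app V (one V)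
  have hs {V W : Y.Opens} (h : W ≤ V) (i) : resL f q L h (s V i) = s W i := by
    have := congr($((ι' i).mapPresheaf.naturality (homOfLE h).op) (one V))
    refine Eq.trans this.symm ?_
    change (ι' i).app W (U.presheaf.map (homOfLE h).op (one V)) = (ι' i).app W (one W)
    congr 1
    exact map_one (Y.presheaf.map (homOfLE h).op).hom
  refine ⟨t, ht, s ⊤, fun V => ?_⟩
  have hone (c : Γ(U, V)) : c = (show Γ(Y, V) from c) • one V := (mul_one (M := Γ(Y, V)) c).symm
  let c (i : I) : SecL f q L V →ₗ[SecY q V] SecY q V :=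
    { toFun := fun m => (π' i).app V m
      map_add' := fun x y => map_add ((π' i).app V).hom x y
      map_smul' := fun a m => Scheme.Modules.Hom.app_smul (π' i) a m }
  have hcs (i j : I) : c i (s V j) = if j = i then 1 else 0 := by
    change (ι' j ≫ π' i).app V (one V) = _
    rw [h₁']
    split_ifs <;> rfl
  have hsum (m : SecL f q L V) : ∑ i, c i m • s V i = m := by
    let ev : (N ⟶ N) →+ SecL f q L V :=
      { toFun := fun φ => φ.app V m
        map_zero' := rfl
        map_add' := fun _ _ => rfl }
    have h₄ := congrArg ev h₃'
    rw [map_sum] at h₄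
    refine Eq.trans (Finset.sum_congr rfl fun i _ => ?_) h₄
    change _ = (ι' i).app V ((π' i).app V m)
    rw [hone ((π' i).app V m), Scheme.Modules.Hom.app_smul]
    rfl
  let e : SecL f q L V ≃ₗ[SecY q V] (I → SecY q V) :=
    { LinearMap.pi c with
      invFun := fun v => ∑ i, v i • s V i
      left_inv := fun m => hsum m
      right_inv := fun v => by
        ext i
        change c i (∑ j, v j • s V j) = v i
        simp only [map_sum, map_smul, hcs, smul_eq_mul, mul_ite, mul_one, mul_zero]
        exact (Finset.sum_ite_eq' Finset.univ i v).trans (if_pos (Finset.mem_univ i)) }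
  refine ⟨.ofEquivFun e, fun i => ?_⟩
  rw [hs le_top, Module.Basis.coe_ofEquivFun]
  change ∑ j, (Pi.single i (1 : SecY q V) : I → SecY q V) j • s V j = s V i
  simp only [Pi.single_apply, ite_smul, one_smul, zero_smul]
  exact (Finset.sum_ite_eq' Finset.univ i _).trans (if_pos (Finset.mem_univ i))

end RelOrient

/-! ### Functions on affine open subsets -/

/-- The rank of the module of differentials of a domain which is smooth of relative dimension
`n`. -/
lemma finrank_kaehlerDifferential_of_locally {K B : Type u} [CommRing K] [CommRing B] [IsDomain B]
    [Algebra K B] {n : ℕ}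
    (h : RingHom.Locally (RingHom.IsStandardSmoothOfRelativeDimension n) (algebraMap K B)) :
    Module.finrank B Ω[B⁄K] = n := by
  obtain ⟨s, hs, hs'⟩ := h
  obtain ⟨t, ht, ht0⟩ : ∃ t ∈ s, t ≠ 0 := by
    by_contra! h0
    have : Ideal.span s ≤ ⊥ := Ideal.span_le.2 fun t ht => h0 t ht
    rw [hs] at this
    exact bot_ne_top (top_le_iff.1 this).symm.symm
  have hle : Submonoid.powers t ≤ nonZeroDivisors B :=
    powers_le_nonZeroDivisors_of_noZeroDivisors ht0
  have h₁ := hs' t ht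
  rw [← IsScalarTower.algebraMap_eq, RingHom.isStandardSmoothOfRelativeDimension_algebraMap] at h₁
  have : IsDomain (Localization.Away t) := IsLocalization.isDomain_localization hle
  have h₂ := Algebra.IsStandardSmoothOfRelativeDimension.rank_kaehlerDifferential (R := K)
    (S := Localization.Away t) n
  rw [← IsLocalizedModule.finrank_eq (Submonoid.powers t)
    (KaehlerDifferential.map K K B (Localization.Away t)) hle,
    ← IsLocalization.finrank_eq (Localization.Away t) (Submonoid.powers t) hle]
  exact Module.finrank_eq_of_rank_eq h₂

namespace RelOrient

variable {K : Type u} [Field K] {X Y : Scheme.{u}}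

lemma smooth_locally_appLE {Z : Scheme.{u}} (n : ℕ) (p : Z ⟶ Spec (.of K))
    [SmoothOfRelativeDimension n p] {U : Z.Opens} (hU : IsAffineOpen U) (φ : K →+* Γ(Z, U))
    (hφ : φ = ((Scheme.ΓSpecIso (.of K)).inv ≫ p.appLE ⊤ U le_top).hom) :
    φ.Smooth ∧ RingHom.Locally (RingHom.IsStandardSmoothOfRelativeDimension n) φ := by
  have := SmoothOfRelativeDimension.smooth n p
  let e : K ≃+* Γ(Spec (.of K), ⊤) := (Scheme.ΓSpecIso (.of K)).commRingCatIsoToRingEquiv.symm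
  have hφ' : φ = (p.appLE ⊤ U le_top).hom.comp e.toRingHom := hφ
  rw [hφ']
  have h₁ : (p.appLE ⊤ U le_top).hom.Smooth := p.smooth_appLE (isAffineOpen_top _) hU le_top
  have h₂ := HasRingHomProperty.appLE (@SmoothOfRelativeDimension n) p inferInstance
    ⟨⊤, isAffineOpen_top _⟩ ⟨U, hU⟩ le_top
  exact ⟨RingHom.Smooth.respectsIso.2 _ e h₁, (RingHom.locally_respectsIso
    RingHom.isStandardSmoothOfRelativeDimension_respectsIso).2 _ e h₂⟩

section

variable (f : X ⟶ Y) (q : Y ⟶ Spec (.of K))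

lemma algebraMap_secX_eq (V : Y.Opens) : algebraMap K (SecX f q V) =
    ((Scheme.ΓSpecIso (.of K)).inv ≫ (f ≫ q).appLE ⊤ (f ⁻¹ᵁ V) le_top).hom := by
  have : ((Scheme.ΓSpecIso (.of K)).inv ≫ q.appTop ≫ Y.presheaf.map (homOfLE le_top).op) ≫
      f.app V = (Scheme.ΓSpecIso (.of K)).inv ≫ (f ≫ q).appLE ⊤ (f ⁻¹ᵁ V) le_top := by
    have h := Scheme.Hom.comp_appLE f q ⊤ (f ⁻¹ᵁ V) le_top
    refine Eq.trans ?_ (congrArg ((Scheme.ΓSpecIso (.of K)).inv ≫ ·) h.symm)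
    rw [Category.assoc, Category.assoc, ← f.appLE_eq_app, Scheme.Hom.map_appLE]
    rfl
  exact congrArg CommRingCat.Hom.hom this

variable {V : Y.Opens} (hV : IsAffineOpen V)

include hV

lemma smooth_secY (n : ℕ) [SmoothOfRelativeDimension n q] : Algebra.Smooth K (SecY q V) := by
  rw [← RingHom.smooth_algebraMap]
  exact (smooth_locally_appLE n q hV _ rfl).1

lemma finrank_secY (n : ℕ) [SmoothOfRelativeDimension n q] [IsDomain (SecY q V)] :
    Module.finrank (SecY q V) Ω[SecY q V⁄K] = n :=
  finrank_kaehlerDifferential_of_locally (smooth_locally_appLE n q hV _ rfl).2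

lemma smooth_secX (n : ℕ) [IsFinite f] [SmoothOfRelativeDimension n (f ≫ q)] :
    Algebra.Smooth K (SecX f q V) := by
  rw [← RingHom.smooth_algebraMap]
  exact (smooth_locally_appLE n (f ≫ q) (hV.preimage f) _ (algebraMap_secX_eq f q V)).1

lemma finrank_secX (n : ℕ) [IsFinite f] [SmoothOfRelativeDimension n (f ≫ q)]
    [IsDomain (SecX f q V)] : Module.finrank (SecX f q V) Ω[SecX f q V⁄K] = n :=
  finrank_kaehlerDifferential_of_locally
    (smooth_locally_appLE n (f ≫ q) (hV.preimage f) _ (algebraMap_secX_eq f q V)).2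

lemma finite_secX [IsFinite f] : Module.Finite (SecY q V) (SecX f q V) := by
  rw [← RingHom.finite_algebraMap]
  exact f.finite_app V hV

end

section

variable (f : X ⟶ Y) (q : Y ⟶ Spec (.of K)) (V : Y.Opens) [IsIntegral X]

lemma germX_injective (hV : genericPoint X ∈ f ⁻¹ᵁ V) : Function.Injective (germX f q V hV) :=
  germ_injective_of_isIntegral X _ hV

lemma germX_resX {V W : Y.Opens} (h : W ≤ V) (hV : genericPoint X ∈ f ⁻¹ᵁ V)
    (hW : genericPoint X ∈ f ⁻¹ᵁ W) (b : SecX f q V) :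
    germX f q W hW (resX f q h b) = germX f q V hV b :=
  X.presheaf.germ_res_apply (homOfLE (f.preimage_mono h)) _ hW b

lemma isDomain_secX (hV : genericPoint X ∈ f ⁻¹ᵁ V) : IsDomain (SecX f q V) :=
  (germX_injective f q V hV).isDomain _

lemma isFractionRing_germX [IsFinite f] (hV : IsAffineOpen V) (hV' : genericPoint X ∈ f ⁻¹ᵁ V) :
    letI := (germX f q V hV').toAlgebra
    IsFractionRing (SecX f q V) X.functionField :=
  have : Nonempty (f ⁻¹ᵁ V : X.Opens) := ⟨⟨_, hV'⟩⟩
  functionField_isFractionRing_of_isAffineOpen X (f ⁻¹ᵁ V) (hV.preimage f)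

end

section

variable (f : X ⟶ Y) (q : Y ⟶ Spec (.of K)) (V : Y.Opens) [IsIntegral X] [IsIntegral Y]
  [Surjective f]

lemma genericPoint_mem_preimage (hV : genericPoint Y ∈ V) : genericPoint X ∈ f ⁻¹ᵁ V :=
  (genericPoint_specializes_of_surjective f).mem_open V.2 hV

lemma genericPoint_mem {y : Y} (hy : y ∈ V) : genericPoint Y ∈ V :=
  ((genericPoint_spec Y).specializes trivial).mem_open V.2 hy

/-- The map from functions on `V` to rational functions on `Y`. -/
noncomputable def germY (hV : genericPoint Y ∈ V) : SecY q V →+* Y.functionField :=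
  (Y.presheaf.germ V (genericPoint Y) hV).hom

lemma germY_injective (hV : genericPoint Y ∈ V) : Function.Injective (germY q V hV) :=
  germ_injective_of_isIntegral Y _ hV

lemma functionFieldMap_germY (hV : genericPoint Y ∈ V) (hV' : genericPoint X ∈ f ⁻¹ᵁ V)
    (a : SecY q V) : functionFieldMap f (germY q V hV a) =
      germX f q V hV' (algebraMap (SecY q V) (SecX f q V) a) := by
  have : Y.presheaf.germ V (genericPoint Y) hV ≫
      Y.presheaf.stalkSpecializes (genericPoint_specializes_of_surjective f) ≫
        f.stalkMap (genericPoint X) = f.app V ≫ X.presheaf.germ (f ⁻¹ᵁ V) (genericPoint X) hV' := by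
    rw [← Category.assoc, TopCat.Presheaf.germ_stalkSpecializes, Scheme.Hom.germ_stalkMap]
  exact congr($(this).hom a)

lemma germY_resY {V W : Y.Opens} (h : W ≤ V) (hV : genericPoint Y ∈ V)
    (hW : genericPoint Y ∈ W) (b : SecY q V) :
    germY q W hW (resY q h b) = germY q V hV b :=
  Y.presheaf.germ_res_apply (homOfLE h) _ hW b

lemma isDomain_secY (hV : genericPoint Y ∈ V) : IsDomain (SecY q V) :=
  (germY_injective q V hV).isDomain _

lemma faithfulSMul_secX (hV : genericPoint Y ∈ V) : FaithfulSMul (SecY q V) (SecX f q V) := by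
  rw [faithfulSMul_iff_algebraMap_injective]
  intro a b hab
  apply germY_injective q V hV
  apply (functionFieldMap f).injective
  rw [functionFieldMap_germY f q V hV (genericPoint_mem_preimage f V hV), hab,
    ← functionFieldMap_germY f q V hV]

lemma isFractionRing_germY (hV : IsAffineOpen V) (hV' : genericPoint Y ∈ V) :
    letI := (germY q V hV').toAlgebra
    IsFractionRing (SecY q V) Y.functionField :=
  have : Nonempty V := ⟨_, hV'⟩
  functionField_isFractionRing_of_isAffineOpen Y V hV

end

end RelOrient

/-! ### Restriction of relations to smaller affine subsets -/

namespace DetHom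

section

variable {n : ℕ} {K A B : Type u} [CommRing K] [CommRing A] [CommRing B] [Algebra K A]
  [Algebra K B] [Algebra A B] [IsScalarTower K A B]

lemma extMap_push_map_pull {C : Type u} [CommRing C] [Algebra K C] [Algebra A C] [Algebra B C]
    [IsScalarTower K B C] [IsScalarTower A B C] (d : ⋀[B]^n (Derivation K B B)) :
    extMap C n (push K A B C) (exteriorPower.map n (pull K A B B) d) =
      exteriorPower.map n (pull K A B C) (extMap C n (push K B B C) d) := by
  have : extMap C n (push K A B C) ∘ₗ exteriorPower.map n (pull K A B B) =
      (exteriorPower.map n (pull K A B C)).restrictScalars B ∘ₗ extMap C n (push K B B C) := by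
    apply exteriorPower.linearMap_ext
    ext1 v
    change extMap C n (push K A B C) (exteriorPower.map n (pull K A B B)
      (exteriorPower.ιMulti B n v)) = exteriorPower.map n (pull K A B C)
      (extMap C n (push K B B C) (exteriorPower.ιMulti B n v))
    rw [exteriorPower.map_apply_ιMulti, extMap_ιMulti, extMap_ιMulti,
      exteriorPower.map_apply_ιMulti]
    rfl
  exact congr($this d)

variable {A' B' : Type u} [CommRing A'] [CommRing B']
    [Algebra K A'] [Algebra K B'] [Algebra A' B'] [IsScalarTower K A' B'] {eA : A →ₐ[K] A'}
    {eB : B →ₐ[K] B'} {h : ∀ a, eB (algebraMap A B a) = algebraMap A' B' (eA a)}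

/-- The Jacobian is compatible with restriction. -/
lemma isRestriction_jacobian :
    IsRestriction eA eB h (jacobian n K A B) (jacobian n K A' B') := by
  let : Algebra A A' := eA.toRingHom.toAlgebra
  let : Algebra B B' := eB.toRingHom.toAlgebra
  let : Algebra A B' := (eB.toRingHom.comp (algebraMap A B)).toAlgebra
  have : IsScalarTower A B B' := .of_algebraMap_eq' rfl
  have : IsScalarTower A A' B' := .of_algebraMap_eq h
  have : IsScalarTower K A A' := .of_algebraMap_eq fun x => (eA.commutes x).symm
  have : IsScalarTower K B B' := .of_algebraMap_eq fun x => (eB.commutes x).symm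
  intro d d' hd
  change extMap B' n (push K A B B') (exteriorPower.map n (pull K A B B) d) =
    exteriorPower.map n (pull K A A' B') (exteriorPower.map n (pull K A' B' B') d')
  rw [extMap_push_map_pull, hd, ← LinearMap.comp_apply, ← LinearMap.comp_apply,
    ← exteriorPower.map_comp, ← exteriorPower.map_comp]
  congr 2
  ext D a
  exact congrArg D (h a)

end

/-- Proportionality in a fibre is unaffected by restriction. -/
lemma eqSMulAlong_restriction_iff {n : ℕ} {K A B A' B' : Type u} [Field K] [CommRing A]
    [CommRing B] [Algebra K A] [Algebra K B] [Algebra A B] [IsScalarTower K A B] [CommRing A']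
    [CommRing B'] [Algebra K A'] [Algebra K B'] [Algebra A' B'] [IsScalarTower K A' B']
    [IsDomain A] [IsDomain B] [IsDomain B'] [Algebra.Smooth K A] [Algebra.Smooth K B]
    (hnA : Module.finrank A Ω[A⁄K] = n) (hnB : Module.finrank B Ω[B⁄K] = n)
    {eA : A →ₐ[K] A'} {eB : B →ₐ[K] B'} (hA : eA.toRingHom.FormallyEtale)
    (hB : eB.toRingHom.FormallyEtale)
    {h : ∀ a, eB (algebraMap A B a) = algebraMap A' B' (eA a)} {φ₁ φ₂ : DetHom n K A B}
    {φ₁' φ₂' : DetHom n K A' B'} (h₁ : IsRestriction eA eB h φ₁ φ₁')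
    (h₂ : IsRestriction eA eB h φ₂ φ₂') {C : Type u} [Field C] (e : B' →+* C) (c : C) :
    EqSMulAlong (e.comp eB.toRingHom) c φ₁ φ₂ ↔ EqSMulAlong e c φ₁' φ₂' := by
  let : Algebra A A' := eA.toRingHom.toAlgebra
  let : Algebra B B' := eB.toRingHom.toAlgebra
  have : IsScalarTower K A A' := .of_algebraMap_eq fun x => (eA.commutes x).symm
  have : IsScalarTower K B B' := .of_algebraMap_eq fun x => (eB.commutes x).symm
  have : Algebra.FormallyEtale A A' := hA
  have : Algebra.FormallyEtale B B' := hB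
  let e' : B →+* C := e.comp eB.toRingHom
  obtain ⟨a, δ, r, hr, HA⟩ := exists_isFrame_algebraMap_ne_zero (K := K) hnA
    (e'.comp (algebraMap A B))
  obtain ⟨w, D, s, hs, HB⟩ := exists_isFrame_algebraMap_ne_zero (K := K) hnB e'
  obtain ⟨δ', -, HA'⟩ := HA.exists_extension (B' := A')
  obtain ⟨D', hD', HB'⟩ := HB.exists_extension (B' := B')
  rw [eqSMulAlong_iff HA HB e' hr hs, eqSMulAlong_iff HA' HB' e ?_ hs]
  · have h₃ := h₁.coord_eq a hD'
    have h₄ := h₂.coord_eq a hD'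
    change _ ↔ e (coord (fun i => eA (a i)) D' φ₁') = c * e (coord (fun i => eA (a i)) D' φ₂')
    rw [h₃, h₄]
    rfl
  · change e (algebraMap A' B' (eA r)) ≠ 0
    rw [← h]
    exact hr

end DetHom

namespace RelOrient

variable {K : Type u} [Field K] {X Y : Scheme.{u}}

section

variable (f : X ⟶ Y) (q : Y ⟶ Spec (.of K)) {V W : Y.Opens} (h : W ≤ V)

lemma formallyEtale_map {Z : Scheme.{u}} {U U' : Z.Opens} (hU : IsAffineOpen U)
    (hU' : IsAffineOpen U') (h : U' ≤ U) :
    (Z.presheaf.map (homOfLE h).op).hom.FormallyEtale := by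
  have h₁ := (𝟙 Z : Z ⟶ Z).etale_appLE hU hU' h
  have h₂ : (𝟙 Z : Z ⟶ Z).appLE U U' h = Z.presheaf.map (homOfLE h).op := by
    simp [Scheme.Hom.appLE]
    rfl
  rw [h₂] at h₁
  exact h₁.formallyEtale

lemma formallyEtale_resY (hV : IsAffineOpen V) (hW : IsAffineOpen W) :
    (resY q h).toRingHom.FormallyEtale :=
  formallyEtale_map hV hW h

lemma formallyEtale_resX [IsFinite f] (hV : IsAffineOpen V) (hW : IsAffineOpen W) :
    (resX f q h).toRingHom.FormallyEtale :=
  formallyEtale_map (hV.preimage f) (hW.preimage f) _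

end

lemma genericPoint_mem_of_ringHom {f : X ⟶ Y} {q : Y ⟶ Spec (.of K)} [IsIntegral X]
    (W : Y.Opens) {C : Type u} [Field C] (e : SecX f q W →+* C) : genericPoint X ∈ f ⁻¹ᵁ W := by
  by_contra hX
  have h₁ : f ⁻¹ᵁ W = ⊥ := by
    by_contra h₀
    obtain ⟨x, hx⟩ := (TopologicalSpace.Opens.ne_bot_iff_nonempty _).1 h₀
    exact hX (((genericPoint_spec X).specializes trivial).mem_open (f ⁻¹ᵁ W).2 hx)
  have h₂ : Subsingleton Γ(X, f ⁻¹ᵁ W) := by rw [h₁]; infer_instance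
  have h₃ : (1 : SecX f q W) = 0 := h₂.elim _ _
  have h₄ := congrArg e h₃
  rw [map_one, map_zero] at h₄
  exact one_ne_zero h₄

section

variable {f : X ⟶ Y} {q : Y ⟶ Spec (.of K)} {n : ℕ} {L : X.Modules}
  [IsIntegral X] [IsIntegral Y] [IsFinite f] [SmoothOfRelativeDimension n q]
  [SmoothOfRelativeDimension n (f ≫ q)] (ψ : RelativeOrientation f q n L)
  (V W : Y.affineOpens) (h : W.1 ≤ V.1) {C : Type u} [Field C] (e : SecX f q W →+* C) (c : C)

lemma eqSMulAlong_iff_of_le {φ₁ φ₂ : DetHom n K (SecY q V) (SecX f q V)}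
    {φ₁' φ₂' : DetHom n K (SecY q W) (SecX f q W)}
    (h₁ : DetHom.IsRestriction (resY q h) (resX f q h) (res_comm f q h) φ₁ φ₁')
    (h₂ : DetHom.IsRestriction (resY q h) (resX f q h) (res_comm f q h) φ₂ φ₂') :
    DetHom.EqSMulAlong (e.comp (resX f q h).toRingHom) c φ₁ φ₂ ↔
      DetHom.EqSMulAlong e c φ₁' φ₂' := by
  have hX := genericPoint_mem_of_ringHom W.1 e
  have hX' : genericPoint X ∈ f ⁻¹ᵁ V.1 := f.preimage_mono h hX
  have hY : genericPoint Y ∈ V.1 := genericPoint_mem V.1 hX'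
  have := isDomain_secX f q W.1 hX
  have := isDomain_secX f q V.1 hX'
  have := isDomain_secY q V.1 hY
  have := smooth_secY q V.2 n
  have := smooth_secX f q V.2 n
  exact DetHom.eqSMulAlong_restriction_iff (finrank_secY q V.2 n) (finrank_secX f q V.2 n)
    (formallyEtale_resY q h V.2 W.2) (formallyEtale_resX f q h V.2 W.2) h₁ h₂ e c

lemma eqSMulAlong_psi_jacobian_iff (s t : SecL f q L V) :
    DetHom.EqSMulAlong (e.comp (resX f q h).toRingHom) c (ψ.iso V (s ⊗ₜ t))
        (DetHom.jacobian n K (SecY q V) (SecX f q V)) ↔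
      DetHom.EqSMulAlong e c (ψ.iso W (resL f q L h s ⊗ₜ resL f q L h t))
        (DetHom.jacobian n K (SecY q W) (SecX f q W)) :=
  eqSMulAlong_iff_of_le V W h e c (ψ.compatible V W h s t) DetHom.isRestriction_jacobian

lemma eqSMulAlong_jacobian_psi_iff (s t : SecL f q L V) :
    DetHom.EqSMulAlong (e.comp (resX f q h).toRingHom) c
        (DetHom.jacobian n K (SecY q V) (SecX f q V)) (ψ.iso V (s ⊗ₜ t)) ↔
      DetHom.EqSMulAlong e c (DetHom.jacobian n K (SecY q W) (SecX f q W))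
        (ψ.iso W (resL f q L h s ⊗ₜ resL f q L h t)) :=
  eqSMulAlong_iff_of_le V W h e c DetHom.isRestriction_jacobian (ψ.compatible V W h s t)

end

/-- There are affine neighbourhoods over which `Ω` is free, with a frame of functions. -/
lemma exists_isFrame_of_mem (q : Y ⟶ Spec (.of K)) (n : ℕ) [IsIntegral Y]
    [SmoothOfRelativeDimension n q] (U : Y.Opens) {y : Y} (hy : y ∈ U) :
    ∃ W : Y.affineOpens, y ∈ W.1 ∧ W.1 ≤ U ∧
      ∃ (a : Fin n → SecY q W) (δ : Fin n → Derivation K (SecY q W) (SecY q W)) (h : SecY q W),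
        IsUnit h ∧ IsFrame K a δ h := by
  obtain ⟨_, ⟨V, hV, rfl⟩, hyV, hVU⟩ := Y.isBasis_affineOpens.exists_subset_of_mem_open hy U.2
  have := isDomain_secY q V (genericPoint_mem V hyV)
  have := smooth_secY q hV n
  obtain ⟨a, δ, h, hh, H⟩ := exists_isFrame_algebraMap_ne_zero (K := K) (finrank_secY q hV n)
    (show SecY q V →+* _ from (Y.evaluation V y hyV).hom)
  let h' : Γ(Y, V) := h
  have hle : Y.basicOpen h' ≤ V := Y.basicOpen_le h'
  let W : Y.affineOpens := ⟨Y.basicOpen h', hV.basicOpen h'⟩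
  refine ⟨W, (Y.evaluation_ne_zero_iff_mem_basicOpen y hyV h').1 hh, hle.trans hVU, ?_⟩
  let : Algebra (SecY q V) (SecY q W) := (resY q hle).toRingHom.toAlgebra
  have : IsScalarTower K (SecY q V) (SecY q W) :=
    .of_algebraMap_eq fun x => ((resY q hle).commutes x).symm
  have : Algebra.FormallyEtale (SecY q V) (SecY q W) := formallyEtale_resY q hle hV W.2
  obtain ⟨δ', -, H'⟩ := H.exists_extension (B' := SecY q W)
  exact ⟨_, δ', _, Y.toRingedSpace.isUnit_res_basicOpen h', H'⟩

end RelOrient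

/-! ### The trace form over a small affine subset -/

namespace DetHom

variable {n : ℕ} {K A B : Type u} [CommRing K] [CommRing A] [CommRing B] [Algebra K A]
  [Algebra K B] [Algebra A B] {C : Type u} [CommRing C]

lemma EqSMulAlong.add {e : B →+* C} {c c' : C} {φ φ' χ : DetHom n K A B}
    (h : EqSMulAlong e c φ χ) (h' : EqSMulAlong e c' φ' χ) :
    EqSMulAlong e (c + c') (φ + φ') χ := by
  let : Algebra B C := e.toAlgebra
  let : Algebra A C := (e.comp (algebraMap A B)).toAlgebra
  let : Algebra K C := (e.comp (algebraMap K B)).toAlgebra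
  have : IsScalarTower A B C := .of_algebraMap_eq' rfl
  have : IsScalarTower K B C := .of_algebraMap_eq' rfl
  change (φ + φ').baseChange C = (c + c') • χ.baseChange C
  rw [baseChange, LinearMap.comp_add, add_smul]
  exact congrArg₂ (· + ·) h h'

lemma EqSMulAlong.smul {e : B →+* C} {c : C} {φ χ : DetHom n K A B} (b : B)
    (h : EqSMulAlong e c φ χ) : EqSMulAlong e (e b * c) (b • φ) χ := by
  let : Algebra B C := e.toAlgebra
  let : Algebra A C := (e.comp (algebraMap A B)).toAlgebra
  let : Algebra K C := (e.comp (algebraMap K B)).toAlgebra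
  have : IsScalarTower A B C := .of_algebraMap_eq' rfl
  have : IsScalarTower K B C := .of_algebraMap_eq' rfl
  change (b • φ).baseChange C = (e b * c) • χ.baseChange C
  rw [baseChange, LinearMap.comp_smul, mul_smul]
  have h' : φ.baseChange C = c • χ.baseChange C := h
  rw [← h']
  refine LinearMap.ext fun x => ?_
  exact (algebraMap_smul C b _).symm

end DetHom

lemma finiteDimensional_fractionRing (A B LA LB : Type*) [CommRing A] [CommRing B] [Algebra A B]
    [IsDomain A] [IsDomain B] [FaithfulSMul A B] [Module.Finite A B] [Field LA] [Field LB]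
    [Algebra A LA] [IsFractionRing A LA] [Algebra B LB] [IsFractionRing B LB] [Algebra A LB]
    [IsScalarTower A B LB] [Algebra LA LB] [IsScalarTower A LA LB] : FiniteDimensional LA LB :=
  .equiv (Algebra.IsAlgebraic.isBaseChange_of_isFractionRing A B LA LB).equiv

lemma relativeOrientation_tmul_comm {n : ℕ} {K A B M ι : Type u} [Field K] [CommRing A]
    [CommRing B] [Algebra K A] [Algebra K B] [Algebra A B] [IsScalarTower K A B] [IsDomain A]
    [IsDomain B] [Algebra.Smooth K B] [FaithfulSMul A B] [Algebra.IsIntegral A B]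
    [AddCommGroup M] [Module A M] [Module B M] [IsScalarTower A B M]
    (hn : Module.finrank B Ω[B⁄K] = n)
    {a : Fin n → A} {δ : Fin n → Derivation K A A} {hA : A} (HA : IsFrame K a δ hA)
    (hhA : IsUnit hA) (ψ : M ⊗[B] M ≃ₗ[B] DetHom n K A B) (e : Module.Basis ι A M) (s t : M) :
    ψ (s ⊗ₜ t) = ψ (t ⊗ₜ s) := by
  have : Module.IsTorsionFree B M := isTorsionFree_of_basis e
  obtain ⟨u, D, h, hh, HB⟩ := exists_isFrame (K := K) hn (⊥ : Ideal B)
  rw [← sub_eq_zero]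
  refine DetHom.eq_zero_of_coord_eq_zero HA HB hhA hh ?_
  rw [map_sub, sub_eq_zero]
  exact pairing_comm (coordPairing_eq_zero ψ HA hhA HB hh) s t

section

variable {n : ℕ} {K A B M LA LB ι : Type u} [Field K] [CommRing A] [CommRing B] [Algebra K A]
  [Algebra K B] [Algebra A B] [IsScalarTower K A B] [IsDomain A] [IsDomain B]
  [Algebra.Smooth K B] [FaithfulSMul A B] [Module.Finite A B]
  [Field LA] [Field LB] [Algebra A LA] [IsFractionRing A LA] [Algebra B LB]
  [IsFractionRing B LB] [Algebra A LB] [IsScalarTower A B LB] [Algebra LA LB]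
  [IsScalarTower A LA LB] [Algebra.IsSeparable LA LB]
  [AddCommGroup M] [Module A M] [Module B M] [IsScalarTower A B M]

/-- The traces of the rational functions defined by `ψ (s ⊗ t)` are integral. -/
lemma trace_mem_range_of_relativeOrientation [Algebra.Smooth K A]
    (hn : Module.finrank B Ω[B⁄K] = n)
    {a : Fin n → A} {δ : Fin n → Derivation K A A} {hA : A} (HA : IsFrame K a δ hA)
    (hhA : IsUnit hA) (ψ : M ⊗[B] M ≃ₗ[B] DetHom n K A B) (e : Module.Basis ι A M) (s t : M)
    (w : LB) (hw : DetHom.EqSMulAlong (algebraMap B LB) w (ψ (s ⊗ₜ t))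
      (DetHom.jacobian n K A B)) :
    Algebra.trace LA LB w ∈ (algebraMap A LA).range := by
  have : FiniteDimensional LA LB := finiteDimensional_fractionRing A B LA LB
  have : Module.Projective A M := .of_basis e
  have : Module.Projective A B := projective_of_relativeOrientation hn HA hhA ψ
  exact trace_mem_range_of_eqSMulAlong hn HA hhA _ w hw

/-- The trace form is non-degenerate. -/
lemma exists_trace_ne_zero (hn : Module.finrank B Ω[B⁄K] = n)
    {a : Fin n → A} {δ : Fin n → Derivation K A A} {hA : A} (HA : IsFrame K a δ hA)
    (hhA : IsUnit hA) (ψ : M ⊗[B] M ≃ₗ[B] DetHom n K A B) (e : Module.Basis ι A M) (s : M)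
    (hs : s ≠ 0) :
    ∃ i, ∀ w : LB, DetHom.EqSMulAlong (algebraMap B LB) w (ψ (s ⊗ₜ e i))
      (DetHom.jacobian n K A B) → Algebra.trace LA LB w ≠ 0 := by
  have : FiniteDimensional LA LB := finiteDimensional_fractionRing A B LA LB
  have : Module.IsTorsionFree B M := isTorsionFree_of_basis e
  have : Nontrivial M := ⟨s, 0, hs⟩
  obtain ⟨u, D, h, hh, HB⟩ := exists_isFrame_algebraMap_ne_zero (K := K) hn (algebraMap B LB)
  have hh' : h ≠ 0 := fun h0 => hh (by rw [h0, map_zero])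
  have hj := coord_jacobian_ne_zero_of_isSeparable LA HA hhA HB hh
  let j : LB := algebraMap B LB (DetHom.coord a D (DetHom.jacobian n K A B))
  let θ : M →ₗ[B] LB := LinearMap.mulLeft B j⁻¹ ∘ₗ Algebra.linearMap B LB ∘ₗ coordPairing ψ a D s
  have hθ (m : M) : θ m = j⁻¹ * algebraMap B LB (coordPairing ψ a D s m) := rfl
  obtain ⟨b, hb⟩ := exists_basis_fractionRing (LA := LA) e θ (by
    rw [injective_iff_map_eq_zero]
    intro m hm
    rw [hθ, mul_eq_zero, or_iff_right (inv_ne_zero hj)] at hm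
    exact (coordPairing_eq_zero ψ HA hhA HB hh' s m
      (IsFractionRing.injective B LB (hm.trans (map_zero _).symm))).resolve_left hs)
  by_contra! H
  refine Algebra.trace_ne_zero LA LB (b.ext fun i => ?_)
  obtain ⟨w, hw, hw'⟩ := H i
  have h₁ : algebraMap B LB (coordPairing ψ a D s (e i)) = w * j :=
    coord_eq_mul_coord_jacobian HA hhA (algebraMap B LB) hw HB hh
  rw [hb, hθ, h₁, mul_comm w, inv_mul_cancel_left₀ hj, hw', LinearMap.zero_apply]

end

/-! ### The trace form on global sections -/

/-- A rational function which is regular near each point is a global function. -/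
lemma AlgebraicGeometry.Scheme.exists_germ_eq_of_forall {Y : Scheme.{u}} [IsIntegral Y]
    (τ : Y.functionField)
    (h : ∀ y : Y, ∃ (V : Y.Opens) (_ : y ∈ V) (hV : genericPoint Y ∈ V) (σ : Γ(Y, V)),
      Y.presheaf.germ V (genericPoint Y) hV σ = τ) :
    ∃ σ : Γ(Y, ⊤), Y.presheaf.germ ⊤ (genericPoint Y) trivial σ = τ := by
  choose V hy hV σ hσ using h
  have hcomp : TopCat.Presheaf.IsCompatible Y.presheaf V σ := by
    intro i j
    have hij : genericPoint Y ∈ V i ⊓ V j := ⟨hV i, hV j⟩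
    apply germ_injective_of_isIntegral Y (genericPoint Y) hij
    exact ((TopCat.Presheaf.germ_res_apply Y.presheaf _ _ hij (σ i)).trans (hσ i)).trans
      ((TopCat.Presheaf.germ_res_apply Y.presheaf _ _ hij (σ j)).trans (hσ j)).symm
  obtain ⟨σ', hσ', -⟩ := Y.sheaf.existsUnique_gluing' V ⊤ (fun i => homOfLE le_top)
    (fun y _ => TopologicalSpace.Opens.mem_iSup.2 ⟨y, hy y⟩) σ hcomp
  refine ⟨σ', ?_⟩
  rw [← hσ (genericPoint Y), ← hσ' (genericPoint Y)]
  exact (TopCat.Presheaf.germ_res_apply Y.presheaf (homOfLE le_top) _ (hV _) σ').symm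

namespace RelOrient

variable {K : Type u} [Field K] {X Y : Scheme.{u}} {f : X ⟶ Y} {q : Y ⟶ Spec (.of K)} {n : ℕ}
  {L : X.Modules} [IsIntegral X]

/-- The rational function `b` with `ψ (s ⊗ t) = b · det (Tf)`. -/
def IsRatio (ψ : RelativeOrientation f q n L) (s t : SecL f q L ⊤) (b : X.functionField) : Prop :=
  ∀ (V : Y.affineOpens) (hV : genericPoint X ∈ f ⁻¹ᵁ V.1),
    DetHom.EqSMulAlong (germX f q V hV) b
      (ψ.iso V (resL f q L le_top s ⊗ₜ resL f q L le_top t))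
      (DetHom.jacobian n K (SecY q V) (SecX f q V))

section

variable {ψ : RelativeOrientation f q n L}

lemma IsRatio.add {s s' t : SecL f q L ⊤} {b b' : X.functionField} (h : IsRatio ψ s t b)
    (h' : IsRatio ψ s' t b') : IsRatio ψ (s + s') t (b + b') := fun V hV => by
  rw [map_add, add_tmul, map_add]
  exact (h V hV).add (h' V hV)

lemma IsRatio.smul [IsIntegral Y] [Surjective f] {s t : SecL f q L ⊤} {b : X.functionField}
    (r : K) (h : IsRatio ψ s t b) :
    IsRatio ψ (r • s) t
      (functionFieldMap f (germY q ⊤ trivial (algebraMap K (SecY q ⊤) r)) * b) := fun V hV => by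
  have h₁ : resL f q L (le_top : V.1 ≤ ⊤) (r • s) =
      algebraMap (SecY q V) (SecX f q V) (algebraMap K (SecY q V) r) • resL f q L le_top s := by
    rw [← (resY q (le_top : V.1 ≤ ⊤)).commutes r, algebraMap_smul, ← resL_smul',
      algebraMap_smul]
  have hY := genericPoint_mem V.1 hV
  rw [h₁, ← germY_resY q (le_top : V.1 ≤ ⊤) trivial hY, functionFieldMap_germY f q V hY hV,
    (resY q (le_top : V.1 ≤ ⊤)).commutes, ← TensorProduct.smul_tmul', map_smul]
  exact (h V hV).smul _

end

variable [IsIntegral Y] [IsFinite f] [Surjective f] [SmoothOfRelativeDimension n q]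
  [SmoothOfRelativeDimension n (f ≫ q)] (ψ : RelativeOrientation f q n L)

section

variable (hsep : IsSeparableMorphism f)
  (V : Y.affineOpens) (hY : genericPoint Y ∈ V.1) (hX : genericPoint X ∈ f ⁻¹ᵁ V.1)
  {a : Fin n → SecY q V} {δ : Fin n → Derivation K (SecY q V) (SecY q V)} {h : SecY q V}
  (H : IsFrame K a δ h) (hh : IsUnit h) {ι : Type u}
  (e : Module.Basis ι (SecY q V) (SecL f q L V))

include hsep H hh e in
/-- The properties of the relative orientation and its trace form over a small affine subset. -/
lemma relativeOrientation_trace_of_isFrame :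
    letI := (functionFieldMap f).toAlgebra
    (∀ s t, ∃ w, DetHom.EqSMulAlong (germX f q V hX) w (ψ.iso V (s ⊗ₜ t))
      (DetHom.jacobian n K (SecY q V) (SecX f q V))) ∧
    (∀ s t w w', DetHom.EqSMulAlong (germX f q V hX) w (ψ.iso V (s ⊗ₜ t))
      (DetHom.jacobian n K (SecY q V) (SecX f q V)) →
      DetHom.EqSMulAlong (germX f q V hX) w' (ψ.iso V (s ⊗ₜ t))
      (DetHom.jacobian n K (SecY q V) (SecX f q V)) → w = w') ∧
    (∀ s t, ψ.iso V (s ⊗ₜ t) = ψ.iso V (t ⊗ₜ s)) ∧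
    (∀ s t w, DetHom.EqSMulAlong (germX f q V hX) w (ψ.iso V (s ⊗ₜ t))
      (DetHom.jacobian n K (SecY q V) (SecX f q V)) →
      Algebra.trace Y.functionField X.functionField w ∈ (germY q V hY).range) ∧
    ∀ s ≠ 0, ∃ i, ∀ w, DetHom.EqSMulAlong (germX f q V hX) w (ψ.iso V (s ⊗ₜ e i))
      (DetHom.jacobian n K (SecY q V) (SecX f q V)) →
      Algebra.trace Y.functionField X.functionField w ≠ 0 := by
  let : Algebra Y.functionField X.functionField := (functionFieldMap f).toAlgebra
  let : Algebra (SecY q V) Y.functionField := (germY q V hY).toAlgebra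
  let : Algebra (SecX f q V) X.functionField := (germX f q V hX).toAlgebra
  let : Algebra (SecY q V) X.functionField :=
    ((germX f q V hX).comp (algebraMap (SecY q V) (SecX f q V))).toAlgebra
  have : IsScalarTower (SecY q V) (SecX f q V) X.functionField := .of_algebraMap_eq' rfl
  have : IsScalarTower (SecY q V) Y.functionField X.functionField :=
    .of_algebraMap_eq fun x => (functionFieldMap_germY f q V hY hX x).symm
  have : IsFractionRing (SecY q V) Y.functionField := isFractionRing_germY q V V.2 hY
  have : IsFractionRing (SecX f q V) X.functionField := isFractionRing_germX f q V V.2 hX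
  have := isDomain_secX f q V.1 hX
  have := isDomain_secY q V.1 hY
  have := smooth_secY q V.2 n
  have := smooth_secX f q V.2 n
  have := faithfulSMul_secX f q V.1 hY
  have := finite_secX f q V.2
  have : Algebra.IsSeparable Y.functionField X.functionField := hsep
  have hn := finrank_secX f q V.2 n
  exact ⟨fun s t => exists_eqSMulAlong_jacobian Y.functionField hn H hh _,
    fun s t w w' => eq_of_eqSMulAlong_jacobian Y.functionField hn H hh _,
    fun s t => relativeOrientation_tmul_comm hn H hh (ψ.iso V) e s t,
    fun s t w => trace_mem_range_of_relativeOrientation hn H hh (ψ.iso V) e s t w,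
    fun s => exists_trace_ne_zero hn H hh (ψ.iso V) e s⟩

end

variable {ψ}

lemma isRatio_of_eqSMulAlong {s t : SecL f q L ⊤} {b : X.functionField} (V : Y.affineOpens)
    (hV : genericPoint X ∈ f ⁻¹ᵁ V.1)
    (h : DetHom.EqSMulAlong (germX f q V hV) b
      (ψ.iso V (resL f q L le_top s ⊗ₜ resL f q L le_top t))
      (DetHom.jacobian n K (SecY q V) (SecX f q V))) : IsRatio ψ s t b := by
  intro V' hV'
  obtain ⟨_, ⟨W, hW, rfl⟩, hyW, hWV⟩ := Y.isBasis_affineOpens.exists_subset_of_mem_open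
    (show genericPoint Y ∈ V.1 ⊓ V'.1 from
      ⟨genericPoint_mem V.1 hV, genericPoint_mem V'.1 hV'⟩) (V.1 ⊓ V'.1).2
  let W' : Y.affineOpens := ⟨W, hW⟩
  have hXW : genericPoint X ∈ f ⁻¹ᵁ W'.1 := genericPoint_mem_preimage f W hyW
  have key (U : Y.affineOpens) (hU : genericPoint X ∈ f ⁻¹ᵁ U.1) (hWU : W'.1 ≤ U.1) :
      DetHom.EqSMulAlong (germX f q U hU) b
        (ψ.iso U (resL f q L le_top s ⊗ₜ resL f q L le_top t))
        (DetHom.jacobian n K (SecY q U) (SecX f q U)) ↔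
      DetHom.EqSMulAlong (germX f q W' hXW) b
        (ψ.iso W' (resL f q L le_top s ⊗ₜ resL f q L le_top t))
        (DetHom.jacobian n K (SecY q W') (SecX f q W')) := by
    have h₁ := eqSMulAlong_psi_jacobian_iff ψ U W' hWU (germX f q W' hXW) b
      (resL f q L le_top s) (resL f q L le_top t)
    have h₂ : (germX f q W' hXW).comp (resX f q hWU).toRingHom = germX f q U hU :=
      RingHom.ext fun x => germX_resX f q hWU hU hXW x
    rw [resL_resL, resL_resL, h₂] at h₁
    exact h₁
  exact (key V' hV' fun x hx => (hWV hx).2).2 ((key V hV fun x hx => (hWV hx).1).1 h)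

section

variable (hsep : IsSeparableMorphism f) (hU : IsUlrich f L)
include hsep hU

variable (ψ) in
lemma exists_isRatio (s t : SecL f q L ⊤) : ∃ b, IsRatio ψ s t b := by
  obtain ⟨_, _, _, hs⟩ := exists_basis_of_isUlrich q hU
  obtain ⟨V, hV, -, a, δ, h, hh, H⟩ := exists_isFrame_of_mem q n ⊤ (y := genericPoint Y) trivial
  obtain ⟨e, -⟩ := hs V.1
  have hX := genericPoint_mem_preimage f V hV
  obtain ⟨h₁, -⟩ := relativeOrientation_trace_of_isFrame ψ hsep V hV hX H hh e
  obtain ⟨w, hw⟩ := h₁ (resL f q L le_top s) (resL f q L le_top t)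
  exact ⟨w, isRatio_of_eqSMulAlong V hX hw⟩

lemma IsRatio.eq {s t : SecL f q L ⊤} {b b' : X.functionField} (hb : IsRatio ψ s t b)
    (hb' : IsRatio ψ s t b') : b = b' := by
  obtain ⟨_, _, _, hs⟩ := exists_basis_of_isUlrich q hU
  obtain ⟨V, hV, -, a, δ, h, hh, H⟩ := exists_isFrame_of_mem q n ⊤ (y := genericPoint Y) trivial
  obtain ⟨e, -⟩ := hs V.1
  have hX := genericPoint_mem_preimage f V hV
  obtain ⟨-, h₁, -⟩ := relativeOrientation_trace_of_isFrame ψ hsep V hV hX H hh e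
  exact h₁ _ _ _ _ (hb V hX) (hb' V hX)

lemma IsRatio.symm {s t : SecL f q L ⊤} {b : X.functionField} (hb : IsRatio ψ s t b) :
    IsRatio ψ t s b := by
  obtain ⟨_, _, _, hs⟩ := exists_basis_of_isUlrich q hU
  obtain ⟨V, hV, -, a, δ, h, hh, H⟩ := exists_isFrame_of_mem q n ⊤ (y := genericPoint Y) trivial
  obtain ⟨e, -⟩ := hs V.1
  have hX := genericPoint_mem_preimage f V hV
  obtain ⟨-, -, h₁, -⟩ := relativeOrientation_trace_of_isFrame ψ hsep V hV hX H hh e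
  refine isRatio_of_eqSMulAlong V hX ?_
  rw [h₁]
  exact hb V hX

/-- The trace of `b` is a regular function. -/
lemma IsRatio.exists_germ_eq_trace {s t : SecL f q L ⊤} {b : X.functionField}
    (hb : IsRatio ψ s t b) :
    letI := (functionFieldMap f).toAlgebra
    ∃ σ : SecY q ⊤, germY q ⊤ trivial σ = Algebra.trace Y.functionField X.functionField b := by
  obtain ⟨_, _, _, hs⟩ := exists_basis_of_isUlrich q hU
  refine Scheme.exists_germ_eq_of_forall _ fun y => ?_
  obtain ⟨V, hV, -, a, δ, h, hh, H⟩ := exists_isFrame_of_mem q n ⊤ (y := y) trivial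
  obtain ⟨e, -⟩ := hs V.1
  have hY := genericPoint_mem V.1 hV
  have hX := genericPoint_mem_preimage f V hY
  obtain ⟨-, -, -, h₁, -⟩ := relativeOrientation_trace_of_isFrame ψ hsep V hY hX H hh e
  obtain ⟨σ, hσ⟩ := h₁ _ _ _ (hb V hX)
  exact ⟨V, hV, hY, σ, hσ⟩

lemma exists_isRatio_trace_ne_zero (s : SecL f q L ⊤) (hs0 : s ≠ 0) :
    letI := (functionFieldMap f).toAlgebra
    ∃ t, ∀ b, IsRatio ψ s t b → Algebra.trace Y.functionField X.functionField b ≠ 0 := by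
  obtain ⟨_, _, σ, hs⟩ := exists_basis_of_isUlrich q hU
  obtain ⟨V, hV, -, a, δ, h, hh, H⟩ := exists_isFrame_of_mem q n ⊤ (y := genericPoint Y) trivial
  obtain ⟨e, he⟩ := hs V.1
  obtain ⟨e₀, he₀⟩ := hs ⊤
  have hX := genericPoint_mem_preimage f V hV
  obtain ⟨-, -, -, -, h₁⟩ := relativeOrientation_trace_of_isFrame ψ hsep V hV hX H hh e
  have h₂ : resL f q L (le_top : V.1 ≤ ⊤) s ≠ 0 := by
    intro h0
    apply hs0
    have h₃ : ∑ i, resY q (le_top : V.1 ≤ ⊤) (e₀.repr s i) • e i = 0 := by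
      rw [← h0]
      conv_rhs => rw [← e₀.sum_repr s, map_sum]
      refine Finset.sum_congr rfl fun i _ => ?_
      rw [resL_smul', he₀, resL_resL, he]
    have h₄ := Fintype.linearIndependent_iff.1 e.linearIndependent _ h₃
    refine e₀.repr.injective (Finsupp.ext fun i => ?_)
    rw [map_zero]
    apply germY_injective q ⊤ trivial
    rw [← germY_resY q (le_top : V.1 ≤ ⊤) trivial hV, h₄, Finsupp.zero_apply, map_zero, map_zero]
  obtain ⟨i, hi⟩ := h₁ _ h₂
  refine ⟨σ i, fun b hb => hi b ?_⟩
  rw [he]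
  exact hb V hX

end

end RelOrient

namespace RelOrient

variable {K : Type u} [Field K] {X Y : Scheme.{u}} {f : X ⟶ Y} {q : Y ⟶ Spec (.of K)} {n : ℕ}
  {L : X.Modules}

lemma exists_basis_secL (hU : IsUlrich f L) (hK : Function.Bijective (scalars q ⊤)) :
    ∃ (t : ℕ) (_ : 0 < t) (b : Module.Basis (ULift.{u} (Fin t)) K (SecL f q L ⊤)),
      ∀ V : Y.Opens, ∃ e : Module.Basis (ULift (Fin t)) (SecY q V) (SecL f q L V),
        ∀ i, e i = resL f q L le_top (b i) := by
  obtain ⟨t, ht, s, hs⟩ := exists_basis_of_isUlrich q hU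
  obtain ⟨e, he⟩ := hs ⊤
  let φ : K ≃+* SecY q ⊤ := RingEquiv.ofBijective (algebraMap K (SecY q ⊤)) hK
  let b : Module.Basis (ULift.{u} (Fin t)) K (SecL f q L ⊤) :=
    e.mapCoeffs φ.symm fun c x => by
      rw [← algebraMap_smul (SecY q ⊤)]
      congr 1
      exact φ.apply_symm_apply c
  refine ⟨t, ht, b, fun V => ?_⟩
  obtain ⟨e', he'⟩ := hs V
  refine ⟨e', fun i => ?_⟩
  rw [he', Module.Basis.mapCoeffs_apply, he, resL_resL]

variable [IsIntegral X] [IsIntegral Y] [IsFinite f] [Surjective f]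
  [SmoothOfRelativeDimension n q] [SmoothOfRelativeDimension n (f ≫ q)]
  {ψ : RelativeOrientation f q n L}

lemma germY_algebraMap_injective :
    Function.Injective fun k : K => germY q ⊤ trivial (algebraMap K (SecY q ⊤) k) :=
  ((germY q ⊤ (genericPoint_mem (y := genericPoint Y) ⊤ trivial)).comp
    (algebraMap K (SecY q ⊤))).injective

section

variable (hsep : IsSeparableMorphism f) (hU : IsUlrich f L)
include hsep hU

/-- The value of a trace form is the trace of any function representing `ψ (s ⊗ t)`. -/
lemma IsTraceForm.germY_eq {β : LinearMap.BilinForm K (SecL f q L ⊤)} (hβ : IsTraceForm ψ β)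
    {s t : SecL f q L ⊤} {b : X.functionField} (hb : IsRatio ψ s t b) :
    letI := (functionFieldMap f).toAlgebra
    germY q ⊤ trivial (algebraMap K (SecY q ⊤) (β s t)) =
      Algebra.trace Y.functionField X.functionField b := by
  obtain ⟨b', hb', h⟩ := hβ s t
  have hb'' : IsRatio ψ s t b' := hb'
  rw [hb.eq hsep hU hb'']
  exact h

lemma IsTraceForm.isSymm {β : LinearMap.BilinForm K (SecL f q L ⊤)} (hβ : IsTraceForm ψ β) :
    β.IsSymm := by
  refine ⟨fun s t => ?_⟩
  obtain ⟨b, hb⟩ := exists_isRatio ψ hsep hU s t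
  apply germY_algebraMap_injective (q := q)
  exact (hβ.germY_eq hsep hU hb).trans (hβ.germY_eq hsep hU (hb.symm hsep hU)).symm

lemma IsTraceForm.nondegenerate {β : LinearMap.BilinForm K (SecL f q L ⊤)}
    (hβ : IsTraceForm ψ β) : β.Nondegenerate := by
  have hl : β.SeparatingLeft := by
    intro s hs
    by_contra hs0
    obtain ⟨t, ht⟩ := exists_isRatio_trace_ne_zero (ψ := ψ) hsep hU s hs0
    obtain ⟨b, hb⟩ := exists_isRatio ψ hsep hU s t
    apply ht b hb
    rw [← hβ.germY_eq hsep hU hb, hs, map_zero, map_zero]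
  refine ⟨hl, fun t ht => hl t fun s => ?_⟩
  rw [← (hβ.isSymm hsep hU).eq]
  exact ht s

lemma existsUnique_isTraceForm (hK : Function.Bijective (scalars q ⊤)) :
    ∃! β : LinearMap.BilinForm K (SecL f q L ⊤), IsTraceForm ψ β := by
  let : Algebra Y.functionField X.functionField := (functionFieldMap f).toAlgebra
  let Tr := Algebra.trace Y.functionField X.functionField
  have h₁ (s t : SecL f q L ⊤) : ∃ k : K, ∃ b, IsRatio ψ s t b ∧
      germY q ⊤ trivial (algebraMap K (SecY q ⊤) k) = Tr b := by
    obtain ⟨b, hb⟩ := exists_isRatio ψ hsep hU s t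
    obtain ⟨σ, hσ⟩ := hb.exists_germ_eq_trace hsep hU
    obtain ⟨k, rfl⟩ := hK.2 σ
    exact ⟨k, b, hb, hσ⟩
  choose β hβ using h₁
  have hβ' (s t : SecL f q L ⊤) (b) (hb : IsRatio ψ s t b) :
      germY q ⊤ trivial (algebraMap K (SecY q ⊤) (β s t)) = Tr b := by
    obtain ⟨b', hb', h⟩ := hβ s t
    rw [hb.eq hsep hU hb', h]
  have hcomm (s t) : β s t = β t s := by
    obtain ⟨b, hb, h⟩ := hβ s t
    apply germY_algebraMap_injective (q := q)
    exact h.trans (hβ' t s b (hb.symm hsep hU)).symm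
  have hadd (s s' t) : β (s + s') t = β s t + β s' t := by
    obtain ⟨b, hb, h⟩ := hβ s t
    obtain ⟨b', hb', h'⟩ := hβ s' t
    apply germY_algebraMap_injective (q := q)
    refine (hβ' _ t _ (hb.add hb')).trans ?_
    dsimp only
    rw [map_add, map_add, map_add, h, h']
  have hsmul (r : K) (s t) : β (r • s) t = r • β s t := by
    obtain ⟨b, hb, h⟩ := hβ s t
    apply germY_algebraMap_injective (q := q)
    refine (hβ' _ t _ (hb.smul r)).trans ?_
    have h₁ : germY q ⊤ trivial (algebraMap K (SecY q ⊤) (r * β s t)) =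
        germY q ⊤ trivial (algebraMap K (SecY q ⊤) r) * Tr b := by
      rw [map_mul, map_mul, h]
    exact ((congrArg Tr (Algebra.smul_def _ _).symm).trans (map_smul Tr _ _)).trans h₁.symm
  let B : LinearMap.BilinForm K (SecL f q L ⊤) := LinearMap.mk₂ K β hadd hsmul
    (fun s t t' => by rw [hcomm, hadd, hcomm t, hcomm t'])
    (fun r s t => by rw [hcomm, hsmul, hcomm t])
  have hB : IsTraceForm ψ B := hβ
  refine ⟨B, hB, fun B' hB' => ?_⟩
  ext s t
  obtain ⟨b, hb⟩ := exists_isRatio ψ hsep hU s t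
  apply germY_algebraMap_injective (q := q)
  exact (hB'.germY_eq hsep hU hb).trans (hB.germY_eq hsep hU hb).symm

end

end RelOrient

/-! ### Unramified points -/

section

variable {A B R S : Type u} [CommRing A] [CommRing B] [CommRing R] [CommRing S] [Algebra A B]
  [Algebra A R] [Algebra B S] [Algebra R S] [Algebra A S] [IsScalarTower A B S]
  [IsScalarTower A R S] [IsLocalRing R] [IsLocalRing S]

lemma surjective_algebraMap_residueField (p : Ideal A) [p.IsMaximal]
    [IsLocalization.AtPrime R p] :
    Function.Surjective ((IsLocalRing.residue R).comp (algebraMap A R)) := by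
  intro z
  obtain ⟨z, rfl⟩ := IsLocalRing.residue_surjective z
  obtain ⟨a, s, rfl⟩ := IsLocalization.exists_mk'_eq p.primeCompl z
  obtain ⟨t, i, hi, ht⟩ := Ideal.IsMaximal.exists_inv (inferInstance : p.IsMaximal) s.2
  have h₁ : IsLocalRing.residue R (algebraMap A R i) = 0 := by
    rw [IsLocalRing.residue_eq_zero_iff]
    exact (IsLocalization.AtPrime.to_map_mem_maximal_iff R p i).2 hi
  have h₂ : IsLocalRing.residue R (algebraMap A R t) *
      IsLocalRing.residue R (algebraMap A R s) = 1 := by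
    have := congrArg (fun x => IsLocalRing.residue R (algebraMap A R x)) ht
    simpa [h₁] using this
  refine ⟨a * t, ?_⟩
  have h₃ := congrArg (IsLocalRing.residue R) (IsLocalization.mk'_spec R a s)
  rw [map_mul] at h₃
  rw [RingHom.comp_apply, map_mul, map_mul, ← h₃, mul_assoc, mul_comm _ (IsLocalRing.residue R
    (algebraMap A R t)), h₂, mul_one]

/-- Near a point `m` over `p` where `f` is unramified, `m` is generated by `p`. -/
lemma exists_notMem_forall_mul_mem_map [IsLocalHom (algebraMap R S)]
    [Algebra.FormallyUnramified R S] [Algebra.EssFiniteType R S] [IsNoetherianRing B]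
    (p : Ideal A) (m : Ideal B) [p.IsPrime] [m.IsPrime] [IsLocalization.AtPrime R p]
    [IsLocalization.AtPrime S m] :
    ∃ r, r ∉ m ∧ ∀ z ∈ m, r * z ∈ p.map (algebraMap A B) := by
  have h₁ (z : B) (hz : z ∈ m) : ∃ r, r ∉ m ∧ r * z ∈ p.map (algebraMap A B) := by
    have h₂ : algebraMap B S z ∈ (p.map (algebraMap A B)).map (algebraMap B S) := by
      rw [Ideal.map_map, ← IsScalarTower.algebraMap_eq, IsScalarTower.algebraMap_eq A R S,
        ← Ideal.map_map, IsLocalization.AtPrime.map_eq_maximalIdeal p R,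
        Algebra.FormallyUnramified.map_maximalIdeal]
      exact (IsLocalization.AtPrime.to_map_mem_maximal_iff S m z).2 hz
    obtain ⟨r, hr, hrz⟩ := (IsLocalization.algebraMap_mem_map_algebraMap_iff m.primeCompl S _ _).1 h₂
    exact ⟨r, hr, hrz⟩
  choose! ρ hρ hρ' using h₁
  obtain ⟨s, hs⟩ := (isNoetherianRing_iff_ideal_fg B).1 inferInstance m
  have hsm (z) (hz : z ∈ s) : z ∈ m := hs ▸ Submodule.subset_span hz
  refine ⟨∏ z ∈ s, ρ z, m.primeCompl.prod_mem fun z hz => hρ z (hsm z hz), fun z hz => ?_⟩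
  rw [← hs] at hz
  induction hz using Submodule.span_induction with
  | mem z hz =>
    obtain ⟨c, hc⟩ := Finset.dvd_prod_of_mem ρ hz
    rw [hc, mul_comm (ρ z), mul_assoc]
    exact Ideal.mul_mem_left _ _ (hρ' z (hsm z hz))
  | zero => rw [mul_zero]; exact zero_mem _
  | add x y _ _ hx hy => rw [mul_add]; exact add_mem hx hy
  | smul c x _ hx => rw [smul_eq_mul, mul_left_comm]; exact Ideal.mul_mem_left _ _ hx

lemma finiteDimensional_and_isSeparable_of_surjective {R S k κ : Type u} [CommRing R] [CommRing S]
    [Algebra R S] [Algebra.FormallyUnramified R S] [Algebra.EssFiniteType R S] [Field k] [Field κ]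
    [Algebra k κ] [Algebra R k] [Algebra S κ] [Algebra R κ] [IsScalarTower R S κ]
    [IsScalarTower R k κ] (h : Function.Surjective (algebraMap S κ)) :
    FiniteDimensional k κ ∧ Algebra.IsSeparable k κ := by
  have : Algebra.FormallyUnramified S κ := .of_surjective (Algebra.ofId S κ) h
  have : Algebra.FormallyUnramified R κ := .comp R S κ
  have : Algebra.FormallyUnramified k κ := .of_restrictScalars R k κ
  have : Algebra.FiniteType S κ := .of_surjective (Algebra.ofId S κ) h
  have : Algebra.EssFiniteType R κ := .comp R S κ
  have : Algebra.EssFiniteType k κ := .of_comp R k κ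
  exact ⟨Algebra.FormallyUnramified.finite_of_free _ _, Algebra.FormallyUnramified.isSeparable _ _⟩

end

namespace AlgebraicGeometry.IsAffineOpen

variable {X : Scheme.{u}} {U : X.Opens} (hU : IsAffineOpen U)

lemma ker_evaluation {x : X} (hx : x ∈ U) :
    RingHom.ker (X.evaluation U x hx).hom = (hU.primeIdealOf ⟨x, hx⟩).asIdeal := by
  rw [hU.primeIdealOf_eq_map_closedPoint]
  ext b
  exact IsLocalRing.residue_eq_zero_iff _

lemma evaluation_surjective {x : X} (hx : x ∈ U)
    [(hU.primeIdealOf ⟨x, hx⟩).asIdeal.IsMaximal] :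
    Function.Surjective (X.evaluation U x hx).hom := by
  let : Algebra Γ(X, U) (X.presheaf.stalk x) := X.presheaf.algebra_section_stalk ⟨x, hx⟩
  have : IsLocalization.AtPrime (X.presheaf.stalk x) (hU.primeIdealOf ⟨x, hx⟩).asIdeal :=
    hU.isLocalization_stalk ⟨x, hx⟩
  exact surjective_algebraMap_residueField (hU.primeIdealOf ⟨x, hx⟩).asIdeal

lemma primeIdealOf_injective {x x' : U} (h : hU.primeIdealOf x = hU.primeIdealOf x') : x = x' := by
  apply Subtype.ext
  rw [← hU.fromSpec_primeIdealOf x, h, hU.fromSpec_primeIdealOf]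

lemma exists_primeIdealOf_eq (p : Spec Γ(X, U)) : ∃ x : U, hU.primeIdealOf x = p :=
  ⟨hU.isoSpec.inv p, by
    change hU.isoSpec.hom (hU.isoSpec.inv p) = p
    rw [← Scheme.Hom.comp_apply, Iso.inv_hom_id]
    rfl⟩

end AlgebraicGeometry.IsAffineOpen

namespace RelOrient

variable {K : Type u} [Field K] {X Y : Scheme.{u}} {f : X ⟶ Y} (q : Y ⟶ Spec (.of K))

/-- Evaluation of functions on `Y` at a point `y`. -/
noncomputable def evalY (V : Y.Opens) (y : Y) (hy : y ∈ V) : SecY q V →+* Y.residueField y :=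
  (Y.evaluation V y hy).hom

lemma residueMap_evalY (V : Y.Opens) {x : X} {y : Y} (h : f x = y) (hy : y ∈ V)
    (hx : x ∈ f ⁻¹ᵁ V) (a : SecY q V) : residueMap f h (evalY q V y hy a) =
      evalX f q V x hx (algebraMap (SecY q V) (SecX f q V) a) := by
  subst h
  rw [residueMap, Scheme.residueFieldCongr_refl]
  exact Scheme.evaluation_naturality_apply f x hy a

lemma comap_ker_evalX (V : Y.Opens) {x : X} {y : Y} (h : f x = y) (hy : y ∈ V)
    (hx : x ∈ f ⁻¹ᵁ V) : (RingHom.ker (evalX f q V x hx)).comap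
      (algebraMap (SecY q V) (SecX f q V)) = RingHom.ker (evalY q V y hy) := by
  ext a
  rw [Ideal.mem_comap, RingHom.mem_ker, RingHom.mem_ker, ← residueMap_evalY q V h hy hx,
    map_eq_zero]

lemma evalY_surjective {V : Y.Opens} (hV : IsAffineOpen V) {y : Y} (hy : y ∈ V)
    (hcl : IsClosed {y}) : Function.Surjective (evalY q V y hy) := by
  have := hV.primeIdealOf_isMaximal_of_isClosed ⟨y, hy⟩ hcl
  exact hV.evaluation_surjective hy

lemma scalarsResidue_eq (V : Y.Opens) {y : Y} (hy : y ∈ V) (k : K) :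
    scalarsResidue q y k = evalY q V y hy (algebraMap K (SecY q V) k) := by
  change Y.evaluation ⊤ y trivial (scalars q ⊤ k) = _
  rw [← (resY q (le_top : V ≤ ⊤)).commutes k]
  exact congrArg (Y.residue y) (Y.presheaf.germ_res_apply (homOfLE le_top) y hy
    (scalars q ⊤ k)).symm

variable [IsFinite f]

lemma evalX_surjective {V : Y.Opens} (hV : IsAffineOpen V) {x : X} {y : Y} (h : f x = y)
    (hy : y ∈ V) (hx : x ∈ f ⁻¹ᵁ V) (hcl : IsClosed {y}) :
    Function.Surjective (evalX f q V x hx) := by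
  have := finite_secX f q hV
  have h₁ := comap_ker_evalX q V h hy hx
  have h₂ : ((RingHom.ker (evalX f q V x hx)).comap
      (algebraMap (SecY q V) (SecX f q V))).IsMaximal := by
    rw [h₁]
    exact RingHom.ker_isMaximal_of_surjective _ (evalY_surjective q hV hy hcl)
  have : (RingHom.ker (evalX f q V x hx)).IsPrime := RingHom.ker_isPrime _
  have h₃ := Ideal.isMaximal_of_isIntegral_of_isMaximal_comap (RingHom.ker (evalX f q V x hx)) h₂
  have : ((hV.preimage f).primeIdealOf ⟨x, hx⟩).asIdeal.IsMaximal := by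
    rw [← (hV.preimage f).ker_evaluation]
    exact h₃
  exact (hV.preimage f).evaluation_surjective hx

lemma ker_evalX_injective {V : Y.Opens} (hV : IsAffineOpen V) {x x' : X} (hx : x ∈ f ⁻¹ᵁ V)
    (hx' : x' ∈ f ⁻¹ᵁ V) (h : RingHom.ker (evalX f q V x hx) = RingHom.ker (evalX f q V x' hx')) :
    x = x' := by
  refine congrArg Subtype.val ((hV.preimage f).primeIdealOf_injective
    (x := ⟨x, hx⟩) (x' := ⟨x', hx'⟩) (PrimeSpectrum.ext ?_))
  rw [← (hV.preimage f).ker_evaluation, ← (hV.preimage f).ker_evaluation]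
  exact h

lemma exists_ker_evalX_eq {V : Y.Opens} (hV : IsAffineOpen V) {y : Y} (hy : y ∈ V)
    (P : Ideal (SecX f q V)) (hP : P.IsPrime)
    (h : P.comap (algebraMap (SecY q V) (SecX f q V)) = RingHom.ker (evalY q V y hy)) :
    ∃ (x : X) (hx : x ∈ f ⁻¹ᵁ V), f x = y ∧ P = RingHom.ker (evalX f q V x hx) := by
  obtain ⟨⟨x, hx⟩, hxP⟩ := (hV.preimage f).exists_primeIdealOf_eq ⟨P, hP⟩
  have h₁ : RingHom.ker (evalX f q V x hx) = P :=
    ((hV.preimage f).ker_evaluation hx).trans (congrArg PrimeSpectrum.asIdeal hxP)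
  refine ⟨x, hx, ?_, h₁.symm⟩
  have h₂ := comap_ker_evalX q V rfl hx hx
  rw [h₁, h] at h₂
  refine congrArg Subtype.val (hV.primeIdealOf_injective
    (x := ⟨f x, hx⟩) (x' := ⟨y, hy⟩) (PrimeSpectrum.ext ?_))
  exact (hV.ker_evaluation (x := f x) hx).symm.trans (h₂.symm.trans (hV.ker_evaluation hy))

/-- The properties of a point where `f` is unramified. -/
lemma unramified_point {V : Y.Opens} (hV : IsAffineOpen V) [IsNoetherianRing (SecX f q V)]
    {x : X} {y : Y} (h : f x = y)
    (hy : y ∈ V) (hx : x ∈ f ⁻¹ᵁ V) (hf : (f.stalkMap x).hom.FormallyUnramified) :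
    letI := (residueMap f h).toAlgebra
    letI := (evalX f q V x hx).toAlgebra
    letI := ((evalX f q V x hx).comp (algebraMap (SecY q V) (SecX f q V))).toAlgebra
    (FiniteDimensional (Y.residueField y) (X.residueField x) ∧
    Algebra.IsSeparable (Y.residueField y) (X.residueField x)) ∧
    (∀ d : Derivation (SecY q V) (SecX f q V) (X.residueField x), d = 0) ∧
    ∃ r, evalX f q V x hx r ≠ 0 ∧ ∀ z, evalX f q V x hx z = 0 →
      r * z ∈ (RingHom.ker (evalY q V y hy)).map (algebraMap (SecY q V) (SecX f q V)) := by
  subst h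
  have := finite_secX f q hV
  let R := Y.presheaf.stalk (f x)
  let S := X.presheaf.stalk x
  let : Algebra R S := (f.stalkMap x).hom.toAlgebra
  let : Algebra (SecY q V) R := (Y.presheaf.germ V (f x) hy).hom.toAlgebra
  let : Algebra (SecX f q V) S := (X.presheaf.germ (f ⁻¹ᵁ V) x hx).hom.toAlgebra
  let : Algebra (SecY q V) S :=
    ((X.presheaf.germ (f ⁻¹ᵁ V) x hx).hom.comp (algebraMap (SecY q V) (SecX f q V))).toAlgebra
  have : IsScalarTower (SecY q V) (SecX f q V) S := .of_algebraMap_eq' rfl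
  have : IsScalarTower (SecY q V) R S :=
    .of_algebraMap_eq fun a => (Scheme.Hom.germ_stalkMap_apply f V x hx a).symm
  have : IsLocalHom (algebraMap R S) := inferInstanceAs (IsLocalHom (f.stalkMap x).hom)
  have : Algebra.FormallyUnramified R S := hf
  let p := RingHom.ker (evalY q V (f x) hy)
  let m := RingHom.ker (evalX f q V x hx)
  have hp : p = (hV.primeIdealOf ⟨f x, hy⟩).asIdeal := hV.ker_evaluation hy
  have hm : m = ((hV.preimage f).primeIdealOf ⟨x, hx⟩).asIdeal := (hV.preimage f).ker_evaluation hx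
  have : p.IsPrime := RingHom.ker_isPrime _
  have : m.IsPrime := RingHom.ker_isPrime _
  have : IsLocalization.AtPrime R p := by
    have h₁ := hV.isLocalization_stalk ⟨f x, hy⟩
    simp only [hp]
    exact h₁
  have : IsLocalization.AtPrime S m := by
    have h₁ := (hV.preimage f).isLocalization_stalk ⟨x, hx⟩
    simp only [hm]
    exact h₁
  have : Algebra.FormallyUnramified (SecY q V) R := .of_isLocalization p.primeCompl
  have : Algebra.FormallyUnramified (SecY q V) S := .comp _ R S
  have : Algebra.EssFiniteType (SecX f q V) S := .of_isLocalization S m.primeCompl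
  have : Algebra.EssFiniteType (SecY q V) S := .comp _ (SecX f q V) S
  have : Algebra.EssFiniteType R S := .of_comp (SecY q V) R S
  refine ⟨?_, ?_, exists_notMem_forall_mul_mem_map (R := R) (S := S) p m⟩
  · let : Algebra (Y.residueField (f x)) (X.residueField x) :=
      (residueMap f (rfl : f x = f x)).toAlgebra
    let : Algebra R (Y.residueField (f x)) := (Y.residue (f x)).hom.toAlgebra
    let : Algebra S (X.residueField x) := (X.residue x).hom.toAlgebra
    let : Algebra R (X.residueField x) :=
      ((X.residue x).hom.comp (algebraMap R S)).toAlgebra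
    have : IsScalarTower R S (X.residueField x) := .of_algebraMap_eq' rfl
    have : IsScalarTower R (Y.residueField (f x)) (X.residueField x) :=
      .of_algebraMap_eq fun r => by
        change X.residue x (f.stalkMap x r) = residueMap f rfl (Y.residue (f x) r)
        rw [residueMap, Scheme.residueFieldCongr_refl]
        exact congr($(Scheme.residue_residueFieldMap f x) r).symm
    exact finiteDimensional_and_isSeparable_of_surjective (R := R) (S := S)
      (X.residue_surjective x)
  · let : Algebra (SecX f q V) (X.residueField x) := (evalX f q V x hx).toAlgebra
    let : Algebra (SecY q V) (X.residueField x) :=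
      ((evalX f q V x hx).comp (algebraMap (SecY q V) (SecX f q V))).toAlgebra
    let : Algebra S (X.residueField x) := (X.residue x).hom.toAlgebra
    have : IsScalarTower (SecX f q V) S (X.residueField x) := .of_algebraMap_eq' rfl
    have : IsScalarTower (SecY q V) S (X.residueField x) := .of_algebraMap_eq' rfl
    have : IsScalarTower (SecY q V) (SecX f q V) (X.residueField x) := .of_algebraMap_eq' rfl
    exact fun d => d.eq_zero_of_formallyUnramified S m.primeCompl

end RelOrient

/-! ### The Jacobian at a point of the fibre -/

section

variable {n : ℕ} {K A B M C : Type u} [Field K] [CommRing A] [CommRing B] [Algebra K A]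
  [Algebra K B] [Algebra A B] [IsScalarTower K A B] [IsDomain B] [Algebra.Smooth K B]
  [AddCommGroup M] [Module B M] [Field C]

/-- Near each point, `ψ (t ⊗ t)` generates for some `t`. -/
lemma exists_eqSMulAlong_jacobian_tmul_self [Module.IsTorsionFree B M]
    (hn : Module.finrank B Ω[B⁄K] = n) {a : Fin n → A} {δ : Fin n → Derivation K A A} {hA : A}
    (HA : IsFrame K a δ hA) (hhA : IsUnit hA) (ψ : M ⊗[B] M ≃ₗ[B] DetHom n K A B) (e : B →+* C) :
    ∃ (t : M) (g : C), DetHom.EqSMulAlong e g (DetHom.jacobian n K A B) (ψ (t ⊗ₜ t)) := by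
  obtain ⟨u, D, h, hh, HB⟩ := exists_isFrame_algebraMap_ne_zero (K := K) hn e
  have hh0 : h ≠ 0 := fun h0 => hh (by rw [h0, map_zero])
  have : (RingHom.ker e).IsPrime := RingHom.ker_isPrime e
  obtain ⟨s, t, hst⟩ := exists_coordPairing_notMem ψ HA hhA HB (RingHom.ker e) hh
  have h₁ := pairing_mul_pairing (coordPairing_eq_zero ψ HA hhA HB hh0) s s t
  have h₂ : e (coordPairing ψ a D t t) ≠ 0 := by
    intro h0
    have h₃ := congrArg e h₁
    rw [map_mul, h0, zero_mul, map_mul] at h₃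
    exact mul_self_ne_zero.2 hst h₃.symm
  refine ⟨t, e (DetHom.coord a D (DetHom.jacobian n K A B)) / e (coordPairing ψ a D t t), ?_⟩
  rw [DetHom.eqSMulAlong_iff HA HB e ((hhA.map (algebraMap A B)).map e).ne_zero hh]
  exact (div_mul_cancel₀ _ h₂).symm

/-- Replacing coefficients by others with the same values at a point does not change the value
of `ψ (t ⊗ t)` at that point. -/
lemma eqSMulAlong_tmul_self_congr [Module A M] [IsScalarTower A B M]
    (hn : Module.finrank B Ω[B⁄K] = n) {a : Fin n → A} {δ : Fin n → Derivation K A A} {hA : A}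
    (HA : IsFrame K a δ hA) (hhA : IsUnit hA) (ψ : M ⊗[B] M ≃ₗ[B] DetHom n K A B) (e : B →+* C)
    {ι : Type*} [Fintype ι] (m : ι → M) (α α' : ι → A)
    (h : ∀ i, e (algebraMap A B (α i)) = e (algebraMap A B (α' i))) (g : C)
    (φ : DetHom n K A B)
    (hg : DetHom.EqSMulAlong e g φ (ψ ((∑ i, α i • m i) ⊗ₜ (∑ i, α i • m i)))) :
    DetHom.EqSMulAlong e g φ (ψ ((∑ i, α' i • m i) ⊗ₜ (∑ i, α' i • m i))) := by
  obtain ⟨u, D, r, hr, HB⟩ := exists_isFrame_algebraMap_ne_zero (K := K) hn e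
  have hA' := ((hhA.map (algebraMap A B)).map e).ne_zero
  have h₁ (α : ι → A) : e (coordPairing ψ a D (∑ i, α i • m i) (∑ i, α i • m i)) =
      ∑ i, ∑ j, e (algebraMap A B (α i)) * (e (algebraMap A B (α j)) *
        e (coordPairing ψ a D (m j) (m i))) := by
    simp only [← algebraMap_smul B (_ : A) (_ : M), map_sum, map_smul, LinearMap.sum_apply,
      LinearMap.smul_apply, smul_eq_mul, map_mul, Finset.mul_sum]
  rw [DetHom.eqSMulAlong_iff HA HB e hA' hr] at hg ⊢
  rw [hg, ← coordPairing_apply, ← coordPairing_apply, h₁, h₁]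
  simp only [h]

end

namespace RelOrient

variable {K : Type u} [Field K] {X Y : Scheme.{u}} {f : X ⟶ Y} {q : Y ⟶ Spec (.of K)} {n : ℕ}
  {L : X.Modules} [IsIntegral X] [IsIntegral Y] [IsFinite f] [Surjective f]
  [SmoothOfRelativeDimension n (f ≫ q)] {ψ : RelativeOrientation f q n L}

lemma exists_isJacobianCoeff (V : Y.affineOpens) {a : Fin n → SecY q V}
    {δ : Fin n → Derivation K (SecY q V) (SecY q V)} {h : SecY q V} (H : IsFrame K a δ h)
    (hh : IsUnit h) {y : Y} (hy : y ∈ V.1) {ι : Type*} (e : Module.Basis ι (SecY q V) (SecL f q L V))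
    {x : X}
    (hx : x ∈ f ⁻¹ᵁ V.1) : ∃ g, IsJacobianCoeff ψ x g := by
  have hY := genericPoint_mem V.1 hy
  have := isDomain_secX f q V.1 (genericPoint_mem_preimage f V.1 hY)
  have := isDomain_secY q V.1 hY
  have := smooth_secX f q V.2 n
  have := faithfulSMul_secX f q V.1 hY
  have := finite_secX f q V.2
  have : Module.IsTorsionFree (SecX f q V) (SecL f q L V) := isTorsionFree_of_basis e
  obtain ⟨t, g, hg⟩ := exists_eqSMulAlong_jacobian_tmul_self (finrank_secX f q V.2 n) H hh
    (ψ.iso V) (evalX f q V x hx)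
  exact ⟨g, V, hx, t, hg⟩

/-- The relation defining the Jacobian coefficient can be verified over each affine neighbourhood. -/
lemma IsJacobianCoeff.exists_eqSMulAlong [SmoothOfRelativeDimension n q] (V : Y.affineOpens)
    {y : Y} (hy : y ∈ V.1) (hcl : IsClosed {y}) {ι : Type*} [Fintype ι]
    (b : ι → SecL f q L ⊤) (hb : ∀ V : Y.Opens, ∃ e : Module.Basis ι (SecY q V) (SecL f q L V),
      ∀ i, e i = resL f q L le_top (b i)) {x : X} (hxy : f x = y) (hx : x ∈ f ⁻¹ᵁ V.1)
    {g : X.residueField x} (hg : IsJacobianCoeff ψ x g) :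
    ∃ t : SecL f q L V, DetHom.EqSMulAlong (evalX f q V x hx) g
      (DetHom.jacobian n K (SecY q V) (SecX f q V)) (ψ.iso V (t ⊗ₜ t)) := by
  obtain ⟨V', hx', t, ht⟩ := hg
  have hy' : y ∈ V'.1 := hxy ▸ hx'
  obtain ⟨W, hyW, hWV, a', δ', h', hh', H'⟩ := exists_isFrame_of_mem q n (V.1 ⊓ V'.1)
    (y := y) ⟨hy, hy'⟩
  have hWV₁ : W.1 ≤ V.1 := fun z hz => (hWV hz).1
  have hWV₂ : W.1 ≤ V'.1 := fun z hz => (hWV hz).2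
  have hxW : x ∈ f ⁻¹ᵁ W.1 := by
    change f x ∈ W.1
    rwa [hxy]
  have hY := genericPoint_mem W.1 hyW
  have := isDomain_secX f q W.1 (genericPoint_mem_preimage f W.1 hY)
  have := smooth_secX f q W.2 n
  obtain ⟨eW, heW⟩ := hb W.1
  let t' := resL f q L hWV₂ t
  have hres (U : Y.affineOpens) (hWU : W.1 ≤ U.1) (hxU : x ∈ f ⁻¹ᵁ U.1) :
      (evalX f q W x hxW).comp (resX f q hWU).toRingHom = evalX f q U x hxU :=
    RingHom.ext fun z => congrArg (X.residue x)
      (X.presheaf.germ_res_apply (homOfLE (f.preimage_mono hWU)) x hxW z)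
  have h₁ := (eqSMulAlong_jacobian_psi_iff ψ V' W hWV₂ (evalX f q W x hxW) g t t).1
    (by rw [hres]; exact ht)
  have h₂ (i) : ∃ α : SecY q V, evalY q V y hy α = evalY q W y hyW (eW.repr t' i) :=
    evalY_surjective q V.2 hy hcl _
  choose α hα using h₂
  refine ⟨∑ i, α i • resL f q L le_top (b i), ?_⟩
  rw [← hres V hWV₁ hx, eqSMulAlong_jacobian_psi_iff ψ V W hWV₁]
  have h₃ : resL f q L hWV₁ (∑ i, α i • resL f q L le_top (b i)) =
      ∑ i, resY q hWV₁ (α i) • eW i := by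
    rw [map_sum]
    refine Finset.sum_congr rfl fun i _ => ?_
    rw [resL_smul', resL_resL, heW]
  rw [h₃]
  refine eqSMulAlong_tmul_self_congr (finrank_secX f q W.2 n) H' hh' (ψ.iso W)
    (evalX f q W x hxW) eW (fun i => eW.repr t' i) _ (fun i => ?_) g _ ?_
  · rw [← residueMap_evalY q W.1 hxy hyW, ← residueMap_evalY q W.1 hxy hyW, ← hα]
    congr 1
    exact congrArg (Y.residue y) (Y.presheaf.germ_res_apply (homOfLE hWV₁) y hyW (α i)).symm
  · rw [eW.sum_repr]
    exact h₁

end RelOrient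

/-! ### The degree -/

namespace RelOrient

variable {K : Type u} [Field K] {X Y : Scheme.{u}} {f : X ⟶ Y} {q : Y ⟶ Spec (.of K)} {n : ℕ}
  {L : X.Modules} [IsIntegral X] [IsIntegral Y] [IsFinite f] [Surjective f]
  [SmoothOfRelativeDimension n q] [SmoothOfRelativeDimension n (f ≫ q)]
  {ψ : RelativeOrientation f q n L}

set_option maxHeartbeats 1000000 in
/-- The trace form computes the degree. -/
lemma IsTraceForm.hasDegree (hsep : IsSeparableMorphism f) (hU : IsUlrich f L)
    (hK : Function.Bijective (scalars q ⊤)) {β : LinearMap.BilinForm K (SecL f q L ⊤)}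
    (hβ : IsTraceForm ψ β) : HasDegree ψ (GW.ofForm β) := by
  intro y hcl hnb
  obtain ⟨t, ht, b, hb⟩ := exists_basis_secL hU hK
  have : Nonempty (ULift.{u} (Fin t)) := ⟨⟨⟨0, ht⟩⟩⟩
  obtain ⟨V, hy, -, a, δ, h, hh, H⟩ := exists_isFrame_of_mem q n ⊤ (y := y) trivial
  obtain ⟨e, he⟩ := hb V.1
  have hY := genericPoint_mem V.1 hy
  have hX := genericPoint_mem_preimage f V.1 hY
  have := isDomain_secX f q V.1 hX
  have := isDomain_secY q V.1 hY
  have := smooth_secY q V.2 n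
  have := smooth_secX f q V.2 n
  have := faithfulSMul_secX f q V.1 hY
  have := finite_secX f q V.2
  have : IsNoetherianRing (SecX f q V) := Algebra.FiniteType.isNoetherianRing K _
  have : Module.IsTorsionFree (SecX f q V) (SecL f q L V) := isTorsionFree_of_basis e
  have hn := finrank_secX f q V.2 n
  let : Algebra Y.functionField X.functionField := (functionFieldMap f).toAlgebra
  let : Algebra (SecY q V) Y.functionField := (germY q V hY).toAlgebra
  let : Algebra (SecX f q V) X.functionField := (germX f q V hX).toAlgebra
  let : Algebra (SecY q V) X.functionField :=
    ((germX f q V hX).comp (algebraMap (SecY q V) (SecX f q V))).toAlgebra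
  have : IsScalarTower (SecY q V) (SecX f q V) X.functionField := .of_algebraMap_eq' rfl
  have : IsScalarTower (SecY q V) Y.functionField X.functionField :=
    .of_algebraMap_eq fun x => (functionFieldMap_germY f q V hY hX x).symm
  have : IsFractionRing (SecY q V) Y.functionField := isFractionRing_germY q V V.2 hY
  have : IsFractionRing (SecX f q V) X.functionField := isFractionRing_germX f q V V.2 hX
  have : Algebra.IsSeparable Y.functionField X.functionField := hsep
  have : FiniteDimensional Y.functionField X.functionField :=
    finiteDimensional_fractionRing (SecY q V) (SecX f q V) _ _
  have : Finite {x : X // f x = y} := (f.finite_preimage_singleton y).to_subtype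
  let := Fintype.ofFinite {x : X // f x = y}
  have hx (x : {x : X // f x = y}) : x.1 ∈ f ⁻¹ᵁ V.1 := by
    change f x.1 ∈ V.1
    rwa [x.2]
  let κ (x : {x : X // f x = y}) : Type u := X.residueField x.1
  let : ∀ x, Field (κ x) := fun x => inferInstanceAs (Field (X.residueField x.1))
  let : Algebra (SecY q V) (Y.residueField y) := (evalY q V y hy).toAlgebra
  let : ∀ x, Algebra (SecX f q V) (κ x) := fun x => (evalX f q V x.1 (hx x)).toAlgebra
  let : ∀ x, Algebra (SecY q V) (κ x) := fun x =>
    ((evalX f q V x.1 (hx x)).comp (algebraMap (SecY q V) (SecX f q V))).toAlgebra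
  let : ∀ x, Algebra (Y.residueField y) (κ x) := fun x => (residueMap f x.2).toAlgebra
  have : ∀ x, IsScalarTower (SecY q V) (SecX f q V) (κ x) := fun x => .of_algebraMap_eq' rfl
  have : ∀ x, IsScalarTower (SecY q V) (Y.residueField y) (κ x) := fun x =>
    .of_algebraMap_eq fun z => (residueMap_evalY q V.1 x.2 hy (hx x) z).symm
  have hpt (x : {x : X // f x = y}) := unramified_point q V.2 x.2 hy (hx x) (hnb x.1 x.2)
  have : ∀ x, FiniteDimensional (Y.residueField y) (κ x) := fun x => (hpt x).1.1
  have : ∀ x, Algebra.IsSeparable (Y.residueField y) (κ x) := fun x => (hpt x).1.2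
  let g (x : {x : X // f x = y}) : κ x := jacobianCoeff ψ x.1
  have hg (x) : IsJacobianCoeff ψ x.1 (g x) := by
    have h₁ := exists_isJacobianCoeff (ψ := ψ) V H hh hy e (hx x)
    change IsJacobianCoeff ψ x.1 (jacobianCoeff ψ x.1)
    rw [jacobianCoeff, dif_pos h₁]
    exact h₁.choose_spec
  obtain ⟨hg0, c, hc⟩ := exists_basis_fibre (LA := Y.functionField) (LB := X.functionField)
    (κ := κ) hn H hh (ψ.iso V) e (evalY_surjective q V.2 hy hcl)
    (fun x => evalX_surjective q V.2 x.2 hy (hx x) hcl)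
    (fun x x' hxx' => Subtype.ext (ker_evalX_injective q V.2 (hx x) (hx x') hxx'))
    (fun P hP hPy => by
      obtain ⟨x, hxV, hxy, hP'⟩ := exists_ker_evalX_eq q V.2 hy P hP hPy
      exact ⟨⟨x, hxy⟩, hP'⟩)
    (fun x => (hpt x).2.1) (fun x => (hpt x).2.2) g
    (fun x => (hg x).exists_eqSMulAlong V hy hcl b hb x.2 (hx x))
  have key := GW.sum_scaledTraceForm_eq_map (scalarsResidue q y) β (hβ.isSymm hsep hU)
    (hβ.nondegenerate hsep hU) g hg0 b c fun i j => by
      obtain ⟨w, hw⟩ := exists_isRatio ψ hsep hU (b i) (b j)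
      rw [hc i j w (algebraMap K (SecY q V) (β (b i) (b j))), scalarsResidue_eq q V.1 hy]
      · rfl
      · rw [he, he]
        exact hw V hX
      · rw [← hβ.germY_eq hsep hU hw, ← germY_resY q (le_top : V.1 ≤ ⊤) trivial hY,
          (resY q (le_top : V.1 ≤ ⊤)).commutes]
        rfl
  rw [degreeAt, finsum_eq_sum_of_fintype]
  exact key

end RelOrient

theorem theoremA {K : Type u} [Field K] {X Y : Scheme.{u}} (n : ℕ)
    (q : Y ⟶ Spec (.of K)) (f : X ⟶ Y)
    [IsIntegral X] [IsIntegral Y] [IsSeparated q] [LocallyOfFiniteType q] [QuasiCompact q]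
    [SmoothOfRelativeDimension n q] [SmoothOfRelativeDimension n (f ≫ q)]
    [IsFinite f] [Surjective f] (hsep : RelOrient.IsSeparableMorphism f)
    (L : X.Modules) (hL : RelOrient.IsLineBundle L) (ψ : RelOrient.RelativeOrientation f q n L)
    (hU : RelOrient.IsUlrich f L) (hK : Function.Bijective (RelOrient.scalars q ⊤)) :
    Module.Finite K (RelOrient.SecL f q L ⊤) ∧
    (∃! β : LinearMap.BilinForm K (RelOrient.SecL f q L ⊤), RelOrient.IsTraceForm ψ β) ∧
    ∀ β : LinearMap.BilinForm K (RelOrient.SecL f q L ⊤), RelOrient.IsTraceForm ψ β →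
      β.IsSymm ∧ β.Nondegenerate ∧ RelOrient.HasDegree ψ (GW.ofForm β) := by
  obtain ⟨t, -, b, -⟩ := RelOrient.exists_basis_secL hU hK
  exact ⟨.of_basis b, RelOrient.existsUnique_isTraceForm hsep hU hK, fun β hβ =>
    ⟨hβ.isSymm hsep hU, hβ.nondegenerate hsep hU, hβ.hasDegree hsep hU hK⟩⟩
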